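/- Let $g\ge 4$ and let $H_{\mathbb Q}$ be a symplectic vector space over $\mathbb Q$ of dimension $2g$ with pairing $u\cdot v$ and a fixed symplectic basis $x_1,\dots,x_g,y_1,\dots,y_g$ (so $x_i\cdot y_j=\delta_{ij}$, $y_i\cdot x_j=-\delta_{ij}$, $x_i\cdot x_j=y_i\cdot y_j=0$). Let $\mathrm{Sp}(H_{\mathbb Q})$ be the group of linear automorphisms of $H_{\mathbb Q}$ preserving the pairing, let $\omega_0=\sum_{i=1}^g(x_i\otimes y_i-y_i\otimes x_i)\in H_{\mathbb Q}^{\otimes 2}$, and let $\mathfrak a_g(2)$ be the space of derivations $D$ of the tensor algebra $T(H_{\mathbb Q})$ which are of degree $2$, that is $D(H_{\mathbb Q})\subseteq H_{\mathbb Q}^{\otimes 3}$, and satisfy $D(\omega_0)=0$; the group $\mathrm{Sp}(H_{\mathbb Q})$ acts on it by conjugation. For a Young diagram with row lengths $b_1\ge\dots\ge b_k$, $k\le g$, let $[b_1\cdots b_k]$ denote the irreducible representation of $\mathrm{Sp}(H_{\mathbb Q})$ with highest weight $(b_1,\dots,b_k,0,\dots,0)$, realized as the submodule of $T(H_{\mathbb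 Q})$ generated by the tensor product, over the columns of the diagram, of the vectors $x_1\wedge\dots\wedge x_m=\sum_{\tau\in\mathfrak S_m}\mathrm{sgn}(\tau)\,x_{\tau(1)}\otimes\dots\otimes x_{\tau(m)}$, where $m$ is the length of the column. Let $\mathbb Q$ denote the one-dimensional trivial representation. Then: 1. Poincaré duality $D\mapsto\sum_{i=1}^g\bigl(x_i\otimes D(y_i)-y_i\otimes D(x_i)\bigr)$ is an isomorphism of $\mathrm{Sp}(H_{\mathbb Q})$-modules $$\mathfrak a_g(2)\;\cong\;\bigl(H_{\mathbb Q}^{\otimes 4}\bigr)^{\mathbb Z/4\mathbb Z},$$ where $\mathbb Z/4\mathbb Z$ acts on $H_{\mathbb Q}^{\otimes 4}$ by cyclic permutations of the factors. 2. There is an isomorphism of $\mathrm{Sp}(H_{\mathbb Q})$-modules $$\mathfrak a_g(2)\;\cong\;\mathbb Q\oplus 2[1^2]\oplus[2]\oplus[2^2]\oplus[21^2]\oplus[4],$$ and the five modules $[1^2]$, $[2]$, $[2^2]$, $[21^2]$, $[4]$ are indeed irreducible with the indicated highest weights. -/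

import Mathlib

open scoped TensorProduct

namespace SympDer

noncomputable section

variable {H : Type*} [AddCommGroup H] [Module ℚ H]

/-- The symplectic group `Sp(H)`: linear automorphisms of `H` preserving the pairing `ω`. -/
def Sp (ω : LinearMap.BilinForm ℚ H) : Subgroup (H ≃ₗ[ℚ] H) where
  carrier := {a | ∀ u v, ω (a u) (a v) = ω u v}
  one_mem' := fun _ _ => rfl
  mul_mem' := fun {a c} ha hc u v => by
    rw [LinearEquiv.mul_apply, LinearEquiv.mul_apply, ha, hc]
  inv_mem' := fun {a} ha u v => by
    have h := ha (a⁻¹ u) (a⁻¹ v)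
    rw [← LinearEquiv.mul_apply, ← LinearEquiv.mul_apply, mul_inv_cancel] at h
    exact h.symm

/-- `b` is a symplectic basis `x_1, …, x_g, y_1, …, y_g` for `ω`, where `x_i = b (Sum.inl i)`
and `y_i = b (Sum.inr i)`. Its existence says that `(H, ω)` is a symplectic vector space of
dimension `2g`. -/
structure IsSymplecticBasis {g : ℕ} (ω : LinearMap.BilinForm ℚ H)
    (b : Module.Basis (Fin g ⊕ Fin g) ℚ H) : Prop where
  xx : ∀ i j, ω (b (Sum.inl i)) (b (Sum.inl j)) = 0
  yy : ∀ i j, ω (b (Sum.inr i)) (b (Sum.inr j)) = 0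
  xy : ∀ i j, ω (b (Sum.inl i)) (b (Sum.inr j)) = if i = j then 1 else 0
  yx : ∀ i j, ω (b (Sum.inr i)) (b (Sum.inl j)) = if i = j then -1 else 0

/-! ### The representations of `Sp(H)` on tensors -/

/-- The algebra endomorphism of `T(H)` induced by a linear endomorphism of `H`. -/
def tensorMap (f : H →ₗ[ℚ] H) : TensorAlgebra ℚ H →ₐ[ℚ] TensorAlgebra ℚ H :=
  TensorAlgebra.lift ℚ (TensorAlgebra.ι ℚ ∘ₗ f)

theorem tensorMap_ι (f : H →ₗ[ℚ] H) (h : H) :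
    tensorMap f (TensorAlgebra.ι ℚ h) = TensorAlgebra.ι ℚ (f h) :=
  TensorAlgebra.lift_ι_apply _ _

theorem tensorMap_id : tensorMap (LinearMap.id : H →ₗ[ℚ] H) = AlgHom.id ℚ _ := by
  refine TensorAlgebra.hom_ext (LinearMap.ext fun h => ?_)
  exact tensorMap_ι _ h

theorem tensorMap_comp (f f' : H →ₗ[ℚ] H) :
    tensorMap (f ∘ₗ f') = (tensorMap f).comp (tensorMap f') := by
  refine TensorAlgebra.hom_ext (LinearMap.ext fun h => ?_)
  simp [tensorMap_ι]

/-- The natural action of `Sp(H)` on the tensor algebra `T(H)`, by algebra automorphisms. -/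
def tensorRep (ω : LinearMap.BilinForm ℚ H) :
    Representation ℚ (Sp ω) (TensorAlgebra ℚ H) where
  toFun a := (tensorMap (a : H ≃ₗ[ℚ] H).toLinearMap).toLinearMap
  map_one' := by
    have h : ((1 : Sp ω) : H ≃ₗ[ℚ] H).toLinearMap = LinearMap.id := rfl
    rw [h, tensorMap_id]
    rfl
  map_mul' a c := by
    have h : ((a * c : Sp ω) : H ≃ₗ[ℚ] H).toLinearMap
        = (a : H ≃ₗ[ℚ] H).toLinearMap ∘ₗ (c : H ≃ₗ[ℚ] H).toLinearMap := rfl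
    rw [h, tensorMap_comp]
    rfl

/-- The diagonal action of `Sp(H)` on `H^{⊗n}`. -/
def tensorPowerRep (ω : LinearMap.BilinForm ℚ H) (n : ℕ) :
    Representation ℚ (Sp ω) (⨂[ℚ]^n H) where
  toFun a := PiTensorProduct.map fun _ => (a : H ≃ₗ[ℚ] H).toLinearMap
  map_one' := PiTensorProduct.map_id
  map_mul' a c := PiTensorProduct.map_mul (fun _ => (a : H ≃ₗ[ℚ] H).toLinearMap)
    (fun _ => (c : H ≃ₗ[ℚ] H).toLinearMap)

/-- The subrepresentation `(H^{⊗n})^{ℤ/n}` of tensors invariant under the cyclic group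
(generated by the `n`-cycle `finRotate n`) that permutes the tensor factors cyclically. -/
def cyclicInvariants (ω : LinearMap.BilinForm ℚ H) (n : ℕ) :
    Subrepresentation (tensorPowerRep ω n) where
  toSubmodule :=
    { carrier := {t | ∀ s ∈ Subgroup.zpowers (finRotate n),
        PiTensorProduct.reindex ℚ (fun _ => H) s t = t}
      add_mem' := fun ht hu s hs => by rw [map_add, ht s hs, hu s hs]
      zero_mem' := fun _ _ => map_zero _
      smul_mem' := fun c t ht s hs => by rw [map_smul, ht s hs] }
  apply_mem_toSubmodule a t ht s hs := by
    have h := PiTensorProduct.map_reindex (R := ℚ)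
      (f := fun _ : Fin n => (a : H ≃ₗ[ℚ] H).toLinearMap) s t
    rw [ht s hs] at h
    exact h.symm

/-! ### The Lie algebra of symplectic derivations of the tensor algebra -/

section Derivations

variable {g : ℕ}

/-- The symplectic class `ω₀ = ∑ᵢ (xᵢ ⊗ yᵢ - yᵢ ⊗ xᵢ)`, an element of degree `2` of `T(H)`. -/
def symplecticClass (b : Module.Basis (Fin g ⊕ Fin g) ℚ H) : TensorAlgebra ℚ H :=
  ∑ i : Fin g,
    (TensorAlgebra.ι ℚ (b (Sum.inl i)) * TensorAlgebra.ι ℚ (b (Sum.inr i))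
      - TensorAlgebra.ι ℚ (b (Sum.inr i)) * TensorAlgebra.ι ℚ (b (Sum.inl i)))

/-- `𝔞_g(k)`: derivations `D` of the tensor algebra which are of degree `k`, that is
`D(H) ⊆ H^{⊗(k+1)}`, and satisfy `D(ω₀) = 0`. (A derivation kills `1`, so these are
the same as derivations of the tensor algebra without unit.) -/
def symplecticDerivations (b : Module.Basis (Fin g ⊕ Fin g) ℚ H) (k : ℕ) :
    Submodule ℚ (Module.End ℚ (TensorAlgebra ℚ H)) where
  carrier := {D | (∀ s t, D (s * t) = D s * t + s * D t) ∧
    (∀ h : H, D (TensorAlgebra.ι ℚ h) ∈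
      (LinearMap.range (TensorAlgebra.ι ℚ : H →ₗ[ℚ] TensorAlgebra ℚ H)) ^ (k + 1)) ∧
    D (symplecticClass b) = 0}
  add_mem' := by
    rintro D E ⟨h1, h2, h3⟩ ⟨k1, k2, k3⟩
    refine ⟨fun s t => ?_, fun h => add_mem (h2 h) (k2 h), ?_⟩
    · simp only [LinearMap.add_apply, h1, k1, add_mul, mul_add]
      abel
    · rw [LinearMap.add_apply, h3, k3, add_zero]
  zero_mem' := ⟨fun s t => by simp, fun h => zero_mem _, rfl⟩
  smul_mem' := by
    rintro c D ⟨h1, h2, h3⟩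
    refine ⟨fun s t => ?_, fun h => Submodule.smul_mem _ c (h2 h), ?_⟩
    · simp only [LinearMap.smul_apply, h1, smul_add, smul_mul_assoc, mul_smul_comm]
    · rw [LinearMap.smul_apply, h3, smul_zero]

/-- The action of `Sp(H)` on linear endomorphisms of `T(H)` by conjugation `D ↦ a D a⁻¹`. -/
def conjRep (ω : LinearMap.BilinForm ℚ H) :
    Representation ℚ (Sp ω) (Module.End ℚ (TensorAlgebra ℚ H)) :=
  Representation.linHom (tensorRep ω) (tensorRep ω)

theorem tensorRep_ι (ω : LinearMap.BilinForm ℚ H) (a : Sp ω) (h : H) :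
    tensorRep ω a (TensorAlgebra.ι ℚ h) = TensorAlgebra.ι ℚ ((a : H ≃ₗ[ℚ] H) h) :=
  tensorMap_ι _ _

theorem tensorRep_mul (ω : LinearMap.BilinForm ℚ H) (a : Sp ω) (s t : TensorAlgebra ℚ H) :
    tensorRep ω a (s * t) = tensorRep ω a s * tensorRep ω a t :=
  map_mul (tensorMap (a : H ≃ₗ[ℚ] H).toLinearMap) s t

/-- The symplectic class is invariant under the symplectic group. -/
theorem tensorRep_symplecticClass {ω : LinearMap.BilinForm ℚ H}
    {b : Module.Basis (Fin g ⊕ Fin g) ℚ H} (hb : IsSymplecticBasis ω b) (a : Sp ω) :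
    tensorRep ω a (symplecticClass b) = symplecticClass b := by
  let d : Fin g ⊕ Fin g → H := Sum.elim (fun i => b (Sum.inr i)) (fun i => - b (Sum.inl i))
  have hω : symplecticClass b
      = ∑ k, TensorAlgebra.ι ℚ (b k) * TensorAlgebra.ι ℚ (d k) := by
    simp [symplecticClass, d, Fintype.sum_sum_type, sub_eq_add_neg, Finset.sum_add_distrib]
  have h1 : ∀ v, v = ∑ k, ω v (d k) • b k := by
    intro v
    have key : (LinearMap.id : H →ₗ[ℚ] H)
        = ∑ k, (LinearMap.toSpanSingleton ℚ H (b k)) ∘ₗ (ω.flip (d k)) := by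
      refine b.ext fun j => ?_
      rcases j with j | j <;>
      simp [d, Fintype.sum_sum_type, hb.xx, hb.yy, hb.xy, hb.yx]
    have := congrArg (fun f : H →ₗ[ℚ] H => f v) key
    simpa using this
  have h2 : ∀ v, v = ∑ k, ω (b k) v • d k := by
    intro v
    have key : (LinearMap.id : H →ₗ[ℚ] H)
        = ∑ k, (LinearMap.toSpanSingleton ℚ H (d k)) ∘ₗ (ω (b k)) := by
      refine b.ext fun j => ?_
      rcases j with j | j <;>
      simp [d, Fintype.sum_sum_type, hb.xx, hb.yy, hb.xy, hb.yx]
    have := congrArg (fun f : H →ₗ[ℚ] H => f v) key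
    simpa using this
  have h3 : ∀ k l, ω ((a : H ≃ₗ[ℚ] H) (b k)) (d l)
      = ω (b k) ((a : H ≃ₗ[ℚ] H).symm (d l)) := by
    intro k l
    have := a.2 (b k) ((a : H ≃ₗ[ℚ] H).symm (d l))
    rwa [LinearEquiv.apply_symm_apply] at this
  rw [hω, map_sum]
  simp only [tensorRep_mul, tensorRep_ι]
  calc ∑ k, TensorAlgebra.ι ℚ ((a : H ≃ₗ[ℚ] H) (b k)) * TensorAlgebra.ι ℚ ((a : H ≃ₗ[ℚ] H) (d k))
      = ∑ k, ∑ l, TensorAlgebra.ι ℚ (b l) *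
          TensorAlgebra.ι ℚ (ω (b k) ((a : H ≃ₗ[ℚ] H).symm (d l)) • (a : H ≃ₗ[ℚ] H) (d k)) := by
        refine Finset.sum_congr rfl fun k _ => ?_
        conv_lhs => rw [h1 ((a : H ≃ₗ[ℚ] H) (b k))]
        simp only [map_sum, map_smul, Finset.sum_mul, smul_mul_assoc, mul_smul_comm, h3]
    _ = ∑ l, TensorAlgebra.ι ℚ (b l) * TensorAlgebra.ι ℚ (d l) := by
        rw [Finset.sum_comm]
        refine Finset.sum_congr rfl fun l _ => ?_
        rw [← Finset.mul_sum, ← map_sum]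
        congr 2
        have := congrArg (a : H ≃ₗ[ℚ] H) (h2 ((a : H ≃ₗ[ℚ] H).symm (d l)))
        rw [LinearEquiv.apply_symm_apply, map_sum] at this
        simp only [map_smul] at this
        exact this.symm

/-- `𝔞_g(k)` as a representation of `Sp(H)`. -/
def symplecticDerivationsRep {ω : LinearMap.BilinForm ℚ H}
    {b : Module.Basis (Fin g ⊕ Fin g) ℚ H} (hb : IsSymplecticBasis ω b) (k : ℕ) :
    Subrepresentation (conjRep ω) where
  toSubmodule := symplecticDerivations b k
  apply_mem_toSubmodule a D := by
    rintro ⟨h1, h2, h3⟩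
    have hc : ∀ t, conjRep ω a D t = tensorRep ω a (D (tensorRep ω a⁻¹ t)) := fun _ => rfl
    refine ⟨fun s t => ?_, fun h => ?_, ?_⟩
    · have hi : ∀ t, tensorRep ω a (tensorRep ω a⁻¹ t) = t := fun t => by
        rw [← Module.End.mul_apply, ← map_mul, mul_inv_cancel, map_one, Module.End.one_apply]
      simp only [hc, tensorRep_mul, h1, map_add, hi]
    · rw [hc, tensorRep_ι]
      have hle : ((LinearMap.range (TensorAlgebra.ι ℚ : H →ₗ[ℚ] TensorAlgebra ℚ H)) ^ (k + 1)).map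
          (tensorMap (a : H ≃ₗ[ℚ] H).toLinearMap).toLinearMap
          ≤ (LinearMap.range (TensorAlgebra.ι ℚ : H →ₗ[ℚ] TensorAlgebra ℚ H)) ^ (k + 1) := by
        rw [Submodule.map_pow]
        refine pow_le_pow_left' ?_ _
        rintro _ ⟨_, ⟨v, rfl⟩, rfl⟩
        exact ⟨(a : H ≃ₗ[ℚ] H) v, (tensorRep_ι ω a v).symm⟩
      exact hle ⟨_, h2 _, rfl⟩
    · rw [hc, tensorRep_symplecticClass hb, h3, map_zero]

/-- The element `D* = ∑ᵢ (xᵢ ⊗ D(yᵢ) - yᵢ ⊗ D(xᵢ))` of `T(H)` that corresponds to the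
restriction of `D` to `H` under the Poincaré duality `H* ≅ H`. -/
def poincareDual (b : Module.Basis (Fin g ⊕ Fin g) ℚ H)
    (D : Module.End ℚ (TensorAlgebra ℚ H)) : TensorAlgebra ℚ H :=
  ∑ i : Fin g,
    (TensorAlgebra.ι ℚ (b (Sum.inl i)) * D (TensorAlgebra.ι ℚ (b (Sum.inr i)))
      - TensorAlgebra.ι ℚ (b (Sum.inr i)) * D (TensorAlgebra.ι ℚ (b (Sum.inl i))))

end Derivations

/-! ### Irreducible representations of `Sp(H)` indexed by Young diagrams -/

section Irreducible

variable {g : ℕ}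

/-- `x_1 ∧ ⋯ ∧ x_m = ∑_τ sgn(τ) x_{τ(1)} ⊗ ⋯ ⊗ x_{τ(m)}` in `H^{⊗m} ⊆ T(H)`
(zero if `m > g`). -/
def wedgeX (b : Module.Basis (Fin g ⊕ Fin g) ℚ H) (m : ℕ) : TensorAlgebra ℚ H :=
  if h : m ≤ g then
    ∑ τ : Equiv.Perm (Fin m), ((Equiv.Perm.sign τ : ℤ) : ℚ) •
      TensorAlgebra.tprod ℚ H m fun i => b (Sum.inl (Fin.castLE h (τ i)))
  else 0

/-- The standard highest weight vector attached to a Young diagram `μ`: the tensor product, over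
the columns of `μ`, of `x_1 ∧ ⋯ ∧ x_m`, where `m` is the length of the column. -/
def highestVector (b : Module.Basis (Fin g ⊕ Fin g) ℚ H) (μ : YoungDiagram) :
    TensorAlgebra ℚ H :=
  ((List.range (μ.rowLen 0)).map fun j => wedgeX b (μ.colLen j)).prod

/-- The representation `[μ]` of `Sp(H)` attached to a Young diagram `μ` (with at most `g` rows):
the submodule of `H^{⊗|μ|} ⊆ T(H)` generated by the standard highest weight vector. -/
def irrep (ω : LinearMap.BilinForm ℚ H) (b : Module.Basis (Fin g ⊕ Fin g) ℚ H)
    (μ : YoungDiagram) : Subrepresentation (tensorRep ω) where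
  toSubmodule := Submodule.span ℚ (Set.range fun a : Sp ω => tensorRep ω a (highestVector b μ))
  apply_mem_toSubmodule a v hv := by
    induction hv using Submodule.span_induction with
    | mem v hv =>
      obtain ⟨c, rfl⟩ := hv
      refine Submodule.subset_span ⟨a * c, ?_⟩
      simp only [map_mul, Module.End.mul_apply]
    | zero => rw [map_zero]; exact zero_mem _
    | add u v _ _ hu hv => rw [map_add]; exact add_mem hu hv
    | smul c v _ hv => rw [map_smul]; exact Submodule.smul_mem _ c hv

/-- `ρ` is an irreducible representation of `Sp(H)` with highest weight `μ`: it is irreducible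
and contains a nonzero vector on which each element `a` of the Borel subgroup stabilizing the flag
`⟨x_1⟩ ⊂ ⟨x_1, x_2⟩ ⊂ ⋯ ⊂ ⟨x_1, …, x_g⟩` acts by the character `∏ᵢ cᵢ ^ μᵢ`, where the `cᵢ` are
the diagonal entries of `a` on `x_1, …, x_g` and the `μᵢ` are the row lengths of `μ`. -/
def IsIrreducibleOfHighestWeight {ω : LinearMap.BilinForm ℚ H}
    (b : Module.Basis (Fin g ⊕ Fin g) ℚ H) {V : Type*} [AddCommGroup V] [Module ℚ V]
    (ρ : Representation ℚ (Sp ω) V) (μ : YoungDiagram) : Prop :=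
  ρ.IsIrreducible ∧ ∃ v : V, v ≠ 0 ∧ ∀ (a : Sp ω) (c : Fin g → ℚ),
    (∀ i, (a : H ≃ₗ[ℚ] H) (b (Sum.inl i)) - c i • b (Sum.inl i) ∈
      Submodule.span ℚ ((fun j => b (Sum.inl j)) '' {j : Fin g | j < i})) →
    ρ a v = (∏ i : Fin g, c i ^ μ.rowLen i) • v

/-- The Young diagram `[1²]`, given by its row lengths. -/
def yd11 : YoungDiagram := YoungDiagram.ofRowLens [1, 1] (by decide)

/-- The Young diagram `[2]`, given by its row lengths. -/
def yd2 : YoungDiagram := YoungDiagram.ofRowLens [2] (by decide)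

/-- The Young diagram `[2²]`, given by its row lengths. -/
def yd22 : YoungDiagram := YoungDiagram.ofRowLens [2, 2] (by decide)

/-- The Young diagram `[21²]`, given by its row lengths. -/
def yd211 : YoungDiagram := YoungDiagram.ofRowLens [2, 1, 1] (by decide)

/-- The Young diagram `[4]`, given by its row lengths. -/
def yd4 : YoungDiagram := YoungDiagram.ofRowLens [4] (by decide)

end Irreducible

end

end SympDer

/-!
# Symplectic derivations of degree two of the tensor algebra

A derivation `D` of `T(H)` is determined by its restriction to `H`, hence by the tensor `D*` that
corresponds to it under `H* ≅ H`. One has `D(ω₀) = D* - rot(D*)` (`derivation_symplecticClass`),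
where `rot` rotates the tensor factors cyclically. So `D ↦ D*` identifies `𝔞_g(2)` with the
cyclically invariant tensors of degree `4` (`range_poincareDualMap`), and it is equivariant because
`ω₀` is invariant (`poincareDual_conj`). Representations embedded equivariantly in `T(H)` with the
same image are isomorphic (`exists_equiv_of_range_eq`), so it remains to decompose the space of
these tensors.

**Complete reducibility.** Words in a symplectic basis form a basis of `T(H)`; let `inn` be the
inner product for which it is orthonormal. The group `Sp(H)` is closed under transposition, so
orthogonal complements of stable subspaces are stable (`inn_tensorRep_eq_zero`).

**Irreducibility.** By complete reducibility the module generated by `v` is irreducible as soon as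
`v` spans its weight space (`isIrreducible_irrep`). For the five diagrams this is read off from the
letters that occur in words of the given weight, which elements `x_i ↦ 2 x_i`, `y_i ↦ y_i / 2` of
the torus detect, and from the skew-symmetries of the tensors in `[μ]`.

**Harmonic tensors.** Let `z` be a tensor of degree `n ≤ g + 1` whose traces (contractions with the
pairing) vanish and that is killed by all raising operators `y_i ↦ x_j`, `y_j ↦ x_i`. Then `z` only
involves the `x_i` (`eq_zero_of_traceless_of_raising`): lowering back and pairing with `z` gives a
quadratic form in the coefficients of `z` that vanishes at `z`, and it is a sum of squares with
positive weight at each word that contains some `y_i`. Induction on the number of letters `y_i`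
shows that a stable module of traceless tensors without words in the `x_i` alone is zero
(`eq_zero_of_traceless_of_stable`). This replaces highest weight theory.

**Decomposition.** The modules `ℚ`, `[1²]`, `[1²]`, `[2]`, `[2²]`, `[21²]`, `[4]` are mapped to the
cyclically invariant tensors: `[2²]`, `[21²]` and `[4]` by cyclic symmetrization (up to a scalar in
the last case), and the others by inserting `ω₀` into a tensor of degree `2` at adjacent, and for
the second copy of `[1²]` at opposite positions. Independence of the images
(`eq_zero_of_sum_eq_zero`) is tested on coefficients of a few words. They span
(`range_summandsMap`): the orthogonal complement of the sum is traceless, since the sum contains all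
insertions of `ω₀` (`degree_two_le`), and it has no words in the `x_i`, since the sum contains the
cyclic symmetrizations of all such words, by polarization of highest weight vectors
(`cycX_mem_of_highestVector`). Hence it is zero.
-/

namespace SympDer

noncomputable section

variable {H : Type*} [AddCommGroup H] [Module ℚ H]

/-! ### Words in a basis -/

section Words

variable {κ : Type*}

/-- The basis of `T(H)` consisting of the words `b a₁ ⊗ ⋯ ⊗ b aₙ` in a basis `b` of `H`. -/
def wordBasis (b : Module.Basis κ ℚ H) : Module.Basis (List κ) ℚ (TensorAlgebra ℚ H) :=
  b.tensorAlgebra.reindex FreeMonoid.toList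

variable (b : Module.Basis κ ℚ H)

theorem wordBasis_apply (l : List κ) :
    wordBasis b l = (l.map fun a => TensorAlgebra.ι ℚ (b a)).prod := by
  have h : ∀ w : FreeMonoid κ, FreeAlgebra.basisFreeMonoid ℚ κ w
      = FreeMonoid.lift (FreeAlgebra.ι ℚ) w := by
    intro w
    simp [FreeAlgebra.basisFreeMonoid, FreeAlgebra.equivMonoidAlgebraFreeMonoid]
  simp only [wordBasis, Module.Basis.tensorAlgebra, Module.Basis.reindex_apply,
    Module.Basis.map_apply, h]
  induction l with
  | nil => simp
  | cons a l ih =>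
    simp only [FreeMonoid.toList_symm, FreeMonoid.ofList_cons, map_mul, FreeMonoid.lift_eval_of,
      AlgEquiv.toLinearEquiv_apply, List.map_cons, List.prod_cons,
      TensorAlgebra.equivFreeAlgebra_symm_ι] at ih ⊢
    rw [ih]

@[simp] theorem wordBasis_nil : wordBasis b [] = 1 := by simp [wordBasis_apply]

theorem wordBasis_cons (a : κ) (l : List κ) :
    wordBasis b (a :: l) = TensorAlgebra.ι ℚ (b a) * wordBasis b l := by
  simp [wordBasis_apply]

theorem wordBasis_append (l l' : List κ) :
    wordBasis b (l ++ l') = wordBasis b l * wordBasis b l' := by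
  simp [wordBasis_apply]

/-- The coefficient of the word `l` in a tensor. -/
def coeff (l : List κ) : TensorAlgebra ℚ H →ₗ[ℚ] ℚ := (wordBasis b).coord l

theorem coeff_wordBasis [DecidableEq κ] (l l' : List κ) :
    coeff b l (wordBasis b l') = if l' = l then 1 else 0 := by
  simp [coeff, Finsupp.single_apply]

theorem ext_coeff {s t : TensorAlgebra ℚ H} (h : ∀ l, coeff b l s = coeff b l t) : s = t :=
  (wordBasis b).ext_elem h

theorem coeff_ι_mul_cons (u : H) (t : TensorAlgebra ℚ H) (a : κ) (l : List κ) :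
    coeff b (a :: l) (TensorAlgebra.ι ℚ u * t) = b.repr u a * coeff b l t := by
  classical
  have h : (LinearMap.mul ℚ (TensorAlgebra ℚ H) ∘ₗ TensorAlgebra.ι ℚ).compr₂ (coeff b (a :: l))
      = (LinearMap.mul ℚ ℚ).compl₁₂ (b.coord a) (coeff b l) := by
    refine b.ext fun c => (wordBasis b).ext fun l' => ?_
    simp only [LinearMap.compr₂_apply, LinearMap.comp_apply, LinearMap.compl₁₂_apply,
      LinearMap.mul_apply', ← wordBasis_cons, coeff_wordBasis, Module.Basis.coord_apply,
      Module.Basis.repr_self, Finsupp.single_apply, List.cons.injEq]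
    split_ifs <;> simp_all
  simpa using LinearMap.congr_fun₂ h u t

theorem coeff_ι_mul_nil (u : H) (t : TensorAlgebra ℚ H) :
    coeff b [] (TensorAlgebra.ι ℚ u * t) = 0 := by
  classical
  have h : (LinearMap.mul ℚ (TensorAlgebra ℚ H) ∘ₗ TensorAlgebra.ι ℚ).compr₂ (coeff b [])
      = 0 := by
    refine b.ext fun c => (wordBasis b).ext fun l' => ?_
    simp only [LinearMap.compr₂_apply, LinearMap.comp_apply,
      LinearMap.mul_apply', ← wordBasis_cons, coeff_wordBasis]
    simp
  simpa using LinearMap.congr_fun₂ h u t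

theorem coeff_ι (u : H) (a : κ) : coeff b [a] (TensorAlgebra.ι ℚ u) = b.repr u a := by
  classical
  have := coeff_ι_mul_cons b u 1 a []
  rw [mul_one, ← wordBasis_nil b, coeff_wordBasis] at this
  simpa using this

/-- Two linear maps on `T(H)` agree if they agree on `1` and on all products `u ⊗ t`. -/
theorem linearMap_ext {V : Type*} [AddCommGroup V] [Module ℚ V]
    {f f' : TensorAlgebra ℚ H →ₗ[ℚ] V} (h1 : f 1 = f' 1)
    (h : ∀ (u : H) t, f (TensorAlgebra.ι ℚ u * t) = f' (TensorAlgebra.ι ℚ u * t)) : f = f' := by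
  refine (wordBasis (Module.Basis.ofVectorSpace ℚ H)).ext fun l => ?_
  cases l with
  | nil => simpa using h1
  | cons a l => rw [wordBasis_cons, h]

/-! ### Permuting the letters of words -/

/-- The linear endomorphism of `T(H)` given on words by a map `π` on lists of letters. -/
def wordMap (π : List κ → List κ) : TensorAlgebra ℚ H →ₗ[ℚ] TensorAlgebra ℚ H :=
  (wordBasis b).constr ℚ fun l => wordBasis b (π l)

@[simp] theorem wordMap_wordBasis (π : List κ → List κ) (l : List κ) :
    wordMap b π (wordBasis b l) = wordBasis b (π l) := by
  simp [wordMap]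

theorem coeff_wordMap {π : List κ → List κ} (hπ : Function.Injective π) (l : List κ)
    (t : TensorAlgebra ℚ H) : coeff b (π l) (wordMap b π t) = coeff b l t := by
  classical
  have h : coeff b (π l) ∘ₗ wordMap b π = coeff b l :=
    (wordBasis b).ext fun l' => by simp [coeff_wordBasis, hπ.eq_iff]
  exact LinearMap.congr_fun h t

/-- Cyclic rotation of the tensor factors of `T(H)`, moving the first factor to the end. -/
def rot : TensorAlgebra ℚ H →ₗ[ℚ] TensorAlgebra ℚ H := wordMap b fun l => l.rotate 1

theorem rot_one : rot b 1 = 1 := by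
  rw [← wordBasis_nil b, rot, wordMap_wordBasis]; rfl

theorem rot_ι_mul (u : H) (t : TensorAlgebra ℚ H) :
    rot b (TensorAlgebra.ι ℚ u * t) = t * TensorAlgebra.ι ℚ u := by
  have h : (LinearMap.mul ℚ (TensorAlgebra ℚ H) ∘ₗ TensorAlgebra.ι ℚ).compr₂ (rot b)
      = (LinearMap.mul ℚ (TensorAlgebra ℚ H)).flip ∘ₗ TensorAlgebra.ι ℚ := by
    refine b.ext fun c => (wordBasis b).ext fun l' => ?_
    simp only [LinearMap.compr₂_apply, LinearMap.comp_apply, LinearMap.flip_apply,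
      LinearMap.mul_apply', ← wordBasis_cons, rot, wordMap_wordBasis]
    simp [wordBasis_append, wordBasis_cons]
  simpa using LinearMap.congr_fun₂ h u t

theorem coeff_rot (a : κ) (l : List κ) (t : TensorAlgebra ℚ H) :
    coeff b (l ++ [a]) (rot b t) = coeff b (a :: l) t := by
  have := coeff_wordMap b (List.rotate_injective 1) (a :: l) t
  simpa [rot] using this

/-- The map on lists exchanging the first two letters. -/
def swapList : List κ → List κ
  | a :: c :: l => c :: a :: l
  | l => l

theorem swapList_injective : Function.Injective (swapList : List κ → List κ) := by
  have : Function.Involutive (swapList : List κ → List κ) := by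
    rintro (_ | ⟨a, _ | ⟨c, l⟩⟩) <;> rfl
  exact this.injective

/-- The linear endomorphism of `T(H)` exchanging the first two tensor factors. -/
def swap : TensorAlgebra ℚ H →ₗ[ℚ] TensorAlgebra ℚ H := wordMap b swapList

theorem swap_one : swap b 1 = 1 := by
  rw [← wordBasis_nil b, swap, wordMap_wordBasis]; rfl

theorem swap_ι (u : H) : swap b (TensorAlgebra.ι ℚ u) = TensorAlgebra.ι ℚ u := by
  have h : swap b ∘ₗ TensorAlgebra.ι ℚ = TensorAlgebra.ι ℚ := by
    refine b.ext fun c => ?_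
    have : TensorAlgebra.ι ℚ (b c) = wordBasis b [c] := by simp [wordBasis_cons]
    rw [LinearMap.comp_apply, this, swap, wordMap_wordBasis]; rfl
  exact LinearMap.congr_fun h u

theorem swap_ι_mul (u v : H) (t : TensorAlgebra ℚ H) :
    swap b (TensorAlgebra.ι ℚ u * (TensorAlgebra.ι ℚ v * t))
      = TensorAlgebra.ι ℚ v * (TensorAlgebra.ι ℚ u * t) := by
  have key : ∀ c d, swap b ∘ₗ LinearMap.mulLeft ℚ (TensorAlgebra.ι ℚ (b c)) ∘ₗ
        LinearMap.mulLeft ℚ (TensorAlgebra.ι ℚ (b d))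
      = LinearMap.mulLeft ℚ (TensorAlgebra.ι ℚ (b d)) ∘ₗ
        LinearMap.mulLeft ℚ (TensorAlgebra.ι ℚ (b c)) := by
    intro c d
    refine (wordBasis b).ext fun l => ?_
    simp only [LinearMap.comp_apply, LinearMap.mulLeft_apply, ← wordBasis_cons, swap,
      wordMap_wordBasis, swapList]
  have hu : ∀ c, swap b ∘ₗ LinearMap.mulLeft ℚ (TensorAlgebra.ι ℚ (b c)) ∘ₗ
        LinearMap.mulRight ℚ t ∘ₗ TensorAlgebra.ι ℚ
      = LinearMap.mulRight ℚ (TensorAlgebra.ι ℚ (b c) * t) ∘ₗ TensorAlgebra.ι ℚ := by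
    intro c
    refine b.ext fun d => ?_
    simpa [mul_assoc] using LinearMap.congr_fun (key c d) t
  have hv : swap b ∘ₗ LinearMap.mulRight ℚ (TensorAlgebra.ι ℚ v * t) ∘ₗ TensorAlgebra.ι ℚ
      = LinearMap.mulLeft ℚ (TensorAlgebra.ι ℚ v) ∘ₗ LinearMap.mulRight ℚ t ∘ₗ
        TensorAlgebra.ι ℚ := by
    refine b.ext fun c => ?_
    simpa [mul_assoc] using LinearMap.congr_fun (hu c) v
  simpa [mul_assoc] using LinearMap.congr_fun hv u

theorem coeff_swap (a c : κ) (l : List κ) (t : TensorAlgebra ℚ H) :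
    coeff b (a :: c :: l) (swap b t) = coeff b (c :: a :: l) t :=
  coeff_wordMap b swapList_injective (c :: a :: l) t

theorem tensorMap_rot (f : H →ₗ[ℚ] H) (t : TensorAlgebra ℚ H) :
    tensorMap f (rot b t) = rot b (tensorMap f t) := by
  have h : (tensorMap f).toLinearMap ∘ₗ rot b = rot b ∘ₗ (tensorMap f).toLinearMap := by
    refine linearMap_ext ?_ fun u t => ?_
    · simp [rot_one]
    · simp [rot_ι_mul, tensorMap_ι]
  exact LinearMap.congr_fun h t

theorem tensorMap_swap (f : H →ₗ[ℚ] H) (t : TensorAlgebra ℚ H) :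
    tensorMap f (swap b t) = swap b (tensorMap f t) := by
  have h : (tensorMap f).toLinearMap ∘ₗ swap b = swap b ∘ₗ (tensorMap f).toLinearMap := by
    refine linearMap_ext ?_ fun u t => ?_
    · simp [swap_one]
    · have : (tensorMap f).toLinearMap ∘ₗ swap b ∘ₗ LinearMap.mulLeft ℚ (TensorAlgebra.ι ℚ u)
          = swap b ∘ₗ (tensorMap f).toLinearMap ∘ₗ
            LinearMap.mulLeft ℚ (TensorAlgebra.ι ℚ u) := by
        refine linearMap_ext ?_ fun v t => ?_
        · simp [swap_ι, tensorMap_ι]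
        · simp [swap_ι_mul, tensorMap_ι]
      simpa using LinearMap.congr_fun this t
  exact LinearMap.congr_fun h t

/-! ### Homogeneous tensors -/

/-- The tensors `H^{⊗n} ⊆ T(H)` of degree `n`. -/
abbrev degree (H : Type*) [AddCommGroup H] [Module ℚ H] (n : ℕ) :
    Submodule ℚ (TensorAlgebra ℚ H) :=
  LinearMap.range (TensorAlgebra.ι ℚ : H →ₗ[ℚ] TensorAlgebra ℚ H) ^ n

theorem degree_eq_span (n : ℕ) :
    degree H n = Submodule.span ℚ (wordBasis b '' {l | l.length = n}) := by
  induction n with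
  | zero =>
    have : {l : List κ | l.length = 0} = {[]} := by ext; simp
    rw [this, Set.image_singleton, wordBasis_nil, degree, pow_zero, Submodule.one_eq_span]
  | succ n ih =>
    have h1 : LinearMap.range (TensorAlgebra.ι ℚ : H →ₗ[ℚ] TensorAlgebra ℚ H)
        = Submodule.span ℚ (Set.range fun a => TensorAlgebra.ι ℚ (b a)) := by
      rw [LinearMap.range_eq_map, ← b.span_eq, Submodule.map_span, ← Set.range_comp]; rfl
    rw [degree, pow_succ', ← degree, ih, h1, Submodule.span_mul_span]
    congr 1
    ext t
    simp only [Set.mem_mul, Set.mem_range, Set.mem_image, Set.mem_ofPred_eq]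
    constructor
    · rintro ⟨_, ⟨a, rfl⟩, _, ⟨l, hl, rfl⟩, rfl⟩
      exact ⟨a :: l, by simp [hl], wordBasis_cons b a l⟩
    · rintro ⟨l, hl, rfl⟩
      cases l with
      | nil => simp at hl
      | cons a l =>
        exact ⟨_, ⟨a, rfl⟩, _, ⟨l, by simpa using hl, rfl⟩, (wordBasis_cons b a l).symm⟩

theorem mem_degree_iff {n : ℕ} {t : TensorAlgebra ℚ H} :
    t ∈ degree H n ↔ ∀ l, l.length ≠ n → coeff b l t = 0 := by
  rw [degree_eq_span b, Module.Basis.mem_span_image]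
  refine ⟨fun h l hl => ?_, fun h l hl => ?_⟩
  · by_contra h0
    exact hl (h (Finsupp.mem_support_iff.2 h0))
  · by_contra h0
    exact (Finsupp.mem_support_iff.1 hl) (h l h0)

theorem wordBasis_mem_degree (l : List κ) : wordBasis b l ∈ degree H l.length := by
  rw [degree_eq_span b]
  exact Submodule.subset_span ⟨l, rfl, rfl⟩

theorem ι_mem_degree (u : H) : TensorAlgebra.ι ℚ u ∈ degree H 1 := by
  rw [degree, pow_one]; exact ⟨u, rfl⟩

theorem mul_mem_degree {m n : ℕ} {s t : TensorAlgebra ℚ H} (hs : s ∈ degree H m)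
    (ht : t ∈ degree H n) : s * t ∈ degree H (m + n) := by
  rw [degree, pow_add]; exact Submodule.mul_mem_mul hs ht

theorem map_mem_degree {n : ℕ} {f : TensorAlgebra ℚ H →ₗ[ℚ] TensorAlgebra ℚ H}
    (h : ∀ l : List κ, l.length = n → f (wordBasis b l) ∈ degree H n) {t : TensorAlgebra ℚ H}
    (ht : t ∈ degree H n) : f t ∈ degree H n := by
  have : (degree H n).map f ≤ degree H n := by
    conv_lhs => rw [degree_eq_span b]
    rw [Submodule.map_span, Submodule.span_le]
    rintro _ ⟨_, ⟨l, hl, rfl⟩, rfl⟩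
    exact h l hl
  exact this ⟨t, ht, rfl⟩

theorem rot_mem_degree {n : ℕ} {t : TensorAlgebra ℚ H} (ht : t ∈ degree H n) :
    rot b t ∈ degree H n :=
  map_mem_degree b (fun l hl => by
    rw [rot, wordMap_wordBasis, ← hl, ← List.length_rotate l 1]
    exact wordBasis_mem_degree b _) ht

theorem swap_mem_degree {n : ℕ} {t : TensorAlgebra ℚ H} (ht : t ∈ degree H n) :
    swap b t ∈ degree H n :=
  map_mem_degree b (fun l hl => by
    have : (swapList l).length = l.length := by rcases l with (_ | ⟨a, _ | ⟨c, l⟩⟩) <;> rfl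
    rw [swap, wordMap_wordBasis, ← hl, ← this]
    exact wordBasis_mem_degree b _) ht

theorem tensorMap_mem_degree (f : H →ₗ[ℚ] H) {n : ℕ} {t : TensorAlgebra ℚ H}
    (ht : t ∈ degree H n) : tensorMap f t ∈ degree H n := by
  have hle : (degree H n).map (tensorMap f).toLinearMap ≤ degree H n := by
    rw [Submodule.map_pow]
    refine pow_le_pow_left' ?_ _
    rintro _ ⟨_, ⟨v, rfl⟩, rfl⟩
    exact ⟨f v, (tensorMap_ι f v).symm⟩
  exact hle ⟨t, ht, rfl⟩

theorem finiteDimensional_degree {κ : Type*} [Finite κ] (b : Module.Basis κ ℚ H) (n : ℕ) :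
    FiniteDimensional ℚ (degree H n) := by
  rw [degree_eq_span b]
  exact FiniteDimensional.span_of_finite ℚ ((List.finite_length_eq κ n).image _)

theorem ext_degree_two {s t : TensorAlgebra ℚ H} (hs : s ∈ degree H 2) (ht : t ∈ degree H 2)
    (h : ∀ a c, coeff b [a, c] s = coeff b [a, c] t) : s = t := by
  refine ext_coeff b fun l => ?_
  by_cases hl : l.length = 2
  · obtain ⟨a, c, rfl⟩ := List.length_eq_two.1 hl
    exact h a c
  · rw [(mem_degree_iff b).1 hs l hl, (mem_degree_iff b).1 ht l hl]

theorem ext_degree_four {s t : TensorAlgebra ℚ H} (hs : s ∈ degree H 4) (ht : t ∈ degree H 4)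
    (h : ∀ a c d e, coeff b [a, c, d, e] s = coeff b [a, c, d, e] t) : s = t := by
  refine ext_coeff b fun l => ?_
  by_cases hl : l.length = 4
  · match l, hl with
    | [a, c, d, e], _ => exact h a c d e
  · rw [(mem_degree_iff b).1 hs l hl, (mem_degree_iff b).1 ht l hl]

end Words

/-! ### The inner product and complete reducibility -/

section InnerProduct

variable {κ : Type*} [DecidableEq κ] (b : Module.Basis κ ℚ H)

/-- The inner product on `T(H)` for which the words in the basis `b` are orthonormal. -/
def inn : TensorAlgebra ℚ H →ₗ[ℚ] TensorAlgebra ℚ H →ₗ[ℚ] ℚ := (wordBasis b).toDual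

theorem inn_wordBasis_left (l : List κ) (t : TensorAlgebra ℚ H) :
    inn b (wordBasis b l) t = coeff b l t :=
  (wordBasis b).toDual_apply_right l t

theorem inn_comm (s t : TensorAlgebra ℚ H) : inn b s t = inn b t s := by
  have h : inn b = (inn b).flip := by
    refine (wordBasis b).ext fun l => (wordBasis b).ext fun l' => ?_
    simp [inn, Module.Basis.toDual_apply, eq_comm]
  exact LinearMap.congr_fun₂ h s t

theorem eq_zero_of_inn_self {t : TensorAlgebra ℚ H} (h : inn b t t = 0) : t = 0 := by
  have h1 : inn b t t = ∑ l ∈ ((wordBasis b).repr t).support, coeff b l t ^ 2 := by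
    conv_lhs => enter [2]; rw [← (wordBasis b).linearCombination_repr t]
    rw [Finsupp.linearCombination_apply, Finsupp.sum, map_sum]
    refine Finset.sum_congr rfl fun l _ => ?_
    rw [map_smul, inn_comm, inn_wordBasis_left, smul_eq_mul, pow_two]
    rfl
  rw [h1, Finset.sum_eq_zero_iff_of_nonneg fun _ _ => sq_nonneg _] at h
  refine ext_coeff b fun l => ?_
  rw [map_zero]
  by_contra h0
  exact h0 (pow_eq_zero_iff two_ne_zero |>.1 (h l (Finsupp.mem_support_iff.2 h0)))

/-- Orthogonal projection of a tensor to a space of homogeneous tensors. -/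
theorem exists_orthogonal_projection [Finite κ] {n : ℕ} {W : Submodule ℚ (TensorAlgebra ℚ H)}
    (hW : W ≤ degree H n) (t : TensorAlgebra ℚ H) :
    ∃ w ∈ W, ∀ w' ∈ W, inn b w' (t - w) = 0 := by
  have := finiteDimensional_degree b n
  have : FiniteDimensional ℚ W := Submodule.finiteDimensional_of_le hW
  let φ : W →ₗ[ℚ] Module.Dual ℚ W := (inn b).compl₁₂ W.subtype W.subtype
  have hφ : Function.Injective φ := by
    rw [injective_iff_map_eq_zero]
    intro w hw
    exact Subtype.ext (eq_zero_of_inn_self b (LinearMap.congr_fun hw w))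
  have hs := (LinearMap.injective_iff_surjective_of_finrank_eq_finrank
    (Subspace.dual_finrank_eq (K := ℚ) (V := W)).symm).1 hφ
  obtain ⟨w, hw⟩ := hs ((inn b t).comp W.subtype)
  refine ⟨w, w.2, fun w' hw' => ?_⟩
  have := LinearMap.congr_fun hw ⟨w', hw'⟩
  rw [map_sub, inn_comm b w' t, inn_comm b w' w, sub_eq_zero]
  exact this.symm

theorem inn_ι_mul (u v : H) (s t : TensorAlgebra ℚ H) :
    inn b (TensorAlgebra.ι ℚ u * s) (TensorAlgebra.ι ℚ v * t) = b.toDual u v * inn b s t := by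
  have key : ∀ c l, inn b (wordBasis b (c :: l)) ∘ₗ LinearMap.mulLeft ℚ (TensorAlgebra.ι ℚ v)
      = b.toDual (b c) v • inn b (wordBasis b l) := by
    intro c l
    refine LinearMap.ext fun t => ?_
    simp only [LinearMap.comp_apply, LinearMap.mulLeft_apply, inn_wordBasis_left,
      coeff_ι_mul_cons, LinearMap.smul_apply, Module.Basis.toDual_apply_right, smul_eq_mul]
  have h : (LinearMap.mul ℚ (TensorAlgebra ℚ H) ∘ₗ TensorAlgebra.ι ℚ).compr₂
      ((inn b).flip (TensorAlgebra.ι ℚ v * t))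
      = (LinearMap.mul ℚ ℚ).compl₁₂ (b.toDual.flip v) ((inn b).flip t) := by
    refine b.ext fun c => (wordBasis b).ext fun l => ?_
    simpa [wordBasis_cons] using LinearMap.congr_fun (key c l) t
  simpa using LinearMap.congr_fun₂ h u s

theorem inn_one_ι_mul (u : H) (t : TensorAlgebra ℚ H) :
    inn b 1 (TensorAlgebra.ι ℚ u * t) = 0 := by
  rw [← wordBasis_nil b, inn_wordBasis_left, coeff_ι_mul_nil]

/-- Adjoint endomorphisms of `H` induce adjoint endomorphisms of `T(H)`. -/
theorem inn_tensorMap {f f' : H →ₗ[ℚ] H} (h : ∀ u v, b.toDual (f u) v = b.toDual u (f' v))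
    (s t : TensorAlgebra ℚ H) : inn b (tensorMap f s) t = inn b s (tensorMap f' t) := by
  suffices h : ∀ l l', inn b (tensorMap f (wordBasis b l)) (wordBasis b l')
      = inn b (wordBasis b l) (tensorMap f' (wordBasis b l')) by
    have h : (inn b) ∘ₗ (tensorMap f).toLinearMap = (inn b).compl₂ (tensorMap f').toLinearMap :=
      (wordBasis b).ext fun l => (wordBasis b).ext fun l' => by simpa using h l l'
    exact LinearMap.congr_fun₂ h s t
  intro l
  induction l with
  | nil =>
    intro l'
    cases l' with
    | nil => simp
    | cons a l' => simp [wordBasis_cons, tensorMap_ι, inn_one_ι_mul]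
  | cons a l ih =>
    intro l'
    cases l' with
    | nil => simp [wordBasis_cons, tensorMap_ι, inn_one_ι_mul, inn_comm b _ 1]
    | cons a' l' => simp [wordBasis_cons, tensorMap_ι, inn_ι_mul, h, ih]

end InnerProduct

section Symplectic

variable {g : ℕ} {ω : LinearMap.BilinForm ℚ H} {b : Module.Basis (Fin g ⊕ Fin g) ℚ H}

/-- The element of `Sp(H)` given by an endomorphism with a given inverse, preserving the pairing
on basis vectors. -/
def spOfInverse (b : Module.Basis (Fin g ⊕ Fin g) ℚ H) (f f' : H →ₗ[ℚ] H)
    (h : f ∘ₗ f' = LinearMap.id) (h' : f' ∘ₗ f = LinearMap.id)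
    (hω : ∀ k l, ω (f (b k)) (f (b l)) = ω (b k) (b l)) : Sp ω :=
  ⟨LinearEquiv.ofLinearMap f f' h h', fun u v => by
    have : ω.compl₁₂ f f = ω := b.ext fun k => b.ext fun l => hω k l
    exact LinearMap.congr_fun₂ this u v⟩

/-- The endomorphism `xᵢ ↦ yᵢ`, `yᵢ ↦ -xᵢ` of `H`. -/
def jMap (b : Module.Basis (Fin g ⊕ Fin g) ℚ H) : H →ₗ[ℚ] H :=
  b.constr ℚ (Sum.elim (fun i => b (Sum.inr i)) fun i => -b (Sum.inl i))

theorem jMap_inl (i : Fin g) : jMap b (b (Sum.inl i)) = b (Sum.inr i) := by simp [jMap]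

theorem jMap_inr (i : Fin g) : jMap b (b (Sum.inr i)) = -b (Sum.inl i) := by simp [jMap]

theorem jMap_jMap (v : H) : jMap b (jMap b v) = -v := by
  have : jMap b ∘ₗ jMap b = -LinearMap.id :=
    b.ext fun k => by rcases k with i | i <;> simp [jMap_inl, jMap_inr]
  exact LinearMap.congr_fun this v

theorem pairing_jMap_right (hb : IsSymplecticBasis ω b) (u v : H) :
    ω u (jMap b v) = b.toDual u v := by
  have : ω.compl₂ (jMap b) = b.toDual := by
    refine b.ext fun k => b.ext fun l => ?_
    rcases k with i | i <;> rcases l with j | j <;>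
      simp [jMap_inl, jMap_inr, hb.xx, hb.xy, hb.yx, hb.yy, Module.Basis.toDual_apply]
    split_ifs <;> simp
  exact LinearMap.congr_fun₂ this u v

/-- The element `xᵢ ↦ yᵢ`, `yᵢ ↦ -xᵢ` of `Sp(H)`. -/
def jSp (hb : IsSymplecticBasis ω b) : Sp ω :=
  spOfInverse b (jMap b) (-jMap b) (by ext; simp [jMap_jMap]) (by ext; simp [jMap_jMap])
    fun k l => by
      rcases k with i | i <;> rcases l with j | j <;>
        simp [jMap_inl, jMap_inr, hb.xx, hb.xy, hb.yx, hb.yy, eq_comm] <;>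
        split_ifs <;> simp

theorem jSp_apply (hb : IsSymplecticBasis ω b) (v : H) :
    ((jSp hb : Sp ω) : H ≃ₗ[ℚ] H) v = jMap b v := rfl

/-- The symplectic group is closed under transposition with respect to a symplectic basis: the
transpose of `a` is `J⁻¹ a⁻¹ J`. -/
theorem inn_tensorRep (hb : IsSymplecticBasis ω b) (a : Sp ω) (s t : TensorAlgebra ℚ H) :
    inn b (tensorRep ω a s) t = inn b s (tensorRep ω ((jSp hb)⁻¹ * a⁻¹ * jSp hb) t) := by
  refine inn_tensorMap b (fun u v => ?_) s t
  have h1 : ∀ c : Sp ω, ∀ u v, ω ((c : H ≃ₗ[ℚ] H) u) v = ω u (((c⁻¹ : Sp ω) : H ≃ₗ[ℚ] H) v) := by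
    intro c u v
    have h := c.2 u (((c⁻¹ : Sp ω) : H ≃ₗ[ℚ] H) v)
    rw [← h, ← LinearEquiv.mul_apply, ← Subgroup.coe_mul, mul_inv_cancel]
    rfl
  have h2 : ∀ w, jMap b ((((jSp hb)⁻¹ : Sp ω) : H ≃ₗ[ℚ] H) w) = w := by
    intro w
    rw [← jSp_apply hb, ← LinearEquiv.mul_apply, ← Subgroup.coe_mul, mul_inv_cancel]
    rfl
  rw [← pairing_jMap_right hb, ← pairing_jMap_right hb]
  change ω ((a : H ≃ₗ[ℚ] H) u) (jMap b v) = ω u (jMap b ((((jSp hb)⁻¹ : Sp ω) : H ≃ₗ[ℚ] H)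
    (((a⁻¹ : Sp ω) : H ≃ₗ[ℚ] H) (jMap b v))))
  rw [h2, h1]

/-- The orthogonal complement of an `Sp(H)`-stable space of tensors is `Sp(H)`-stable. -/
theorem inn_tensorRep_eq_zero (hb : IsSymplecticBasis ω b) {W : Submodule ℚ (TensorAlgebra ℚ H)}
    (hW : ∀ a : Sp ω, ∀ w ∈ W, tensorRep ω a w ∈ W) {t : TensorAlgebra ℚ H}
    (ht : ∀ w ∈ W, inn b w t = 0) (a : Sp ω) : ∀ w ∈ W, inn b w (tensorRep ω a t) = 0 := by
  intro w hw
  rw [inn_comm, inn_tensorRep hb, inn_comm]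
  exact ht _ (hW _ _ hw)

theorem highestVector_mem_irrep (μ : YoungDiagram) :
    highestVector b μ ∈ (irrep ω b μ).toSubmodule :=
  Submodule.subset_span ⟨1, by simp⟩

theorem irrep_le {μ : YoungDiagram} {W : Submodule ℚ (TensorAlgebra ℚ H)}
    (hW : ∀ a : Sp ω, ∀ w ∈ W, tensorRep ω a w ∈ W) (h : highestVector b μ ∈ W) :
    (irrep ω b μ).toSubmodule ≤ W := by
  refine Submodule.span_le.2 ?_
  rintro _ ⟨a, rfl⟩
  exact hW a _ h

/-- By complete reducibility, the module generated by a vector `v` is irreducible if `v` is, up to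
scalars, its only vector on which the group elements `τ i` act by the same scalars as on `v`. -/
theorem isIrreducible_irrep (hb : IsSymplecticBasis ω b) {μ : YoungDiagram} {n : ℕ}
    (hn : highestVector b μ ∈ degree H n) (h0 : highestVector b μ ≠ 0)
    {ι : Type*} (τ : ι → Sp ω) (χ : ι → ℚ)
    (h1 : ∀ i, tensorRep ω (τ i) (highestVector b μ) = χ i • highestVector b μ)
    (h2 : ∀ t ∈ (irrep ω b μ).toSubmodule, (∀ i, tensorRep ω (τ i) t = χ i • t) →
      ∃ c : ℚ, t = c • highestVector b μ) :
    (irrep ω b μ).toRepresentation.IsIrreducible := by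
  set v := highestVector b μ with hv
  have hle : (irrep ω b μ).toSubmodule ≤ degree H n :=
    irrep_le (fun a w hw => tensorMap_mem_degree _ hw) hn
  have hvm : v ∈ (irrep ω b μ).toSubmodule := highestVector_mem_irrep μ
  -- the alternative for a stable subspace `W`, inside the tensor algebra
  have key : ∀ W : Submodule ℚ (TensorAlgebra ℚ H), W ≤ (irrep ω b μ).toSubmodule →
      (∀ a : Sp ω, ∀ w ∈ W, tensorRep ω a w ∈ W) → W = ⊥ ∨ W = (irrep ω b μ).toSubmodule := by
    intro W hWi hW
    obtain ⟨w, hw, hort⟩ := exists_orthogonal_projection b (hWi.trans hle) v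
    -- the projection `w` of `v` has the same weight as `v`
    have hwt : ∀ i, tensorRep ω (τ i) w = χ i • w := by
      intro i
      have hmem : tensorRep ω (τ i) w - χ i • w ∈ W := sub_mem (hW _ w hw) (W.smul_mem _ hw)
      have heq : tensorRep ω (τ i) w - χ i • w
          = -(tensorRep ω (τ i) (v - w) - χ i • (v - w)) := by
        rw [map_sub, h1 i]; module
      refine sub_eq_zero.1 (eq_zero_of_inn_self b ?_)
      conv_lhs => enter [2]; rw [heq]
      rw [map_neg, map_sub, map_smul, hort _ hmem, inn_tensorRep_eq_zero hb hW hort _ _ hmem]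
      simp
    obtain ⟨c, hc⟩ := h2 w (hWi hw) hwt
    by_cases hc0 : c = 0
    · left
      rw [hc, hc0, zero_smul, sub_zero] at hort
      rw [eq_bot_iff]
      intro u hu
      let P : Submodule ℚ (TensorAlgebra ℚ H) :=
        { carrier := {t | ∀ w' ∈ W, inn b w' t = 0}
          add_mem' := fun hs ht w' hw' => by rw [map_add, hs w' hw', ht w' hw', add_zero]
          zero_mem' := fun w' _ => map_zero _
          smul_mem' := fun c t ht w' hw' => by rw [map_smul, ht w' hw', smul_zero] }
      have hP : (irrep ω b μ).toSubmodule ≤ P :=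
        irrep_le (fun a t ht => inn_tensorRep_eq_zero hb hW ht a) hort
      exact eq_zero_of_inn_self b (hP (hWi hu) u hu)
    · right
      refine le_antisymm hWi (irrep_le hW ?_)
      have : v = c⁻¹ • w := by rw [hc, smul_smul, inv_mul_cancel₀ hc0, one_smul]
      rw [← hv, this]
      exact W.smul_mem _ hw
  refine { exists_pair_ne := ⟨⊥, ⊤, fun h => ?_⟩, eq_bot_or_eq_top := fun W => ?_ }
  · have : (⟨v, hvm⟩ : (irrep ω b μ).toSubmodule) ∈
        (⊥ : Subrepresentation (irrep ω b μ).toRepresentation).toSubmodule := by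
      rw [h]; exact Submodule.mem_top
    exact h0 (congrArg Subtype.val ((Submodule.mem_bot ℚ).1 this))
  · have hsub := key (W.toSubmodule.map (irrep ω b μ).toSubmodule.subtype)
      (Submodule.map_subtype_le _ _) (by
        rintro a _ ⟨w, hw, rfl⟩
        exact ⟨_, W.apply_mem_toSubmodule a hw, rfl⟩)
    refine hsub.imp (fun h => ?_) fun h => ?_
    · refine Subrepresentation.toSubmodule_injective ?_
      exact Submodule.map_injective_of_injective (Submodule.subtype_injective _)
        (h.trans (Submodule.map_bot _).symm)
    · refine Subrepresentation.toSubmodule_injective ?_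
      exact Submodule.map_injective_of_injective (Submodule.subtype_injective _)
        (h.trans (Submodule.map_subtype_top _).symm)

end Symplectic

/-! ### Harmonic tensors -/

section Harmonic

open Function

/-- Summing a function of words over all words and all values of one letter. -/
theorem sum_sum_update {ι α : Type*} [Fintype ι] [DecidableEq ι] [Fintype α]
    (f : (ι → α) → ℚ) (p : ι) :
    ∑ m, ∑ a, f (update m p a) = Fintype.card α * ∑ m, f m := by
  let e : (ι → α) × α ≃ (ι → α) × α :=
    { toFun := fun x => (update x.1 p x.2, x.1 p)
      invFun := fun x => (update x.1 p x.2, x.1 p)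
      left_inv := fun x => by simp
      right_inv := fun x => by simp }
  have h := Equiv.sum_comp e fun x : (ι → α) × α => f x.1
  simp only [Fintype.sum_prod_type, e, Equiv.coe_fn_mk, Finset.sum_const, Finset.card_univ,
    nsmul_eq_mul] at h
  rw [h, Finset.mul_sum]

variable {g n : ℕ} {z : (Fin n → Fin g ⊕ Fin g) → ℚ}

/-- The contribution of the traces to the quadratic form is a sum of squares. -/
theorem trace_term_nonneg (hg : 0 < g)
    (hT : ∀ p q, p ≠ q → ∀ m, ∑ i : Fin g, z (update (update m p (Sum.inl i)) q (Sum.inr i))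
      = ∑ i : Fin g, z (update (update m p (Sum.inr i)) q (Sum.inl i)))
    {p q : Fin n} (hpq : p ≠ q) :
    0 ≤ ∑ m, ∑ a : Fin g, if m p = Sum.inr a ∧ m q = Sum.inl a then
      z m * ∑ j : Fin g, z (update (update m p (Sum.inl j)) q (Sum.inr j)) else 0 := by
  set f : (Fin n → Fin g ⊕ Fin g) → ℚ := fun m =>
    ∑ a : Fin g, if m p = Sum.inr a ∧ m q = Sum.inl a then
      z m * ∑ j : Fin g, z (update (update m p (Sum.inl j)) q (Sum.inr j)) else 0 with hf
  have h1 := sum_sum_update f q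
  have h2 := sum_sum_update (fun m => ∑ c, f (update m q c)) p
  rw [h1] at h2
  have h3 : ∀ m, ∑ a, ∑ c, f (update (update m p a) q c)
      = (∑ j : Fin g, z (update (update m p (Sum.inl j)) q (Sum.inr j))) ^ 2 := by
    intro m
    have hτ : ∀ (a c : Fin g ⊕ Fin g),
        ∑ j : Fin g, z (update (update (update (update m p a) q c) p (Sum.inl j)) q (Sum.inr j))
        = ∑ j : Fin g, z (update (update m p (Sum.inl j)) q (Sum.inr j)) := by
      intro a c
      refine Finset.sum_congr rfl fun j _ => ?_
      rw [update_comm hpq.symm, update_idem, update_idem]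
    simp only [hf, hτ, update_self, update_of_ne hpq]
    rw [pow_two]
    simp only [Fintype.sum_sum_type, Sum.inr.injEq, reduceCtorEq, Sum.inl.injEq,
      if_false, Finset.sum_const_zero, zero_add, add_zero, ite_and]
    simp only [Finset.sum_ite_eq, Finset.sum_ite_eq', Finset.mem_univ, if_true,
      Finset.sum_const_zero, add_zero]
    rw [← Finset.sum_mul, hT p q hpq m]
  have h4 : 0 ≤ (Fintype.card (Fin g ⊕ Fin g) : ℚ) * ((Fintype.card (Fin g ⊕ Fin g) : ℚ)
      * ∑ m, f m) := by
    rw [← h2]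
    exact Finset.sum_nonneg fun m _ => by rw [h3]; positivity
  have hc : 0 < (Fintype.card (Fin g ⊕ Fin g) : ℚ) := by
    simp only [Fintype.card_sum, Fintype.card_fin]
    exact_mod_cast (by omega : 0 < g + g)
  exact nonneg_of_mul_nonneg_right (nonneg_of_mul_nonneg_right h4 hc) hc

/-- Applying the raising operators `y_a ↦ x_j`, `y_j ↦ x_a` and lowering back, summed over `j`. -/
theorem casimir_identity
    (hF : ∀ i j m, ∑ p, ((if m p = Sum.inl j then z (update m p (Sum.inr i)) else 0)
      + if m p = Sum.inl i then z (update m p (Sum.inr j)) else 0) = 0)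
    {m : Fin n → Fin g ⊕ Fin g} {p : Fin n} {a : Fin g} (hm : m p = Sum.inr a) :
    (g + 1) * z m + ∑ q ∈ Finset.univ.erase p,
      ((if (m q).isLeft then z (m ∘ Equiv.swap p q) else 0)
      + if m q = Sum.inl a then
          ∑ j : Fin g, z (update (update m p (Sum.inl j)) q (Sum.inr j)) else 0) = 0 := by
  have h : ∑ j : Fin g, ∑ q, ((if update m p (Sum.inl j) q = Sum.inl j then
        z (update (update m p (Sum.inl j)) q (Sum.inr a)) else 0)
      + if update m p (Sum.inl j) q = Sum.inl a then
        z (update (update m p (Sum.inl j)) q (Sum.inr j)) else 0) = 0 :=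
    Finset.sum_eq_zero fun j _ => hF a j (update m p (Sum.inl j))
  rw [Finset.sum_comm, ← Finset.add_sum_erase _ _ (Finset.mem_univ p)] at h
  convert h using 1
  congr 1
  · have : ∀ j, update (update m p (Sum.inl j)) p (Sum.inr a) = m := fun j => by
      rw [update_idem, ← hm, update_eq_self]
    simp only [update_self, if_true, this, Finset.sum_add_distrib, Finset.sum_const,
      Finset.card_univ, Fintype.card_fin, nsmul_eq_mul, Sum.inl.injEq]
    rw [Finset.sum_ite_eq' Finset.univ a, if_pos (Finset.mem_univ _), this]
    ring
  · refine Finset.sum_congr rfl fun q hq => ?_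
    have hqp : q ≠ p := Finset.ne_of_mem_erase hq
    simp only [update_of_ne hqp, Finset.sum_add_distrib]
    congr 1
    · rcases hmq : m q with c | c
      · simp only [Sum.isLeft_inl, if_true, Sum.inl.injEq]
        rw [Finset.sum_ite_eq Finset.univ c, if_pos (Finset.mem_univ _)]
        congr 1
        ext1 r
        rcases eq_or_ne r p with rfl | hrp
        · simp [hqp.symm, hmq]
        · rcases eq_or_ne r q with rfl | hrq
          · simp [hm]
          · simp [hrp, hrq, Equiv.swap_apply_of_ne_of_ne]
      · simp
    · split_ifs <;> simp

/-- A traceless tensor `z` of degree `n ≤ g + 1` that is killed by the raising operators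
`y_i ↦ x_j`, `y_j ↦ x_i` only involves the `x_i`. The identity `casimir_identity`, multiplied by
`z m` and summed over all words `m` and all places `p` of a letter `y` in `m`, exhibits zero as a
quadratic form in `z`. Its mixed terms `z m * z (m ∘ swap p q)` are bounded by the squares, and what
remains is positive definite on words with a letter `y` as long as `n ≤ g + 1`. -/
theorem eq_zero_of_traceless_of_raising (hn : n ≤ g + 1)
    (hF : ∀ i j m, ∑ p, ((if m p = Sum.inl j then z (update m p (Sum.inr i)) else 0)
      + if m p = Sum.inl i then z (update m p (Sum.inr j)) else 0) = 0)
    (hT : ∀ p q, p ≠ q → ∀ m, ∑ i : Fin g, z (update (update m p (Sum.inl i)) q (Sum.inr i))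
      = ∑ i : Fin g, z (update (update m p (Sum.inr i)) q (Sum.inl i)))
    {m : Fin n → Fin g ⊕ Fin g} {p : Fin n} {a : Fin g} (hm : m p = Sum.inr a) : z m = 0 := by
  -- the indicator functions of the `y`'s and of the `x`'s
  let r : Fin g ⊕ Fin g → ℚ := Sum.elim (fun _ => 0) fun _ => 1
  let l : Fin g ⊕ Fin g → ℚ := Sum.elim (fun _ => 1) fun _ => 0
  have hr0 : ∀ u, 0 ≤ r u := by rintro (u | u) <;> simp [r]
  have hl0 : ∀ u, 0 ≤ l u := by rintro (u | u) <;> simp [l]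
  have hl1 : ∀ u, l u ≤ 1 := by rintro (u | u) <;> simp [l]
  have hg : 0 < g := a.pos
  have hid : ∀ (m : Fin n → Fin g ⊕ Fin g) p, r (m p) * ((g + 1) * z m ^ 2)
      + ∑ q ∈ Finset.univ.erase p, (r (m p) * l (m q) * (z m * z (m ∘ Equiv.swap p q))
        + ∑ a : Fin g, if m p = Sum.inr a ∧ m q = Sum.inl a then
          z m * ∑ j : Fin g, z (update (update m p (Sum.inl j)) q (Sum.inr j)) else 0) = 0 := by
    intro m p
    rcases hmp : m p with c | c
    · simp [r]
    · have := congrArg (z m * ·) (casimir_identity hF hmp)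
      simp only [mul_zero, mul_add, Finset.mul_sum] at this
      refine Eq.trans ?_ this
      simp only [r, Sum.elim_inr, one_mul, Sum.inr.injEq, ite_and]
      congr 1
      · ring
      · refine Finset.sum_congr rfl fun q _ => ?_
        congr 1
        · rcases m q with d | d <;> simp [l]
        · rw [Finset.sum_ite_eq, if_pos (Finset.mem_univ _)]
          simp [Finset.mul_sum]
  have hswap : ∀ p q : Fin n, ∑ m : Fin n → Fin g ⊕ Fin g,
      r (m p) * l (m q) * z (m ∘ Equiv.swap p q) ^ 2
      = ∑ m : Fin n → Fin g ⊕ Fin g, r (m q) * l (m p) * z m ^ 2 := by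
    intro p q
    refine Fintype.sum_equiv ((Equiv.swap p q).arrowCongr (Equiv.refl _)) _ _ fun m => ?_
    simp [Equiv.arrowCongr, Function.comp_def]
  have hle : ∑ m : Fin n → Fin g ⊕ Fin g, ∑ p, r (m p) * ((g + 1 - ∑ q ∈ Finset.univ.erase p,
      l (m q)) * z m ^ 2) ≤ 0 := by
    have h0 : ∑ p, ∑ m : Fin n → Fin g ⊕ Fin g, (r (m p) * ((g + 1) * z m ^ 2)
      + ∑ q ∈ Finset.univ.erase p, (r (m p) * l (m q) * (z m * z (m ∘ Equiv.swap p q))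
        + ∑ a : Fin g, if m p = Sum.inr a ∧ m q = Sum.inl a then
          z m * ∑ j : Fin g, z (update (update m p (Sum.inl j)) q (Sum.inr j)) else 0)) = 0 :=
      Finset.sum_eq_zero fun p _ => Finset.sum_eq_zero fun m _ => hid m p
    -- the mixed terms are at least minus the mean of two squares, the trace terms are nonnegative
    have hpq : ∀ p, ∀ q ∈ Finset.univ.erase p,
        ∑ m : Fin n → Fin g ⊕ Fin g, (-(1 / 2) * (r (m p) * l (m q) * z m ^ 2)
          - 1 / 2 * (r (m q) * l (m p) * z m ^ 2))
        ≤ ∑ m : Fin n → Fin g ⊕ Fin g, (r (m p) * l (m q) * (z m * z (m ∘ Equiv.swap p q))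
        + ∑ a : Fin g, if m p = Sum.inr a ∧ m q = Sum.inl a then
          z m * ∑ j : Fin g, z (update (update m p (Sum.inl j)) q (Sum.inr j)) else 0) := by
      intro p q hq
      have ht := trace_term_nonneg hg hT (Finset.ne_of_mem_erase hq).symm
      have hs : ∑ m : Fin n → Fin g ⊕ Fin g, (-(1 / 2) * (r (m p) * l (m q) * z m ^ 2)
          - 1 / 2 * (r (m p) * l (m q) * z (m ∘ Equiv.swap p q) ^ 2))
          ≤ ∑ m : Fin n → Fin g ⊕ Fin g, r (m p) * l (m q) * (z m * z (m ∘ Equiv.swap p q)) := by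
        refine Finset.sum_le_sum fun m _ => ?_
        have := mul_nonneg (mul_nonneg (hr0 (m p)) (hl0 (m q)))
          (sq_nonneg (z m + z (m ∘ Equiv.swap p q)))
        linarith
      rw [Finset.sum_sub_distrib, ← Finset.mul_sum, ← Finset.mul_sum] at hs ⊢
      rw [hswap] at hs
      rw [Finset.sum_add_distrib]
      linarith
    -- exchanging `p` and `q` identifies the two squares
    have hsym : ∑ p, ∑ q ∈ Finset.univ.erase p, ∑ m : Fin n → Fin g ⊕ Fin g,
        r (m q) * l (m p) * z m ^ 2
        = ∑ p, ∑ q ∈ Finset.univ.erase p, ∑ m : Fin n → Fin g ⊕ Fin g,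
        r (m p) * l (m q) * z m ^ 2 := by
      refine Finset.sum_comm' fun p q => ?_
      simp [eq_comm]
    have h1 : ∑ p, ∑ q ∈ Finset.univ.erase p, ∑ m : Fin n → Fin g ⊕ Fin g,
        (-(1 / 2) * (r (m p) * l (m q) * z m ^ 2) - 1 / 2 * (r (m q) * l (m p) * z m ^ 2))
        = - ∑ p, ∑ q ∈ Finset.univ.erase p, ∑ m : Fin n → Fin g ⊕ Fin g,
        r (m p) * l (m q) * z m ^ 2 := by
      simp only [Finset.sum_sub_distrib, ← Finset.mul_sum]
      rw [hsym]
      ring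
    have h2 := Finset.sum_le_sum fun p (_ : p ∈ Finset.univ) => Finset.sum_le_sum (hpq p)
    rw [h1] at h2
    simp only [Finset.sum_add_distrib (f := fun m : Fin n → Fin g ⊕ Fin g => r _ * _)] at h0
    rw [Finset.sum_add_distrib] at h0
    have h3 : ∑ m : Fin n → Fin g ⊕ Fin g, ∑ p, r (m p) * ((g + 1 - ∑ q ∈ Finset.univ.erase p,
        l (m q)) * z m ^ 2)
        = ∑ p, ∑ m : Fin n → Fin g ⊕ Fin g, r (m p) * ((g + 1) * z m ^ 2)
          - ∑ p, ∑ q ∈ Finset.univ.erase p, ∑ m : Fin n → Fin g ⊕ Fin g,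
            r (m p) * l (m q) * z m ^ 2 := by
      rw [Finset.sum_comm, ← Finset.sum_sub_distrib]
      refine Finset.sum_congr rfl fun p _ => ?_
      rw [Finset.sum_comm (s := Finset.univ.erase p), ← Finset.sum_sub_distrib]
      refine Finset.sum_congr rfl fun m _ => ?_
      rw [sub_mul, mul_sub, Finset.sum_mul, Finset.mul_sum]
      simp only [mul_assoc]
    rw [h3]
    have h4 : ∑ p, ∑ m : Fin n → Fin g ⊕ Fin g, ∑ q ∈ Finset.univ.erase p,
        (r (m p) * l (m q) * (z m * z (m ∘ Equiv.swap p q))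
        + ∑ a : Fin g, if m p = Sum.inr a ∧ m q = Sum.inl a then
          z m * ∑ j : Fin g, z (update (update m p (Sum.inl j)) q (Sum.inr j)) else 0)
        = ∑ p, ∑ q ∈ Finset.univ.erase p, ∑ m : Fin n → Fin g ⊕ Fin g,
        (r (m p) * l (m q) * (z m * z (m ∘ Equiv.swap p q))
        + ∑ a : Fin g, if m p = Sum.inr a ∧ m q = Sum.inl a then
          z m * ∑ j : Fin g, z (update (update m p (Sum.inl j)) q (Sum.inr j)) else 0) :=
      Finset.sum_congr rfl fun p _ => Finset.sum_comm
    linarith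
  -- every coefficient of the quadratic form is nonnegative, and positive where a `y` occurs
  have hpos : ∀ (m : Fin n → Fin g ⊕ Fin g) p,
      0 < (g + 1 - ∑ q ∈ Finset.univ.erase p, l (m q) : ℚ) := by
    intro m p
    have h := Finset.sum_le_card_nsmul (Finset.univ.erase p) (fun q => l (m q)) 1 fun q _ => hl1 _
    rw [Finset.card_erase_of_mem (Finset.mem_univ p), Finset.card_univ, Fintype.card_fin,
      nsmul_eq_mul, mul_one] at h
    have : ((n - 1 : ℕ) : ℚ) ≤ g := by exact_mod_cast (by omega : n - 1 ≤ g)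
    linarith
  have hnn : ∀ (m : Fin n → Fin g ⊕ Fin g) p, 0 ≤ r (m p) * ((g + 1 -
      ∑ q ∈ Finset.univ.erase p, l (m q)) * z m ^ 2) := fun m p =>
    mul_nonneg (hr0 _) (mul_nonneg (hpos m p).le (sq_nonneg _))
  have h0 := le_antisymm hle (Finset.sum_nonneg fun m _ => Finset.sum_nonneg fun p _ => hnn m p)
  rw [Finset.sum_eq_zero_iff_of_nonneg fun m _ => Finset.sum_nonneg fun p _ => hnn m p] at h0
  have h1 := h0 m (Finset.mem_univ _)
  rw [Finset.sum_eq_zero_iff_of_nonneg fun p _ => hnn m p] at h1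
  have h2 := h1 p (Finset.mem_univ _)
  simp only [hm, r, Sum.elim_inr, one_mul] at h2
  exact pow_eq_zero_iff two_ne_zero |>.1 ((mul_eq_zero.1 h2).resolve_left (hpos m p).ne')

end Harmonic

/-! ### The standard highest weight vectors -/

/-- `u ∧ v = u ⊗ v - v ⊗ u`. -/
def wedge₂ (u v : H) : TensorAlgebra ℚ H :=
  TensorAlgebra.ι ℚ u * TensorAlgebra.ι ℚ v - TensorAlgebra.ι ℚ v * TensorAlgebra.ι ℚ u

/-- `u ∧ v ∧ w`, the alternating sum over the permutations of three vectors. -/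
def wedge₃ (u v w : H) : TensorAlgebra ℚ H :=
  TensorAlgebra.ι ℚ u * (TensorAlgebra.ι ℚ v * TensorAlgebra.ι ℚ w)
  - TensorAlgebra.ι ℚ v * (TensorAlgebra.ι ℚ u * TensorAlgebra.ι ℚ w)
  - TensorAlgebra.ι ℚ w * (TensorAlgebra.ι ℚ v * TensorAlgebra.ι ℚ u)
  - TensorAlgebra.ι ℚ u * (TensorAlgebra.ι ℚ w * TensorAlgebra.ι ℚ v)
  + TensorAlgebra.ι ℚ v * (TensorAlgebra.ι ℚ w * TensorAlgebra.ι ℚ u)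
  + TensorAlgebra.ι ℚ w * (TensorAlgebra.ι ℚ u * TensorAlgebra.ι ℚ v)

theorem tensorMap_wedge₂ (f : H →ₗ[ℚ] H) (u v : H) :
    tensorMap f (wedge₂ u v) = wedge₂ (f u) (f v) := by
  simp [wedge₂, tensorMap_ι]

theorem tensorMap_wedge₃ (f : H →ₗ[ℚ] H) (u v w : H) :
    tensorMap f (wedge₃ u v w) = wedge₃ (f u) (f v) (f w) := by
  simp [wedge₃, tensorMap_ι]

section HighestVectors

variable {g : ℕ} (b : Module.Basis (Fin g ⊕ Fin g) ℚ H)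

/-- The vectors `x₁, x₂, x₃, x₄` of a symplectic basis. -/
def xVec (hg : 4 ≤ g) (k : Fin 4) : H := b (Sum.inl (Fin.castLE hg k))

theorem rowLen_ofRowLens_eq_getD {w : List ℕ} {hw : w.SortedGE} (i : ℕ) :
    (YoungDiagram.ofRowLens w hw).rowLen i = w.getD i 0 := by
  by_cases h : i < w.length
  · rw [List.getD_eq_getElem _ _ h]
    exact YoungDiagram.rowLen_ofRowLens ⟨i, h⟩
  · rw [List.getD_eq_default _ _ (not_lt.1 h), ← Nat.le_zero, ← not_lt,
      ← YoungDiagram.mem_iff_lt_rowLen, YoungDiagram.mem_ofRowLens]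
    exact fun h' => h h'.1

theorem colLen_eq_succ {μ : YoungDiagram} {c j : ℕ} (h : j < μ.rowLen c)
    (h' : ¬ j < μ.rowLen (c + 1)) : μ.colLen j = c + 1 := by
  rw [← YoungDiagram.mem_iff_lt_rowLen, YoungDiagram.mem_iff_lt_colLen] at h h'
  omega

theorem rowLen_yd11 (i : ℕ) : yd11.rowLen i = [1, 1].getD i 0 := rowLen_ofRowLens_eq_getD i

theorem rowLen_yd2 (i : ℕ) : yd2.rowLen i = [2].getD i 0 := rowLen_ofRowLens_eq_getD i

theorem rowLen_yd22 (i : ℕ) : yd22.rowLen i = [2, 2].getD i 0 := rowLen_ofRowLens_eq_getD i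

theorem rowLen_yd211 (i : ℕ) : yd211.rowLen i = [2, 1, 1].getD i 0 := rowLen_ofRowLens_eq_getD i

theorem rowLen_yd4 (i : ℕ) : yd4.rowLen i = [4].getD i 0 := rowLen_ofRowLens_eq_getD i

theorem wedgeX_one (hg : 4 ≤ g) :
    wedgeX b 1 = TensorAlgebra.ι ℚ (xVec b hg 0) := by
  rw [wedgeX, dif_pos (by omega)]
  simp [xVec]
  rfl

theorem wedgeX_two (hg : 4 ≤ g) : wedgeX b 2 = wedge₂ (xVec b hg 0) (xVec b hg 1) := by
  rw [wedgeX, dif_pos (by omega),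
    show (Finset.univ : Finset (Equiv.Perm (Fin 2))) = {1, Equiv.swap 0 1} by decide,
    Finset.sum_pair (by decide)]
  simp [TensorAlgebra.tprod_apply, wedge₂, xVec, sub_eq_add_neg]
  rfl

theorem wedgeX_three (hg : 4 ≤ g) :
    wedgeX b 3 = wedge₃ (xVec b hg 0) (xVec b hg 1) (xVec b hg 2) := by
  rw [wedgeX, dif_pos (by omega),
    show (Finset.univ : Finset (Equiv.Perm (Fin 3))) = {1, Equiv.swap 0 1, Equiv.swap 0 2,
      Equiv.swap 1 2, Equiv.swap 0 1 * Equiv.swap 1 2, Equiv.swap 1 2 * Equiv.swap 0 1} by decide]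
  repeat rw [Finset.sum_insert (by decide)]
  rw [Finset.sum_singleton]
  have h1 : ∀ i, (Equiv.swap 0 1 * Equiv.swap 1 2 : Equiv.Perm (Fin 3)) i = ![1, 2, 0] i := by
    decide
  have h2 : ∀ i, (Equiv.swap 1 2 * Equiv.swap 0 1 : Equiv.Perm (Fin 3)) i = ![2, 0, 1] i := by
    decide
  have h3 : ∀ i, (Equiv.swap 0 1 : Equiv.Perm (Fin 3)) i = ![1, 0, 2] i := by decide
  have h4 : ∀ i, (Equiv.swap 0 2 : Equiv.Perm (Fin 3)) i = ![2, 1, 0] i := by decide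
  have h5 : ∀ i, (Equiv.swap 1 2 : Equiv.Perm (Fin 3)) i = ![0, 2, 1] i := by decide
  have s3 : Equiv.Perm.sign (Equiv.swap 0 1 : Equiv.Perm (Fin 3)) = -1 := by decide
  have s4 : Equiv.Perm.sign (Equiv.swap 0 2 : Equiv.Perm (Fin 3)) = -1 := by decide
  have s5 : Equiv.Perm.sign (Equiv.swap 1 2 : Equiv.Perm (Fin 3)) = -1 := by decide
  have t : ∀ v : Fin 3 → H, TensorAlgebra.tprod ℚ H 3 v = TensorAlgebra.ι ℚ (v 0) *
      (TensorAlgebra.ι ℚ (v 1) * TensorAlgebra.ι ℚ (v 2)) := fun v => by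
    simp [TensorAlgebra.tprod_apply]
  simp only [h1, h2, t, h3, h4, h5, map_mul, s3, s4, s5]
  simp [wedge₃, xVec]
  abel

theorem highestVector_yd11 (hg : 4 ≤ g) :
    highestVector b yd11 = wedge₂ (xVec b hg 0) (xVec b hg 1) := by
  have h0 : yd11.rowLen 0 = 1 := rowLen_yd11 0
  have h1 : yd11.colLen 0 = 2 := colLen_eq_succ (by simp [rowLen_yd11]) (by simp [rowLen_yd11])
  rw [highestVector, h0]
  simp [List.range_succ, h1, wedgeX_two b hg]

theorem highestVector_yd2 (hg : 4 ≤ g) :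
    highestVector b yd2
      = TensorAlgebra.ι ℚ (xVec b hg 0) * TensorAlgebra.ι ℚ (xVec b hg 0) := by
  have h0 : yd2.rowLen 0 = 2 := rowLen_yd2 0
  have h1 : yd2.colLen 0 = 1 := colLen_eq_succ (by simp [rowLen_yd2]) (by simp [rowLen_yd2])
  have h2 : yd2.colLen 1 = 1 := colLen_eq_succ (by simp [rowLen_yd2]) (by simp [rowLen_yd2])
  rw [highestVector, h0]
  simp [List.range_succ, h1, h2, wedgeX_one b hg]

theorem highestVector_yd22 (hg : 4 ≤ g) :
    highestVector b yd22
      = wedge₂ (xVec b hg 0) (xVec b hg 1) * wedge₂ (xVec b hg 0) (xVec b hg 1) := by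
  have h0 : yd22.rowLen 0 = 2 := rowLen_yd22 0
  have h1 : yd22.colLen 0 = 2 := colLen_eq_succ (by simp [rowLen_yd22]) (by simp [rowLen_yd22])
  have h2 : yd22.colLen 1 = 2 := colLen_eq_succ (by simp [rowLen_yd22]) (by simp [rowLen_yd22])
  rw [highestVector, h0]
  simp [List.range_succ, h1, h2, wedgeX_two b hg]

theorem highestVector_yd211 (hg : 4 ≤ g) :
    highestVector b yd211
      = wedge₃ (xVec b hg 0) (xVec b hg 1) (xVec b hg 2) * TensorAlgebra.ι ℚ (xVec b hg 0) := by
  have h0 : yd211.rowLen 0 = 2 := rowLen_yd211 0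
  have h1 : yd211.colLen 0 = 3 := colLen_eq_succ (by simp [rowLen_yd211]) (by simp [rowLen_yd211])
  have h2 : yd211.colLen 1 = 1 := colLen_eq_succ (by simp [rowLen_yd211]) (by simp [rowLen_yd211])
  rw [highestVector, h0]
  simp [List.range_succ, h1, h2, wedgeX_one b hg, wedgeX_three b hg]

theorem highestVector_yd4 (hg : 4 ≤ g) :
    highestVector b yd4
      = TensorAlgebra.ι ℚ (xVec b hg 0) * (TensorAlgebra.ι ℚ (xVec b hg 0) *
        (TensorAlgebra.ι ℚ (xVec b hg 0) * TensorAlgebra.ι ℚ (xVec b hg 0))) := by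
  have h0 : yd4.rowLen 0 = 4 := rowLen_yd4 0
  have h1 : yd4.colLen 0 = 1 := colLen_eq_succ (by simp [rowLen_yd4]) (by simp [rowLen_yd4])
  have h2 : yd4.colLen 1 = 1 := colLen_eq_succ (by simp [rowLen_yd4]) (by simp [rowLen_yd4])
  have h3 : yd4.colLen 2 = 1 := colLen_eq_succ (by simp [rowLen_yd4]) (by simp [rowLen_yd4])
  have h4 : yd4.colLen 3 = 1 := colLen_eq_succ (by simp [rowLen_yd4]) (by simp [rowLen_yd4])
  rw [highestVector, h0]
  simp [List.range_succ, h1, h2, h3, h4, wedgeX_one b hg]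

/-! ### The action of the Borel subgroup -/

theorem prod_pow_eq (hg : 4 ≤ g) (c : Fin g → ℚ) (f : ℕ → ℕ) (hf : ∀ i, 3 ≤ i → f i = 0) :
    ∏ i : Fin g, c i ^ f i = c (Fin.castLE hg 0) ^ f 0 * c (Fin.castLE hg 1) ^ f 1
      * c (Fin.castLE hg 2) ^ f 2 := by
  obtain ⟨m, rfl⟩ := Nat.exists_eq_add_of_le' hg
  rw [Fin.prod_univ_succ, Fin.prod_univ_succ, Fin.prod_univ_succ, Finset.prod_eq_one]
  · rw [mul_one, mul_assoc]
    rfl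
  · intro i _
    rw [hf _ (by simp), pow_zero]

theorem borel_apply {f : H →ₗ[ℚ] H} {c : Fin g → ℚ} (hg : 4 ≤ g)
    (h : ∀ i, f (b (Sum.inl i)) - c i • b (Sum.inl i) ∈
      Submodule.span ℚ ((fun j => b (Sum.inl j)) '' {j : Fin g | j < i})) :
    f (xVec b hg 0) = c (Fin.castLE hg 0) • xVec b hg 0 ∧
    (∃ α : ℚ, f (xVec b hg 1) = c (Fin.castLE hg 1) • xVec b hg 1 + α • xVec b hg 0) ∧
    ∃ α β : ℚ, f (xVec b hg 2) = c (Fin.castLE hg 2) • xVec b hg 2 + α • xVec b hg 0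
      + β • xVec b hg 1 := by
  refine ⟨?_, ?_, ?_⟩
  · have h0 := h (Fin.castLE hg 0)
    have : {j : Fin g | j < Fin.castLE hg 0} = ∅ := by
      ext j; simp [Fin.lt_def]
    rw [this, Set.image_empty, Submodule.span_empty, Submodule.mem_bot, sub_eq_zero] at h0
    exact h0
  · have h1 := h (Fin.castLE hg 1)
    have : {j : Fin g | j < Fin.castLE hg 1} = {Fin.castLE hg 0} := by
      ext j; simp [Fin.lt_def, Fin.ext_iff]
    rw [this, Set.image_singleton, Submodule.mem_span_singleton] at h1
    obtain ⟨α, hα⟩ := h1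
    exact ⟨α, by rw [xVec, xVec, hα]; abel⟩
  · have h2 := h (Fin.castLE hg 2)
    have : {j : Fin g | j < Fin.castLE hg 2} = {Fin.castLE hg 0, Fin.castLE hg 1} := by
      ext j; simp [Fin.lt_def, Fin.ext_iff]; omega
    rw [this, Set.image_pair, Submodule.mem_span_pair] at h2
    obtain ⟨α, β, hα⟩ := h2
    exact ⟨α, β, by rw [xVec, xVec, xVec, add_assoc, hα]; abel⟩

theorem wedge₂_borel (u v : H) (c d α : ℚ) :
    wedge₂ (c • u) (d • v + α • u) = (c * d) • wedge₂ u v := by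
  simp only [wedge₂, map_add, map_smul, mul_add, add_mul, smul_mul_assoc, mul_smul_comm]
  module

theorem wedge₃_borel (u v w : H) (c d e α β γ : ℚ) :
    wedge₃ (c • u) (d • v + α • u) (e • w + β • u + γ • v) = (c * d * e) • wedge₃ u v w := by
  simp only [wedge₃, map_add, map_smul, mul_add, add_mul, smul_mul_assoc, mul_smul_comm]
  module

/-- The Borel subgroup acts on the standard highest weight vectors by the expected characters. -/
theorem tensorMap_highestVector (hg : 4 ≤ g) {f : H →ₗ[ℚ] H} {c : Fin g → ℚ}
    (h : ∀ i, f (b (Sum.inl i)) - c i • b (Sum.inl i) ∈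
      Submodule.span ℚ ((fun j => b (Sum.inl j)) '' {j : Fin g | j < i}))
    {μ : YoungDiagram} (hμ : μ ∈ ({yd11, yd2, yd22, yd211, yd4} : Set YoungDiagram)) :
    tensorMap f (highestVector b μ) = (∏ i : Fin g, c i ^ μ.rowLen i) • highestVector b μ := by
  obtain ⟨h0, ⟨α, h1⟩, β, γ, h2⟩ := borel_apply b hg h
  have hlen : ∀ {ν : YoungDiagram}, ν.rowLen 3 = 0 → ∀ i, 3 ≤ i → ν.rowLen i = 0 :=
    fun {ν} h3 i hi => Nat.le_zero.1 (h3 ▸ ν.rowLen_anti 3 i hi)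
  simp only [Set.mem_insert_iff, Set.mem_singleton_iff] at hμ
  rcases hμ with rfl | rfl | rfl | rfl | rfl
  · rw [prod_pow_eq hg c _ (hlen (rowLen_yd11 3)), rowLen_yd11, rowLen_yd11, rowLen_yd11,
      highestVector_yd11 b hg, tensorMap_wedge₂, h0, h1, wedge₂_borel]
    simp
  · rw [prod_pow_eq hg c _ (hlen (rowLen_yd2 3)), rowLen_yd2, rowLen_yd2, rowLen_yd2,
      highestVector_yd2 b hg, map_mul, tensorMap_ι, h0]
    simp only [map_smul, smul_mul_assoc, mul_smul_comm, List.getD_cons_zero,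
      List.getD_cons_succ, List.getD_nil]
    module
  · rw [prod_pow_eq hg c _ (hlen (rowLen_yd22 3)), rowLen_yd22, rowLen_yd22, rowLen_yd22,
      highestVector_yd22 b hg, map_mul, tensorMap_wedge₂, h0, h1, wedge₂_borel]
    simp only [smul_mul_assoc, mul_smul_comm, List.getD_cons_zero,
      List.getD_cons_succ, List.getD_nil]
    module
  · rw [prod_pow_eq hg c _ (hlen (rowLen_yd211 3)), rowLen_yd211, rowLen_yd211, rowLen_yd211,
      highestVector_yd211 b hg, map_mul, tensorMap_wedge₃, tensorMap_ι, h0, h1, h2, wedge₃_borel]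
    simp only [map_smul, smul_mul_assoc, mul_smul_comm, List.getD_cons_zero,
      List.getD_cons_succ]
    module
  · rw [prod_pow_eq hg c _ (hlen (rowLen_yd4 3)), rowLen_yd4, rowLen_yd4, rowLen_yd4,
      highestVector_yd4 b hg, map_mul, map_mul, map_mul, tensorMap_ι, h0]
    simp only [map_smul, smul_mul_assoc, mul_smul_comm, List.getD_cons_zero,
      List.getD_cons_succ, List.getD_nil]
    module

end HighestVectors

/-! ### Torus weights and irreducibility -/

section Torus

theorem coeff_tensorMap_diagonal {κ : Type*} (b : Module.Basis κ ℚ H) {f : H →ₗ[ℚ] H} {c : κ → ℚ}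
    (h : ∀ k, f (b k) = c k • b k) (l : List κ) (t : TensorAlgebra ℚ H) :
    coeff b l (tensorMap f t) = (l.map c).prod * coeff b l t := by
  classical
  have hw : ∀ l', tensorMap f (wordBasis b l') = (l'.map c).prod • wordBasis b l' := by
    intro l'
    induction l' with
    | nil => simp
    | cons a l' ih =>
      rw [wordBasis_cons, map_mul, tensorMap_ι, h, ih, map_smul, List.map_cons, List.prod_cons,
        smul_mul_smul_comm]
  have : coeff b l ∘ₗ (tensorMap f).toLinearMap = (l.map c).prod • coeff b l := by
    refine (wordBasis b).ext fun l' => ?_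
    simp only [LinearMap.comp_apply, AlgHom.toLinearMap_apply, hw, map_smul, coeff_wordBasis,
      LinearMap.smul_apply, smul_eq_mul]
    split_ifs with h
    · rw [h]
    · simp
  exact LinearMap.congr_fun this t

variable {g : ℕ} {ω : LinearMap.BilinForm ℚ H} {b : Module.Basis (Fin g ⊕ Fin g) ℚ H}

/-- The weights of the torus element `torus hb A` on the basis vectors. -/
def torusWeight (A : Finset (Fin g)) : Fin g ⊕ Fin g → ℚ :=
  Sum.elim (fun i => if i ∈ A then 2 else 1) fun i => if i ∈ A then 1 / 2 else 1

/-- The element of `Sp(H)` with `xᵢ ↦ 2 xᵢ`, `yᵢ ↦ yᵢ / 2` for `i ∈ A`, fixing the other basis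
vectors. -/
def torus (hb : IsSymplecticBasis ω b) (A : Finset (Fin g)) : Sp ω :=
  spOfInverse b (b.constr ℚ fun k => torusWeight A k • b k)
    (b.constr ℚ fun k => (torusWeight A k)⁻¹ • b k)
    (b.ext fun k => by
      have : torusWeight A k ≠ 0 := by
        rcases k with i | i <;> simp only [torusWeight, Sum.elim_inl, Sum.elim_inr] <;>
          split_ifs <;> norm_num
      simp [smul_smul, this])
    (b.ext fun k => by
      have : torusWeight A k ≠ 0 := by
        rcases k with i | i <;> simp only [torusWeight, Sum.elim_inl, Sum.elim_inr] <;>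
          split_ifs <;> norm_num
      simp [smul_smul, this])
    fun k l => by
      rcases k with i | i <;> rcases l with j | j <;>
        simp only [Module.Basis.constr_basis, map_smul, LinearMap.smul_apply, hb.xx, hb.xy, hb.yx,
          hb.yy, smul_eq_mul, mul_zero, torusWeight, Sum.elim_inl, Sum.elim_inr]
      all_goals
        rcases eq_or_ne i j with rfl | hij
        · by_cases hi : i ∈ A <;> simp [hi]
        · simp [hij]

theorem tensorRep_torus (hb : IsSymplecticBasis ω b) (A : Finset (Fin g)) (t : TensorAlgebra ℚ H) :
    tensorRep ω (torus hb A) t = tensorMap (b.constr ℚ fun k => torusWeight A k • b k) t := rfl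

theorem coeff_torus (hb : IsSymplecticBasis ω b) (A : Finset (Fin g)) (l : List (Fin g ⊕ Fin g))
    (t : TensorAlgebra ℚ H) : coeff b l (tensorRep ω (torus hb A) t)
      = (l.map (torusWeight A)).prod * coeff b l t := by
  rw [tensorRep_torus]
  exact coeff_tensorMap_diagonal b (fun k => by simp) l t

theorem torusWeight_le (A : Finset (Fin g)) (k : Fin g ⊕ Fin g) : torusWeight A k ≤ 2 := by
  rcases k with i | i <;> simp only [torusWeight, Sum.elim_inl, Sum.elim_inr] <;>
    split_ifs <;> norm_num

theorem torusWeight_pos (A : Finset (Fin g)) (k : Fin g ⊕ Fin g) : 0 < torusWeight A k := by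
  rcases k with i | i <;> simp only [torusWeight, Sum.elim_inl, Sum.elim_inr] <;>
    split_ifs <;> norm_num

theorem prod_torusWeight_le (A : Finset (Fin g)) (l : List (Fin g ⊕ Fin g)) :
    (l.map (torusWeight A)).prod ≤ 2 ^ l.length ∧ 0 < (l.map (torusWeight A)).prod := by
  induction l with
  | nil => simp
  | cons k l ih =>
    rw [List.map_cons, List.prod_cons, List.length_cons, pow_succ']
    exact ⟨mul_le_mul (torusWeight_le A k) ih.1 ih.2.le (by norm_num),
      mul_pos (torusWeight_pos A k) ih.2⟩

/-- A word whose weight is as large as its length allows consists of the letters `xᵢ`, `i ∈ A`. -/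
theorem exists_of_prod_torusWeight (A : Finset (Fin g)) (l : List (Fin g ⊕ Fin g))
    (h : (l.map (torusWeight A)).prod = 2 ^ l.length) : ∀ k ∈ l, ∃ i ∈ A, k = Sum.inl i := by
  induction l with
  | nil => simp
  | cons k l ih =>
    rw [List.map_cons, List.prod_cons, List.length_cons, pow_succ'] at h
    obtain ⟨h1, h2⟩ := prod_torusWeight_le A l
    have hk := torusWeight_le A k
    have hk0 := torusWeight_pos A k
    have hl : (l.map (torusWeight A)).prod = 2 ^ l.length := by nlinarith
    have hk2 : torusWeight A k = 2 := by
      rw [hl] at h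
      exact mul_right_cancel₀ (by positivity) h
    rintro k' hk'
    rcases List.mem_cons.1 hk' with rfl | hk'
    · rcases k' with i | i <;> simp only [torusWeight, Sum.elim_inl, Sum.elim_inr] at hk2 <;>
        split_ifs at hk2 with hi
      · exact ⟨i, hi, rfl⟩
      · norm_num at hk2
      · norm_num at hk2
      · norm_num at hk2
    · exact ih hl k' hk'

/-- A nonzero coefficient of a weight vector occurs at a word of the same weight. -/
theorem prod_torusWeight_eq (hb : IsSymplecticBasis ω b) {A : Finset (Fin g)} {χ : ℚ}
    {t : TensorAlgebra ℚ H} (h : tensorRep ω (torus hb A) t = χ • t)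
    {l : List (Fin g ⊕ Fin g)} (hl : coeff b l t ≠ 0) : (l.map (torusWeight A)).prod = χ := by
  have := congrArg (coeff b l) h
  rw [coeff_torus, map_smul, smul_eq_mul] at this
  exact mul_right_cancel₀ hl this

theorem tensorRep_torus_highestVector (hb : IsSymplecticBasis ω b) (hg : 4 ≤ g)
    {μ : YoungDiagram} (hμ : μ ∈ ({yd11, yd2, yd22, yd211, yd4} : Set YoungDiagram))
    (A : Finset (Fin g)) : tensorRep ω (torus hb A) (highestVector b μ)
      = (∏ i : Fin g, torusWeight A (Sum.inl i) ^ μ.rowLen i) • highestVector b μ := by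
  rw [tensorRep_torus]
  refine tensorMap_highestVector b hg (c := fun i => torusWeight A (Sum.inl i)) (fun i => ?_) hμ
  simp

/-- An operator that commutes with `Sp(H)` and kills the highest weight vector kills `[μ]`. -/
theorem map_eq_zero_of_mem_irrep {μ : YoungDiagram} {V : Type*} [AddCommGroup V] [Module ℚ V]
    (ρ : Representation ℚ (Sp ω) V) (P : TensorAlgebra ℚ H →ₗ[ℚ] V)
    (hP : ∀ a t, P (tensorRep ω a t) = ρ a (P t)) (h : P (highestVector b μ) = 0)
    {t : TensorAlgebra ℚ H} (ht : t ∈ (irrep ω b μ).toSubmodule) : P t = 0 := by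
  have : (irrep ω b μ).toSubmodule ≤ LinearMap.ker P :=
    irrep_le (fun a w hw => by
      rw [LinearMap.mem_ker] at hw ⊢
      rw [hP, hw, map_zero]) h
  exact this ht

theorem tensorRep_rot (a : Sp ω) (t : TensorAlgebra ℚ H) :
    tensorRep ω a (rot b t) = rot b (tensorRep ω a t) := tensorMap_rot b _ t

theorem tensorRep_swap (a : Sp ω) (t : TensorAlgebra ℚ H) :
    tensorRep ω a (swap b t) = swap b (tensorRep ω a t) := tensorMap_swap b _ t

theorem mem_degree_of_mem_irrep {μ : YoungDiagram} {n : ℕ} (h : highestVector b μ ∈ degree H n)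
    {t : TensorAlgebra ℚ H} (ht : t ∈ (irrep ω b μ).toSubmodule) : t ∈ degree H n := by
  have hle : (irrep ω b μ).toSubmodule ≤ degree H n :=
    irrep_le (fun a w hw => tensorMap_mem_degree _ hw) h
  exact hle ht

theorem wedge₂_mem_degree (u v : H) : wedge₂ u v ∈ degree H 2 :=
  sub_mem (mul_mem_degree (ι_mem_degree u) (ι_mem_degree v))
    (mul_mem_degree (ι_mem_degree v) (ι_mem_degree u))

theorem wedge₃_mem_degree (u v w : H) : wedge₃ u v w ∈ degree H 3 := by
  have h : ∀ u v w : H, TensorAlgebra.ι ℚ u * (TensorAlgebra.ι ℚ v * TensorAlgebra.ι ℚ w)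
      ∈ degree H 3 := fun u v w =>
    mul_mem_degree (ι_mem_degree u) (mul_mem_degree (ι_mem_degree v) (ι_mem_degree w))
  exact add_mem (add_mem (sub_mem (sub_mem (sub_mem (h _ _ _) (h _ _ _)) (h _ _ _)) (h _ _ _))
    (h _ _ _)) (h _ _ _)

theorem highestVector_yd11_mem (hg : 4 ≤ g) : highestVector b yd11 ∈ degree H 2 := by
  rw [highestVector_yd11 b hg]; exact wedge₂_mem_degree _ _

theorem highestVector_yd2_mem (hg : 4 ≤ g) : highestVector b yd2 ∈ degree H 2 := by
  rw [highestVector_yd2 b hg]; exact mul_mem_degree (ι_mem_degree _) (ι_mem_degree _)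

theorem highestVector_yd22_mem (hg : 4 ≤ g) : highestVector b yd22 ∈ degree H 4 := by
  rw [highestVector_yd22 b hg]
  exact mul_mem_degree (wedge₂_mem_degree _ _) (wedge₂_mem_degree _ _)

theorem highestVector_yd211_mem (hg : 4 ≤ g) : highestVector b yd211 ∈ degree H 4 := by
  rw [highestVector_yd211 b hg]
  exact mul_mem_degree (wedge₃_mem_degree _ _ _) (ι_mem_degree _)

theorem highestVector_yd4_mem (hg : 4 ≤ g) : highestVector b yd4 ∈ degree H 4 := by
  rw [highestVector_yd4 b hg]
  exact mul_mem_degree (ι_mem_degree _) (mul_mem_degree (ι_mem_degree _)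
    (mul_mem_degree (ι_mem_degree _) (ι_mem_degree _)))

/-- Tensors in `[1²]` are skew-symmetric. -/
theorem coeff_yd11_swap (hg : 4 ≤ g) {t : TensorAlgebra ℚ H}
    (ht : t ∈ (irrep ω b yd11).toSubmodule) (k l : Fin g ⊕ Fin g) :
    coeff b [k, l] t = -coeff b [l, k] t := by
  have h := map_eq_zero_of_mem_irrep (tensorRep ω) (swap b + LinearMap.id)
    (fun a t => by simp [tensorRep_swap]) (by
      rw [highestVector_yd11 b hg]
      have h2 := fun u v : H => swap_ι_mul b u v 1
      simp only [mul_one] at h2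
      simp [wedge₂, h2]) ht
  have h1 := congrArg (coeff b [k, l]) h
  rw [LinearMap.add_apply, map_add, coeff_swap, LinearMap.id_apply, map_zero] at h1
  linarith

/-- Tensors in `[2]` are symmetric. -/
theorem coeff_yd2_swap (hg : 4 ≤ g) {t : TensorAlgebra ℚ H}
    (ht : t ∈ (irrep ω b yd2).toSubmodule) (k l : Fin g ⊕ Fin g) :
    coeff b [k, l] t = coeff b [l, k] t := by
  have h := map_eq_zero_of_mem_irrep (tensorRep ω) (swap b - LinearMap.id)
    (fun a t => by simp [tensorRep_swap]) (by
      rw [highestVector_yd2 b hg]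
      have h2 := fun u v : H => swap_ι_mul b u v 1
      simp only [mul_one] at h2
      simp [h2]) ht
  have h1 := congrArg (coeff b [k, l]) h
  rw [LinearMap.sub_apply, map_sub, coeff_swap, LinearMap.id_apply, map_zero] at h1
  linarith

theorem coeff_rot_four (k l m n : Fin g ⊕ Fin g) (t : TensorAlgebra ℚ H) :
    coeff b [k, l, m, n] (rot b t) = coeff b [n, k, l, m] t :=
  coeff_rot b n [k, l, m] t

/-- Tensors in `[2²]` are skew-symmetric in the first two and in the last two factors. -/
theorem coeff_yd22_swap (hg : 4 ≤ g) {t : TensorAlgebra ℚ H}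
    (ht : t ∈ (irrep ω b yd22).toSubmodule) (k l m n : Fin g ⊕ Fin g) :
    coeff b [k, l, m, n] t = -coeff b [l, k, m, n] t ∧
      coeff b [k, l, m, n] t = -coeff b [k, l, n, m] t := by
  constructor
  · have h := map_eq_zero_of_mem_irrep (tensorRep ω) (swap b + LinearMap.id)
      (fun a t => by simp [tensorRep_swap]) (by
        rw [highestVector_yd22 b hg]
        simp [wedge₂, swap_ι_mul, sub_mul, mul_assoc]) ht
    have h1 := congrArg (coeff b [k, l, m, n]) h
    rw [LinearMap.add_apply, map_add, coeff_swap, LinearMap.id_apply, map_zero] at h1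
    linarith
  · have h := map_eq_zero_of_mem_irrep (tensorRep ω)
      ((swap b + LinearMap.id) ∘ₗ rot b ∘ₗ rot b)
      (fun a t => by simp [tensorRep_swap, tensorRep_rot]) (by
        rw [highestVector_yd22 b hg]
        simp [wedge₂, swap_ι_mul, rot_ι_mul, sub_mul, mul_sub, mul_assoc]) ht
    have h1 := congrArg (coeff b [m, n, k, l]) h
    simp only [LinearMap.comp_apply, LinearMap.add_apply, map_add, coeff_swap, LinearMap.id_apply,
      map_zero, coeff_rot_four] at h1
    linarith

/-- Tensors in `[21²]` are skew-symmetric in the first three factors. -/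
theorem coeff_yd211_swap (hg : 4 ≤ g) {t : TensorAlgebra ℚ H}
    (ht : t ∈ (irrep ω b yd211).toSubmodule) (k l m n : Fin g ⊕ Fin g) :
    coeff b [k, l, m, n] t = -coeff b [l, k, m, n] t ∧
      coeff b [k, l, m, n] t = -coeff b [k, m, l, n] t := by
  constructor
  · have h := map_eq_zero_of_mem_irrep (tensorRep ω) (swap b + LinearMap.id)
      (fun a t => by simp [tensorRep_swap]) (by
        rw [highestVector_yd211 b hg]
        simp [wedge₃, swap_ι_mul, sub_mul, add_mul, mul_assoc]
        abel) ht
    have h1 := congrArg (coeff b [k, l, m, n]) h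
    rw [LinearMap.add_apply, map_add, coeff_swap, LinearMap.id_apply, map_zero] at h1
    linarith
  · have h := map_eq_zero_of_mem_irrep (tensorRep ω)
      ((swap b + LinearMap.id) ∘ₗ rot b)
      (fun a t => by simp [tensorRep_swap, tensorRep_rot]) (by
        rw [highestVector_yd211 b hg]
        simp [wedge₃, swap_ι_mul, rot_ι_mul, sub_mul, add_mul, mul_assoc]
        abel) ht
    have h1 := congrArg (coeff b [l, m, n, k]) h
    simp only [LinearMap.comp_apply, LinearMap.add_apply, map_add, coeff_swap, LinearMap.id_apply,
      map_zero, coeff_rot_four] at h1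
    linarith

/-- The letters `x₁, x₂, x₃, x₄`. -/
def xIdx (hg : 4 ≤ g) (k : Fin 4) : Fin g ⊕ Fin g := Sum.inl (Fin.castLE hg k)

theorem coeff_xVec_mul (hg : 4 ≤ g) (k l : Fin 4) (w : List (Fin g ⊕ Fin g))
    (t : TensorAlgebra ℚ H) : coeff b (xIdx hg k :: w) (TensorAlgebra.ι ℚ (xVec b hg l) * t)
      = if l = k then coeff b w t else 0 := by
  rw [coeff_ι_mul_cons]
  simp only [xVec, xIdx, Module.Basis.repr_self, Finsupp.single_apply, Sum.inl.injEq,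
    (Fin.castLE_injective hg).eq_iff]
  split_ifs <;> simp

theorem coeff_xVec (hg : 4 ≤ g) (k l : Fin 4) :
    coeff b [xIdx hg k] (TensorAlgebra.ι ℚ (xVec b hg l)) = if l = k then 1 else 0 := by
  rw [coeff_ι]
  simp only [xVec, xIdx, Module.Basis.repr_self, Finsupp.single_apply, Sum.inl.injEq,
    (Fin.castLE_injective hg).eq_iff]

/-- `[μ]` is irreducible if its vectors of highest weight are determined by the coefficient of one
word `w` that occurs in the highest weight vector. -/
theorem isIrreducible_of_coeff (hb : IsSymplecticBasis ω b) (hg : 4 ≤ g)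
    {μ : YoungDiagram} (hμ : μ ∈ ({yd11, yd2, yd22, yd211, yd4} : Set YoungDiagram)) {n : ℕ}
    (hn : highestVector b μ ∈ degree H n) (w : List (Fin g ⊕ Fin g))
    (h1 : coeff b w (highestVector b μ) = 1)
    (h2 : ∀ t ∈ (irrep ω b μ).toSubmodule, (∀ A, tensorRep ω (torus hb A) t
      = (∏ i : Fin g, torusWeight A (Sum.inl i) ^ μ.rowLen i) • t) → coeff b w t = 0 → t = 0) :
    (irrep ω b μ).toRepresentation.IsIrreducible := by
  refine isIrreducible_irrep hb hn (fun h => by simp [h] at h1) (torus hb)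
    (fun A => ∏ i : Fin g, torusWeight A (Sum.inl i) ^ μ.rowLen i)
    (tensorRep_torus_highestVector hb hg hμ) fun t ht hwt => ⟨coeff b w t, ?_⟩
  refine sub_eq_zero.1 (h2 _ (sub_mem ht (Submodule.smul_mem _ _ (highestVector_mem_irrep μ)))
    (fun A => ?_) ?_)
  · rw [map_sub, map_smul, hwt, tensorRep_torus_highestVector hb hg hμ]
    module
  · simp [h1]

theorem torusWeight_xIdx (hg : 4 ≤ g) (A : Finset (Fin 4)) (k : Fin 4) :
    torusWeight (A.map (Fin.castLEEmb hg)) (xIdx hg k) = if k ∈ A then 2 else 1 := by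
  simp [torusWeight, xIdx]

theorem prod_torusWeight_rowLen (hg : 4 ≤ g) {μ : YoungDiagram} (h3 : μ.rowLen 3 = 0)
    (A : Finset (Fin 4)) :
    ∏ i : Fin g, torusWeight (A.map (Fin.castLEEmb hg)) (Sum.inl i) ^ μ.rowLen i
      = (if 0 ∈ A then 2 else 1) ^ μ.rowLen 0 * (if 1 ∈ A then 2 else 1) ^ μ.rowLen 1
        * (if 2 ∈ A then 2 else 1) ^ μ.rowLen 2 := by
  rw [prod_pow_eq hg _ μ.rowLen fun i hi => Nat.le_zero.1 (h3 ▸ μ.rowLen_anti 3 i hi)]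
  have := torusWeight_xIdx hg A
  simp only [xIdx] at this
  rw [this, this, this]

/-- A word occurring in a vector of weight `μ`, for a diagram `μ` with at most three rows, only has
letters `xᵢ` with `i ∈ A`, provided that these carry the whole weight. -/
theorem exists_xIdx_of_coeff_ne_zero (hb : IsSymplecticBasis ω b) (hg : 4 ≤ g)
    {μ : YoungDiagram} (h3 : μ.rowLen 3 = 0) {t : TensorAlgebra ℚ H}
    (hwt : ∀ A, tensorRep ω (torus hb A) t
      = (∏ i : Fin g, torusWeight A (Sum.inl i) ^ μ.rowLen i) • t)
    {l : List (Fin g ⊕ Fin g)} (hl : coeff b l t ≠ 0) (A : Finset (Fin 4))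
    (hA : ((if 0 ∈ A then 2 else 1) ^ μ.rowLen 0 * (if 1 ∈ A then 2 else 1) ^ μ.rowLen 1
        * (if 2 ∈ A then 2 else 1) ^ μ.rowLen 2 : ℚ) = 2 ^ l.length) :
    ∀ k ∈ l, ∃ i ∈ A, k = xIdx hg i := by
  intro k hk
  have h := prod_torusWeight_eq hb (hwt (A.map (Fin.castLEEmb hg))) hl
  rw [prod_torusWeight_rowLen hg h3, hA] at h
  obtain ⟨i, hi, rfl⟩ := exists_of_prod_torusWeight _ l h k hk
  obtain ⟨j, hj, rfl⟩ := Finset.mem_map.1 hi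
  exact ⟨j, hj, rfl⟩

theorem isIrreducible_yd11 (hb : IsSymplecticBasis ω b) (hg : 4 ≤ g) :
    (irrep ω b yd11).toRepresentation.IsIrreducible := by
  refine isIrreducible_of_coeff hb hg (by simp) (highestVector_yd11_mem hg)
    [xIdx hg 0, xIdx hg 1] ?_ fun t ht hwt h0 => ?_
  · simp [highestVector_yd11 b hg, wedge₂, coeff_xVec_mul, coeff_xVec]
  · refine ext_degree_two b (mem_degree_of_mem_irrep (highestVector_yd11_mem hg) ht)
      (zero_mem _) fun k l => ?_
    rw [map_zero]
    by_contra hne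
    have hlet := exists_xIdx_of_coeff_ne_zero hb hg (rowLen_yd11 3) hwt hne {0, 1} (by
      simp [rowLen_yd11]; norm_num)
    have hs := coeff_yd11_swap hg ht
    simp only [List.mem_cons, List.not_mem_nil, or_false, forall_eq_or_imp, forall_eq,
      Finset.mem_insert, Finset.mem_singleton, exists_eq_or_imp, exists_eq_left] at hlet
    have hself : ∀ k, coeff b [k, k] t = 0 := fun k => by linarith [hs k k]
    rcases hlet with ⟨rfl | rfl, rfl | rfl⟩
    · exact hne (hself _)
    · exact hne h0
    · exact hne (by rw [hs, h0, neg_zero])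
    · exact hne (hself _)

theorem isIrreducible_yd2 (hb : IsSymplecticBasis ω b) (hg : 4 ≤ g) :
    (irrep ω b yd2).toRepresentation.IsIrreducible := by
  refine isIrreducible_of_coeff hb hg (by simp) (highestVector_yd2_mem hg)
    [xIdx hg 0, xIdx hg 0] ?_ fun t ht hwt h0 => ?_
  · simp [highestVector_yd2 b hg, coeff_xVec_mul, coeff_xVec]
  · refine ext_degree_two b (mem_degree_of_mem_irrep (highestVector_yd2_mem hg) ht)
      (zero_mem _) fun k l => ?_
    rw [map_zero]
    by_contra hne
    have hlet := exists_xIdx_of_coeff_ne_zero hb hg (rowLen_yd2 3) hwt hne {0} (by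
      simp [rowLen_yd2])
    simp only [List.mem_cons, List.not_mem_nil, or_false, forall_eq_or_imp, forall_eq,
      Finset.mem_singleton, exists_eq_left] at hlet
    obtain ⟨rfl, rfl⟩ := hlet
    exact hne h0

theorem isIrreducible_yd4 (hb : IsSymplecticBasis ω b) (hg : 4 ≤ g) :
    (irrep ω b yd4).toRepresentation.IsIrreducible := by
  refine isIrreducible_of_coeff hb hg (by simp) (highestVector_yd4_mem hg)
    [xIdx hg 0, xIdx hg 0, xIdx hg 0, xIdx hg 0] ?_ fun t ht hwt h0 => ?_
  · simp [highestVector_yd4 b hg, coeff_xVec_mul, coeff_xVec]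
  · refine ext_degree_four b (mem_degree_of_mem_irrep (highestVector_yd4_mem hg) ht)
      (zero_mem _) fun k l m n => ?_
    rw [map_zero]
    by_contra hne
    have hlet := exists_xIdx_of_coeff_ne_zero hb hg (rowLen_yd4 3) hwt hne {0} (by
      simp [rowLen_yd4])
    simp only [List.mem_cons, List.not_mem_nil, or_false, forall_eq_or_imp, forall_eq,
      Finset.mem_singleton, exists_eq_left] at hlet
    obtain ⟨rfl, rfl, rfl, rfl⟩ := hlet
    exact hne h0

theorem isIrreducible_yd22 (hb : IsSymplecticBasis ω b) (hg : 4 ≤ g) :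
    (irrep ω b yd22).toRepresentation.IsIrreducible := by
  refine isIrreducible_of_coeff hb hg (by simp) (highestVector_yd22_mem hg)
    [xIdx hg 0, xIdx hg 1, xIdx hg 0, xIdx hg 1] ?_ fun t ht hwt h0 => ?_
  · simp [highestVector_yd22 b hg, wedge₂, sub_mul, mul_sub, mul_assoc, coeff_xVec_mul, coeff_xVec]
  · refine ext_degree_four b (mem_degree_of_mem_irrep (highestVector_yd22_mem hg) ht)
      (zero_mem _) fun k l m n => ?_
    rw [map_zero]
    by_contra hne
    have hlet := exists_xIdx_of_coeff_ne_zero hb hg (rowLen_yd22 3) hwt hne {0, 1} (by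
      simp [rowLen_yd22]; norm_num)
    have hs := fun k l m n => (coeff_yd22_swap hg ht k l m n).1
    have hs' := fun k l m n => (coeff_yd22_swap hg ht k l m n).2
    simp only [List.mem_cons, List.not_mem_nil, or_false, forall_eq_or_imp, forall_eq,
      Finset.mem_insert, Finset.mem_singleton, exists_eq_or_imp, exists_eq_left] at hlet
    have hself : ∀ k m n, coeff b [k, k, m, n] t = 0 := fun k m n => by linarith [hs k k m n]
    have hself' : ∀ k l m, coeff b [k, l, m, m] t = 0 := fun k l m => by linarith [hs' k l m m]
    apply hne
    -- by skew-symmetry only words `x₁x₂` or `x₂x₁` followed by one of these two survive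
    rcases hlet with ⟨rfl | rfl, rfl | rfl, rfl | rfl, rfl | rfl⟩ <;>
    first
      | (rw [hself])
      | (rw [hself'])
      | (rw [h0])
      | (rw [hs, h0, neg_zero])
      | (rw [hs', h0, neg_zero])
      | (rw [hs, hs', h0, neg_zero, neg_zero])

theorem isIrreducible_yd211 (hb : IsSymplecticBasis ω b) (hg : 4 ≤ g) :
    (irrep ω b yd211).toRepresentation.IsIrreducible := by
  refine isIrreducible_of_coeff hb hg (by simp) (highestVector_yd211_mem hg)
    [xIdx hg 0, xIdx hg 1, xIdx hg 2, xIdx hg 0] ?_ fun t ht hwt h0 => ?_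
  · simp [highestVector_yd211 b hg, wedge₃, sub_mul, add_mul, mul_assoc, coeff_xVec_mul,
      coeff_xVec]
  · refine ext_degree_four b (mem_degree_of_mem_irrep (highestVector_yd211_mem hg) ht)
      (zero_mem _) fun k l m n => ?_
    rw [map_zero]
    by_contra hne
    have hlet := exists_xIdx_of_coeff_ne_zero hb hg (rowLen_yd211 3) hwt hne {0, 1, 2} (by
      simp [rowLen_yd211]; norm_num)
    -- the letter `x₁` occurs twice
    obtain ⟨B, hB0, hB1, hB2, hB⟩ : ∃ B : Finset (Fin g), torusWeight B (xIdx hg 0) = 2 ∧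
        torusWeight B (xIdx hg 1) = 1 ∧ torusWeight B (xIdx hg 2) = 1 ∧
        ([k, l, m, n].map (torusWeight B)).prod = 4 := by
      refine ⟨({0} : Finset (Fin 4)).map (Fin.castLEEmb hg), ?_, ?_, ?_, ?_⟩
      · rw [torusWeight_xIdx, if_pos (by decide)]
      · rw [torusWeight_xIdx, if_neg (by decide)]
      · rw [torusWeight_xIdx, if_neg (by decide)]
      · rw [prod_torusWeight_eq hb (hwt _) hne, prod_torusWeight_rowLen hg (rowLen_yd211 3),
          if_pos (by decide), if_neg (by decide), if_neg (by decide), rowLen_yd211]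
        norm_num
    have hs := fun k l m n => (coeff_yd211_swap hg ht k l m n).1
    have hs' := fun k l m n => (coeff_yd211_swap hg ht k l m n).2
    simp only [List.mem_cons, List.not_mem_nil, or_false, forall_eq_or_imp, forall_eq,
      Finset.mem_insert, Finset.mem_singleton, exists_eq_or_imp, exists_eq_left] at hlet
    have h12 : ∀ k m n, coeff b [k, k, m, n] t = 0 := fun k m n => by linarith [hs k k m n]
    have h23 : ∀ k l n, coeff b [k, l, l, n] t = 0 := fun k l n => by linarith [hs' k l l n]
    have h13 : ∀ k l n, coeff b [k, l, k, n] t = 0 := fun k l n => by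
      rw [hs, h23, neg_zero]
    -- the first three letters are distinct, so the last one is the second occurrence of `x₁`
    obtain ⟨hk, hl, hm, hn⟩ := hlet
    have hn0 : n = xIdx hg 0 := by
      rcases hn with rfl | rfl | rfl
      · rfl
      all_goals
        exfalso
        rcases hk with rfl | rfl | rfl <;> rcases hl with rfl | rfl | rfl <;>
          rcases hm with rfl | rfl | rfl <;>
          first
            | (exact hne (by rw [h12]))
            | (exact hne (by rw [h23]))
            | (exact hne (by rw [h13]))
            | (norm_num [hB0, hB1, hB2] at hB)
    subst hn0
    apply hne
    have h102 : coeff b [xIdx hg 1, xIdx hg 0, xIdx hg 2, xIdx hg 0] t = 0 := by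
      rw [hs, h0, neg_zero]
    have h021 : coeff b [xIdx hg 0, xIdx hg 2, xIdx hg 1, xIdx hg 0] t = 0 := by
      rw [hs', h0, neg_zero]
    rcases hk with rfl | rfl | rfl <;> rcases hl with rfl | rfl | rfl <;>
      rcases hm with rfl | rfl | rfl <;>
      first
        | (rw [h12])
        | (rw [h23])
        | (rw [h13])
        | (rw [h0])
        | (rw [h102])
        | (rw [h021])
        | (rw [hs, h021, neg_zero])
        | (rw [hs', h102, neg_zero])
        | (rw [hs, hs', h102, neg_zero, neg_zero])

theorem isIrreducibleOfHighestWeight (hb : IsSymplecticBasis ω b) (hg : 4 ≤ g)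
    {μ : YoungDiagram} (hμ : μ ∈ ({yd11, yd2, yd22, yd211, yd4} : Set YoungDiagram)) :
    IsIrreducibleOfHighestWeight b (irrep ω b μ).toRepresentation μ := by
  have hirr : (irrep ω b μ).toRepresentation.IsIrreducible := by
    simp only [Set.mem_insert_iff, Set.mem_singleton_iff] at hμ
    rcases hμ with rfl | rfl | rfl | rfl | rfl
    exacts [isIrreducible_yd11 hb hg, isIrreducible_yd2 hb hg, isIrreducible_yd22 hb hg,
      isIrreducible_yd211 hb hg, isIrreducible_yd4 hb hg]
  refine ⟨hirr, ⟨highestVector b μ, highestVector_mem_irrep μ⟩, fun h => ?_, fun a c hac => ?_⟩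
  · obtain ⟨W, W', hne⟩ := hirr.exists_pair_ne
    have h0 : (irrep ω b μ).toSubmodule ≤ ⊥ :=
      irrep_le (fun a w hw => by rw [(Submodule.mem_bot ℚ).1 hw, map_zero]; exact zero_mem _)
        ((Submodule.mem_bot ℚ).2 (congrArg Subtype.val h))
    have hz : ∀ t : (irrep ω b μ).toSubmodule, t = 0 := fun t =>
      Subtype.ext ((Submodule.mem_bot ℚ).1 (h0 t.2))
    refine hne (Subrepresentation.toSubmodule_injective (Submodule.ext fun t => ?_))
    rw [hz t]
    exact ⟨fun _ => zero_mem _, fun _ => zero_mem _⟩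
  · exact Subtype.ext (tensorMap_highestVector b hg hac hμ)

end Torus

/-! ### Poincaré duality -/

/-- Representations embedded equivariantly with the same image are isomorphic. -/
theorem exists_equiv_of_range_eq {G M N X : Type*} [Group G] [AddCommMonoid M] [Module ℚ M]
    [AddCommMonoid N] [Module ℚ N] [AddCommMonoid X] [Module ℚ X] {ρM : Representation ℚ G M}
    {ρN : Representation ℚ G N} (ρX : Representation ℚ G X) {f : M →ₗ[ℚ] X} {f' : N →ₗ[ℚ] X}
    (hf : Function.Injective f) (hf' : Function.Injective f')
    (hr : LinearMap.range f = LinearMap.range f') (he : ∀ a m, f (ρM a m) = ρX a (f m))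
    (he' : ∀ a m, f' (ρN a m) = ρX a (f' m)) : ∃ Φ : ρM.Equiv ρN, ∀ m, f' (Φ m) = f m := by
  let e : M ≃ₗ[ℚ] N := (LinearEquiv.ofInjective f hf).trans
    ((LinearEquiv.ofEq _ _ hr).trans (LinearEquiv.ofInjective f' hf').symm)
  have h : ∀ m, f' (e m) = f m := fun m =>
    congrArg Subtype.val ((LinearEquiv.ofInjective f' hf').apply_symm_apply
      (LinearEquiv.ofEq _ _ hr (LinearEquiv.ofInjective f hf m)))
  refine ⟨Representation.Equiv.mk e fun a => LinearMap.ext fun m => hf' ?_, h⟩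
  change f' (e (ρM a m)) = f' (ρN a (e m))
  rw [h, he, he', h]

theorem coe_toRepresentation_apply {G W : Type*} [Group G] [AddCommGroup W] [Module ℚ W]
    {ρ : Representation ℚ G W} (σ : Subrepresentation ρ) (a : G) (w : σ.toSubmodule) :
    (σ.toRepresentation a w : W) = ρ a w := rfl

section TensorPower

theorem toTensorAlgebra_injective (n : ℕ) :
    Function.Injective (TensorPower.toTensorAlgebra : ⨂[ℚ]^n H →ₗ[ℚ] TensorAlgebra ℚ H) := by
  intro s t h
  have h1 : ∀ t : ⨂[ℚ]^n H, TensorAlgebra.ofDirectSum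
      (DirectSum.of (fun n => ⨂[ℚ]^n H) n t) = TensorPower.toTensorAlgebra t := fun t =>
    DirectSum.toAddMonoid_of
      (fun n => (TensorPower.toTensorAlgebra : ⨂[ℚ]^n H →ₗ[ℚ] _).toAddMonoidHom) n t
  rw [← h1, ← h1] at h
  exact DirectSum.of_injective n (TensorAlgebra.equivDirectSum.symm.injective h)

theorem toTensorAlgebra_tensorPowerRep (ω : LinearMap.BilinForm ℚ H) {n : ℕ} (a : Sp ω)
    (t : ⨂[ℚ]^n H) : TensorPower.toTensorAlgebra (tensorPowerRep ω n a t)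
      = tensorRep ω a (TensorPower.toTensorAlgebra t) := by
  induction t using PiTensorProduct.induction_on with
  | smul_tprod c v =>
    change TensorPower.toTensorAlgebra (PiTensorProduct.map _ _) = _
    simp only [map_smul, PiTensorProduct.map_tprod, TensorPower.toTensorAlgebra_tprod,
      TensorAlgebra.tprod_apply]
    congr 1
    change _ = tensorMap _ _
    rw [map_list_prod, List.map_ofFn]
    congr 2
    funext i
    exact (tensorMap_ι _ _).symm
  | add s t hs ht => simp only [map_add, hs, ht]

theorem range_toTensorAlgebra (n : ℕ) :
    LinearMap.range (TensorPower.toTensorAlgebra : ⨂[ℚ]^n H →ₗ[ℚ] TensorAlgebra ℚ H)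
      = degree H n := by
  refine le_antisymm ?_ ?_
  · rintro _ ⟨t, rfl⟩
    induction t using PiTensorProduct.induction_on with
    | smul_tprod c v =>
      rw [map_smul, TensorPower.toTensorAlgebra_tprod, TensorAlgebra.tprod_apply]
      refine Submodule.smul_mem _ c ?_
      have : ∀ l : List H, (l.map (TensorAlgebra.ι ℚ)).prod ∈ degree H l.length := by
        intro l
        induction l with
        | nil => simp
        | cons u l ih =>
          rw [List.map_cons, List.prod_cons, List.length_cons, add_comm]
          exact mul_mem_degree (ι_mem_degree u) ih
      have h := this (List.ofFn v)
      rwa [List.map_ofFn, List.length_ofFn] at h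
    | add s t hs ht => rw [map_add]; exact add_mem hs ht
  · rw [degree_eq_span (Module.Basis.ofVectorSpace ℚ H), Submodule.span_le]
    rintro _ ⟨l, rfl, rfl⟩
    refine ⟨PiTensorProduct.tprod ℚ fun i => Module.Basis.ofVectorSpace ℚ H (l.get i), ?_⟩
    rw [TensorPower.toTensorAlgebra_tprod, TensorAlgebra.tprod_apply, wordBasis_apply]
    congr 1
    exact List.ext_getElem (by simp) (by simp)

theorem rot_toTensorAlgebra_reindex {κ : Type*} (b : Module.Basis κ ℚ H) (t : ⨂[ℚ]^4 H) :
    rot b (TensorPower.toTensorAlgebra (PiTensorProduct.reindex ℚ (fun _ => H) (finRotate 4) t))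
      = TensorPower.toTensorAlgebra t := by
  induction t using PiTensorProduct.induction_on with
  | smul_tprod c v =>
    have h0 : (finRotate 4).symm 0 = 3 := by decide
    have h1 : (finRotate 4).symm 1 = 0 := by decide
    have h2 : (finRotate 4).symm 2 = 1 := by decide
    have h3 : (finRotate 4).symm 3 = 2 := by decide
    have ht : ∀ v : Fin 4 → H, TensorAlgebra.tprod ℚ H 4 v = TensorAlgebra.ι ℚ (v 0) *
        (TensorAlgebra.ι ℚ (v 1) * (TensorAlgebra.ι ℚ (v 2) * TensorAlgebra.ι ℚ (v 3))) :=
      fun v => by simp [TensorAlgebra.tprod_apply, Fin.succ_one_eq_two]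
    simp only [map_smul]
    rw [PiTensorProduct.reindex_tprod, TensorPower.toTensorAlgebra_tprod,
      TensorPower.toTensorAlgebra_tprod, ht, ht, rot_ι_mul, h0, h1, h2, h3]
    simp only [mul_assoc]
  | add s t hs ht => simp only [map_add, hs, ht]

theorem mem_cyclicInvariants_iff (ω : LinearMap.BilinForm ℚ H) {n : ℕ} {t : ⨂[ℚ]^n H} :
    t ∈ (cyclicInvariants ω n).toSubmodule ↔
      PiTensorProduct.reindex ℚ (fun _ => H) (finRotate n) t = t := by
  refine ⟨fun h => h _ (Subgroup.mem_zpowers _), fun h s hs => ?_⟩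
  obtain ⟨k, rfl⟩ := mem_powers_iff_mem_zpowers.2 hs
  induction k with
  | zero => exact LinearEquiv.congr_fun PiTensorProduct.reindex_refl t
  | succ k ih =>
    have hk := ih ⟨k, by simp⟩
    simp only at hk ⊢
    have h2 := PiTensorProduct.reindex_reindex (R := ℚ) (s := fun _ => H) (finRotate n)
      (finRotate n ^ k) t
    rw [h, hk] at h2
    rw [pow_succ]
    exact h2.symm

/-- The tensors of degree `4` that are invariant under cyclic rotation of the factors. -/
def cyclicTensors {κ : Type*} (b : Module.Basis κ ℚ H) : Submodule ℚ (TensorAlgebra ℚ H) :=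
  degree H 4 ⊓ LinearMap.ker (rot b - LinearMap.id)

theorem mem_cyclicTensors {κ : Type*} {b : Module.Basis κ ℚ H} {t : TensorAlgebra ℚ H} :
    t ∈ cyclicTensors b ↔ t ∈ degree H 4 ∧ rot b t = t := by
  simp [cyclicTensors, sub_eq_zero]

theorem range_cyclicInvariants {κ : Type*} (b : Module.Basis κ ℚ H)
    (ω : LinearMap.BilinForm ℚ H) :
    LinearMap.range (TensorPower.toTensorAlgebra ∘ₗ (cyclicInvariants ω 4).toSubmodule.subtype)
      = cyclicTensors b := by
  ext t
  rw [mem_cyclicTensors, ← range_toTensorAlgebra]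
  constructor
  · rintro ⟨⟨s, hs⟩, rfl⟩
    refine ⟨⟨s, rfl⟩, ?_⟩
    have h := rot_toTensorAlgebra_reindex b s
    rwa [(mem_cyclicInvariants_iff ω).1 hs] at h
  · rintro ⟨⟨s, rfl⟩, hs⟩
    refine ⟨⟨s, (mem_cyclicInvariants_iff ω).2 (toTensorAlgebra_injective 4 ?_)⟩, rfl⟩
    have h := rot_toTensorAlgebra_reindex b
      ((PiTensorProduct.reindex ℚ (fun _ => H) (finRotate 4)).symm s)
    rw [LinearEquiv.apply_symm_apply, hs] at h
    have h2 := congrArg (PiTensorProduct.reindex ℚ (fun _ => H) (finRotate 4))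
      (toTensorAlgebra_injective 4 h)
    rw [LinearEquiv.apply_symm_apply] at h2
    rw [h2]

end TensorPower

section Derivations

/-- A derivation of `T(H)` kills `1`. -/
theorem derivation_one {D : Module.End ℚ (TensorAlgebra ℚ H)}
    (hD : ∀ s t, D (s * t) = D s * t + s * D t) : D 1 = 0 := by
  have := hD 1 1
  simpa using this

/-- The derivation of `T(H)` extending a linear map `δ : H → T(H)`, obtained from the algebra
homomorphism `u ↦ u + δ(u) ε` to the square-zero extension `T(H) ⊕ T(H) ε`. -/
def derivationOf (δ : H →ₗ[ℚ] TensorAlgebra ℚ H) : Module.End ℚ (TensorAlgebra ℚ H) :=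
  TrivSqZeroExt.sndHom (TensorAlgebra ℚ H) (TensorAlgebra ℚ H) |>.restrictScalars ℚ |>.comp
    (TensorAlgebra.lift ℚ
      ((TrivSqZeroExt.inlAlgHom ℚ (TensorAlgebra ℚ H) (TensorAlgebra ℚ H)).toLinearMap ∘ₗ
        TensorAlgebra.ι ℚ +
        (TrivSqZeroExt.inrHom (TensorAlgebra ℚ H) (TensorAlgebra ℚ H)).restrictScalars ℚ ∘ₗ
          δ)).toLinearMap

theorem derivationOf_ι (δ : H →ₗ[ℚ] TensorAlgebra ℚ H) (u : H) :
    derivationOf δ (TensorAlgebra.ι ℚ u) = δ u := by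
  simp [derivationOf]

theorem derivationOf_mul (δ : H →ₗ[ℚ] TensorAlgebra ℚ H) (s t : TensorAlgebra ℚ H) :
    derivationOf δ (s * t) = derivationOf δ s * t + s * derivationOf δ t := by
  have hfst : (TrivSqZeroExt.fstHom ℚ (TensorAlgebra ℚ H) (TensorAlgebra ℚ H)).comp
      (TensorAlgebra.lift ℚ
      ((TrivSqZeroExt.inlAlgHom ℚ (TensorAlgebra ℚ H) (TensorAlgebra ℚ H)).toLinearMap ∘ₗ
        TensorAlgebra.ι ℚ +
        (TrivSqZeroExt.inrHom (TensorAlgebra ℚ H) (TensorAlgebra ℚ H)).restrictScalars ℚ ∘ₗ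
          δ)) = AlgHom.id ℚ _ := TensorAlgebra.hom_ext (by ext; simp)
  have h := fun s => AlgHom.congr_fun hfst s
  simp only [AlgHom.comp_apply, TrivSqZeroExt.fstHom_apply, AlgHom.id_apply] at h
  simp only [derivationOf, LinearMap.comp_apply, AlgHom.toLinearMap_apply, map_mul,
    LinearMap.restrictScalars_apply, TrivSqZeroExt.sndHom_apply, TrivSqZeroExt.snd_mul, h,
    smul_eq_mul, op_smul_eq_mul]
  abel

/-- The left derivative of tensors that removes the first letter if it is `a`. -/
def leftDeriv {κ : Type*} [DecidableEq κ] (b : Module.Basis κ ℚ H) (a : κ) :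
    TensorAlgebra ℚ H →ₗ[ℚ] TensorAlgebra ℚ H :=
  (wordBasis b).constr ℚ fun l => match l with
    | [] => 0
    | c :: l => if c = a then wordBasis b l else 0

theorem coeff_leftDeriv {κ : Type*} [DecidableEq κ] (b : Module.Basis κ ℚ H) (a : κ) (l : List κ)
    (t : TensorAlgebra ℚ H) : coeff b l (leftDeriv b a t) = coeff b (a :: l) t := by
  have : coeff b l ∘ₗ leftDeriv b a = coeff b (a :: l) := by
    refine (wordBasis b).ext fun l' => ?_
    rw [LinearMap.comp_apply, leftDeriv, Module.Basis.constr_basis]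
    cases l' with
    | nil => rw [coeff_wordBasis]; simp
    | cons c l' =>
      by_cases h : c = a <;> simp [h, coeff_wordBasis]
  exact LinearMap.congr_fun this t

variable {g : ℕ} {ω : LinearMap.BilinForm ℚ H} {b : Module.Basis (Fin g ⊕ Fin g) ℚ H}

theorem coeff_poincareDual (D : Module.End ℚ (TensorAlgebra ℚ H)) (l : List (Fin g ⊕ Fin g)) :
    (∀ i, coeff b (Sum.inl i :: l) (poincareDual b D)
      = coeff b l (D (TensorAlgebra.ι ℚ (b (Sum.inr i))))) ∧
    (∀ i, coeff b (Sum.inr i :: l) (poincareDual b D)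
      = -coeff b l (D (TensorAlgebra.ι ℚ (b (Sum.inl i))))) ∧
    coeff b [] (poincareDual b D) = 0 := by
  refine ⟨fun i => ?_, fun i => ?_, ?_⟩
  · simp [poincareDual, coeff_ι_mul_cons, Finsupp.single_apply]
  · simp [poincareDual, coeff_ι_mul_cons, Finsupp.single_apply]
  · simp [poincareDual, coeff_ι_mul_nil]

/-- Poincaré duality as a linear map on the endomorphisms of `T(H)`. -/
def poincareDualMap (b : Module.Basis (Fin g ⊕ Fin g) ℚ H) :
    Module.End ℚ (TensorAlgebra ℚ H) →ₗ[ℚ] TensorAlgebra ℚ H where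
  toFun D := poincareDual b D
  map_add' D E := by
    simp only [poincareDual, LinearMap.add_apply, mul_add, ← Finset.sum_add_distrib]
    exact Finset.sum_congr rfl fun i _ => by abel
  map_smul' c D := by
    simp only [poincareDual, LinearMap.smul_apply, mul_smul_comm,
      Finset.smul_sum, smul_sub, RingHom.id_apply]

theorem poincareDualMap_injective (b : Module.Basis (Fin g ⊕ Fin g) ℚ H) (k : ℕ) :
    Function.Injective (poincareDualMap b ∘ₗ (symplecticDerivations b k).subtype) := by
  rw [injective_iff_map_eq_zero]
  rintro ⟨D, hD, hD2, hD3⟩ h0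
  replace h0 : poincareDual b D = 0 := h0
  have hι : ∀ a, D (TensorAlgebra.ι ℚ (b a)) = 0 := by
    rintro (i | i) <;> refine ext_coeff b fun l => ?_
    · have := (coeff_poincareDual (b := b) D l).2.1 i
      rw [h0, map_zero] at this
      rw [map_zero]
      linarith
    · have := (coeff_poincareDual (b := b) D l).1 i
      rw [h0, map_zero] at this
      rw [map_zero]
      exact this.symm
  refine Subtype.ext ((wordBasis b).ext fun l => ?_)
  change D _ = 0
  induction l with
  | nil => rw [wordBasis_nil, derivation_one hD]
  | cons a l ih => rw [wordBasis_cons, hD, hι, ih, zero_mul, mul_zero, add_zero]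

/-- A derivation sends `ω₀` to the difference of its dual tensor and the rotation of the latter. -/
theorem derivation_symplecticClass {D : Module.End ℚ (TensorAlgebra ℚ H)}
    (hD : ∀ s t, D (s * t) = D s * t + s * D t) :
    D (symplecticClass b) = poincareDual b D - rot b (poincareDual b D) := by
  simp only [symplecticClass, poincareDual, map_sum, map_sub, rot_ι_mul, hD,
    ← Finset.sum_sub_distrib]
  exact Finset.sum_congr rfl fun i _ => by abel

theorem range_poincareDualMap (b : Module.Basis (Fin g ⊕ Fin g) ℚ H) :
    LinearMap.range (poincareDualMap b ∘ₗ (symplecticDerivations b 2).subtype)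
      = cyclicTensors b := by
  ext t
  rw [mem_cyclicTensors]
  constructor
  · rintro ⟨⟨D, hD, hD2, hD3⟩, rfl⟩
    change poincareDual b D ∈ degree H 4 ∧ rot b (poincareDual b D) = poincareDual b D
    refine ⟨Submodule.sum_mem _ fun i _ => sub_mem ?_ ?_, ?_⟩
    · exact mul_mem_degree (ι_mem_degree _) (hD2 _)
    · exact mul_mem_degree (ι_mem_degree _) (hD2 _)
    · rw [derivation_symplecticClass hD, sub_eq_zero] at hD3
      exact hD3.symm
  · rintro ⟨ht, hrot⟩
    let δ : H →ₗ[ℚ] TensorAlgebra ℚ H := b.constr ℚ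
      (Sum.elim (fun i => -leftDeriv b (Sum.inr i) t) fun i => leftDeriv b (Sum.inl i) t)
    have hl : ∀ i, derivationOf δ (TensorAlgebra.ι ℚ (b (Sum.inl i)))
        = -leftDeriv b (Sum.inr i) t := fun i => by simp [derivationOf_ι, δ]
    have hr : ∀ i, derivationOf δ (TensorAlgebra.ι ℚ (b (Sum.inr i)))
        = leftDeriv b (Sum.inl i) t := fun i => by simp [derivationOf_ι, δ]
    have hdual : poincareDual b (derivationOf δ) = t := by
      refine ext_coeff b fun l => ?_
      rcases l with _ | ⟨i | i, l⟩
      · rw [(coeff_poincareDual _ []).2.2, (mem_degree_iff b).1 ht [] (by simp)]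
      · rw [(coeff_poincareDual _ l).1, hr, coeff_leftDeriv]
      · rw [(coeff_poincareDual _ l).2.1, hl, map_neg, coeff_leftDeriv, neg_neg]
    have hdeg : ∀ a, leftDeriv b a t ∈ degree H 3 := fun a => by
      rw [mem_degree_iff b]
      intro l hl
      rw [coeff_leftDeriv, (mem_degree_iff b).1 ht]
      simpa using hl
    refine ⟨⟨derivationOf δ, derivationOf_mul δ, fun u => ?_, ?_⟩, hdual⟩
    · rw [derivationOf_ι]
      have : LinearMap.range δ ≤ degree H 3 := by
        rw [LinearMap.range_eq_map, ← b.span_eq, Submodule.map_span, Submodule.span_le]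
        rintro _ ⟨_, ⟨i | i, rfl⟩, rfl⟩
        · simpa [δ] using hdeg _
        · simpa [δ] using hdeg _
      exact this ⟨u, rfl⟩
    · rw [derivation_symplecticClass (derivationOf_mul δ), hdual, hrot, sub_self]

/-- The tensor `∑ₖ bₖ ⊗ dₖ` of a symplectic basis and its dual basis is invariant: `Sp(H)` may be
applied to both factors of `poincareDual`. -/
theorem poincareDual_conj (hb : IsSymplecticBasis ω b) (a : Sp ω)
    (D : Module.End ℚ (TensorAlgebra ℚ H)) :
    poincareDual b (conjRep ω a D) = tensorRep ω a (poincareDual b D) := by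
  have hD : ∀ t, conjRep ω a D (tensorRep ω a t) = tensorRep ω a (D t) := fun t => by
    change tensorRep ω a (D (tensorRep ω a⁻¹ (tensorRep ω a t))) = _
    rw [← Module.End.mul_apply (tensorRep ω a⁻¹), ← map_mul, inv_mul_cancel, map_one,
      Module.End.one_apply]
  -- both sides are the value of a linear map at the invariant tensor `ω₀`
  let E := conjRep ω a D
  let φ : TensorAlgebra ℚ H →ₗ[ℚ] TensorAlgebra ℚ H :=
    (wordBasis b).constr ℚ fun l => match l with
      | [] => 0
      | k :: l => TensorAlgebra.ι ℚ (b k) * E (wordBasis b l)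
  have hφ : ∀ u t, φ (TensorAlgebra.ι ℚ u * t) = TensorAlgebra.ι ℚ u * E t := by
    intro u t
    have h : (LinearMap.mul ℚ (TensorAlgebra ℚ H) ∘ₗ TensorAlgebra.ι ℚ).compr₂ φ
        = (LinearMap.mul ℚ (TensorAlgebra ℚ H) ∘ₗ TensorAlgebra.ι ℚ).compl₂ E := by
      refine b.ext fun c => (wordBasis b).ext fun l' => ?_
      simp only [LinearMap.compr₂_apply, LinearMap.comp_apply, LinearMap.compl₂_apply,
        LinearMap.mul_apply', ← wordBasis_cons]
      exact (wordBasis b).constr_basis ℚ _ _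
    simpa using LinearMap.congr_fun₂ h u t
  have h1 : φ (symplecticClass b) = poincareDual b E := by
    simp only [symplecticClass, poincareDual, map_sum, map_sub, hφ]
  have h2 : φ (tensorRep ω a (symplecticClass b)) = tensorRep ω a (poincareDual b D) := by
    simp only [symplecticClass, poincareDual, map_sum, map_sub, tensorRep_mul, tensorRep_ι, hφ]
    simp only [← tensorRep_ι, E, hD]
  rw [tensorRep_symplecticClass hb] at h2
  exact h1.symm.trans h2

theorem exists_equiv_cyclicInvariants (hb : IsSymplecticBasis ω b) :
    ∃ Φ : ((symplecticDerivationsRep hb 2).toRepresentation).Equiv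
        (cyclicInvariants ω 4).toRepresentation,
      ∀ D, TensorPower.toTensorAlgebra (Φ D : ⨂[ℚ]^4 H) = poincareDual b D := by
  have h1 : Function.Injective
      (TensorPower.toTensorAlgebra ∘ₗ (cyclicInvariants ω 4).toSubmodule.subtype) :=
    (toTensorAlgebra_injective 4).comp (Submodule.subtype_injective _)
  have h2 : LinearMap.range (poincareDualMap b ∘ₗ
      (symplecticDerivationsRep hb 2).toSubmodule.subtype) = _ :=
    (range_poincareDualMap b).trans (range_cyclicInvariants b ω).symm
  have h3 : Function.Injective (poincareDualMap b ∘ₗ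
      (symplecticDerivationsRep hb 2).toSubmodule.subtype) := poincareDualMap_injective b 2
  obtain ⟨Φ, hΦ⟩ := exists_equiv_of_range_eq
    (ρM := (symplecticDerivationsRep hb 2).toRepresentation)
    (ρN := (cyclicInvariants ω 4).toRepresentation) (tensorRep ω)
    (f := poincareDualMap b ∘ₗ (symplecticDerivationsRep hb 2).toSubmodule.subtype)
    (f' := TensorPower.toTensorAlgebra ∘ₗ (cyclicInvariants ω 4).toSubmodule.subtype) h3 h1 h2
    (fun a D => by
      simp only [LinearMap.comp_apply, Submodule.subtype_apply, coe_toRepresentation_apply]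
      exact poincareDual_conj hb a _)
    (fun a t => by
      simp only [LinearMap.comp_apply, Submodule.subtype_apply, coe_toRepresentation_apply]
      exact toTensorAlgebra_tensorPowerRep ω a _)
  exact ⟨Φ, hΦ⟩

end Derivations

/-! ### Independence of the summands -/

section Decomposition

variable {g : ℕ} {ω : LinearMap.BilinForm ℚ H} {b : Module.Basis (Fin g ⊕ Fin g) ℚ H}

/-- The sum over the cyclic rotations of tensors of degree `4`. -/
def cyc (b : Module.Basis (Fin g ⊕ Fin g) ℚ H) : TensorAlgebra ℚ H →ₗ[ℚ] TensorAlgebra ℚ H :=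
  LinearMap.id + rot b + rot b ∘ₗ rot b + rot b ∘ₗ rot b ∘ₗ rot b

/-- Cyclic symmetrization of the insertion of `ω₀` at the first and second position. -/
def insertAdjacent (b : Module.Basis (Fin g ⊕ Fin g) ℚ H) :
    TensorAlgebra ℚ H →ₗ[ℚ] TensorAlgebra ℚ H :=
  cyc b ∘ₗ LinearMap.mulLeft ℚ (symplecticClass b)

/-- Cyclic symmetrization of the insertion of `ω₀` at two opposite positions: the product
`x ⊗ y ⊗ u ⊗ v` is turned into `u ⊗ y ⊗ v ⊗ x` before it is symmetrized. -/
def insertOpposite (b : Module.Basis (Fin g ⊕ Fin g) ℚ H) :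
    TensorAlgebra ℚ H →ₗ[ℚ] TensorAlgebra ℚ H :=
  cyc b ∘ₗ swap b ∘ₗ rot b ∘ₗ LinearMap.mulLeft ℚ (symplecticClass b)

theorem cyc_apply (t : TensorAlgebra ℚ H) :
    cyc b t = t + rot b t + rot b (rot b t) + rot b (rot b (rot b t)) := rfl

theorem tensorRep_cyc (a : Sp ω) (t : TensorAlgebra ℚ H) :
    tensorRep ω a (cyc b t) = cyc b (tensorRep ω a t) := by
  simp only [cyc_apply, map_add, tensorRep_rot]

theorem tensorRep_insertAdjacent (hb : IsSymplecticBasis ω b) (a : Sp ω) (t : TensorAlgebra ℚ H) :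
    tensorRep ω a (insertAdjacent b t) = insertAdjacent b (tensorRep ω a t) := by
  simp only [insertAdjacent, LinearMap.comp_apply, LinearMap.mulLeft_apply, tensorRep_cyc,
    tensorRep_mul, tensorRep_symplecticClass hb]

theorem tensorRep_insertOpposite (hb : IsSymplecticBasis ω b) (a : Sp ω) (t : TensorAlgebra ℚ H) :
    tensorRep ω a (insertOpposite b t) = insertOpposite b (tensorRep ω a t) := by
  simp only [insertOpposite, LinearMap.comp_apply, LinearMap.mulLeft_apply, tensorRep_cyc,
    tensorRep_mul, tensorRep_symplecticClass hb, tensorRep_rot, tensorRep_swap]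

theorem rot_four {t : TensorAlgebra ℚ H} (ht : t ∈ degree H 4) :
    rot b (rot b (rot b (rot b t))) = t :=
  ext_degree_four b (rot_mem_degree b (rot_mem_degree b (rot_mem_degree b (rot_mem_degree b ht))))
    ht fun k l m n => by simp only [coeff_rot_four]

theorem rot_cyc {t : TensorAlgebra ℚ H} (ht : t ∈ degree H 4) : rot b (cyc b t) = cyc b t := by
  rw [cyc_apply, map_add, map_add, map_add, rot_four ht]
  abel

theorem cyc_mem {t : TensorAlgebra ℚ H} (ht : t ∈ degree H 4) : cyc b t ∈ cyclicTensors b := by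
  refine mem_cyclicTensors.2 ⟨?_, rot_cyc ht⟩
  have h1 := rot_mem_degree b ht
  have h2 := rot_mem_degree b h1
  exact add_mem (add_mem (add_mem ht h1) h2) (rot_mem_degree b h2)

theorem symplecticClass_mem : symplecticClass b ∈ degree H 2 :=
  Submodule.sum_mem _ fun _ _ => sub_mem (mul_mem_degree (ι_mem_degree _) (ι_mem_degree _))
    (mul_mem_degree (ι_mem_degree _) (ι_mem_degree _))

theorem insertAdjacent_mem {t : TensorAlgebra ℚ H} (ht : t ∈ degree H 2) :
    insertAdjacent b t ∈ cyclicTensors b :=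
  cyc_mem (mul_mem_degree symplecticClass_mem ht)

theorem insertOpposite_mem {t : TensorAlgebra ℚ H} (ht : t ∈ degree H 2) :
    insertOpposite b t ∈ cyclicTensors b :=
  cyc_mem (swap_mem_degree b (rot_mem_degree b (mul_mem_degree symplecticClass_mem ht)))

/-- The coefficients of `ω₀`. -/
def eps : Fin g ⊕ Fin g → Fin g ⊕ Fin g → ℚ
  | Sum.inl i, Sum.inr j => if i = j then 1 else 0
  | Sum.inr i, Sum.inl j => if i = j then -1 else 0
  | _, _ => 0

theorem coeff_symplecticClass_mul (k l : Fin g ⊕ Fin g) (w : List (Fin g ⊕ Fin g))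
    (t : TensorAlgebra ℚ H) :
    coeff b (k :: l :: w) (symplecticClass b * t) = eps k l * coeff b w t := by
  rw [symplecticClass, Finset.sum_mul, map_sum]
  simp only [sub_mul, mul_assoc, map_sub, coeff_ι_mul_cons, Module.Basis.repr_self,
    Finsupp.single_apply]
  rcases k with i | i <;> rcases l with j | j <;> simp [eps, eq_comm]
  split_ifs <;> simp

theorem coeff_symplecticClass (k l : Fin g ⊕ Fin g) :
    coeff b [k, l] (symplecticClass b) = eps k l := by
  classical
  have := coeff_symplecticClass_mul (b := b) k l [] 1
  rw [mul_one, ← wordBasis_nil b, coeff_wordBasis] at this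
  simpa using this

theorem coeff_cyc (k l m n : Fin g ⊕ Fin g) (t : TensorAlgebra ℚ H) :
    coeff b [k, l, m, n] (cyc b t) = coeff b [k, l, m, n] t + coeff b [n, k, l, m] t
      + coeff b [m, n, k, l] t + coeff b [l, m, n, k] t := by
  simp only [cyc_apply, map_add, coeff_rot_four]

theorem coeff_insertAdjacent (k l m n : Fin g ⊕ Fin g) (t : TensorAlgebra ℚ H) :
    coeff b [k, l, m, n] (insertAdjacent b t)
      = eps k l * coeff b [m, n] t + eps n k * coeff b [l, m] t
      + eps m n * coeff b [k, l] t + eps l m * coeff b [n, k] t := by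
  simp only [insertAdjacent, LinearMap.comp_apply, LinearMap.mulLeft_apply, coeff_cyc,
    coeff_symplecticClass_mul]

theorem coeff_insertOpposite (k l m n : Fin g ⊕ Fin g) (t : TensorAlgebra ℚ H) :
    coeff b [k, l, m, n] (insertOpposite b t)
      = eps n l * coeff b [k, m] t + eps m k * coeff b [n, l] t
      + eps l n * coeff b [m, k] t + eps k m * coeff b [l, n] t := by
  simp only [insertOpposite, LinearMap.comp_apply, LinearMap.mulLeft_apply, coeff_cyc, coeff_swap,
    coeff_rot_four, coeff_symplecticClass_mul]

/-- If a functional `φ ∘ A` does not vanish at the highest weight vector of an irreducible `[μ]`,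
then it vanishes on no orbit of a nonzero vector of `[μ]`. -/
theorem eq_zero_of_functional {μ : YoungDiagram}
    (hirr : (irrep ω b μ).toRepresentation.IsIrreducible)
    {A : TensorAlgebra ℚ H →ₗ[ℚ] TensorAlgebra ℚ H} (φ : TensorAlgebra ℚ H →ₗ[ℚ] ℚ)
    (h0 : φ (A (highestVector b μ)) ≠ 0) {w : TensorAlgebra ℚ H}
    (hw : w ∈ (irrep ω b μ).toSubmodule) (h : ∀ a, φ (A (tensorRep ω a w)) = 0) : w = 0 := by
  let K : Subrepresentation (irrep ω b μ).toRepresentation :=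
    { toSubmodule :=
        { carrier := {u | ∀ a, φ (A (tensorRep ω a u)) = 0}
          add_mem' := fun hu hv a => by
            rw [Submodule.coe_add, map_add, map_add, map_add, hu a, hv a, add_zero]
          zero_mem' := fun a => by simp
          smul_mem' := fun c u hu a => by
            rw [Submodule.coe_smul, map_smul, map_smul, map_smul, hu a, smul_zero] }
      apply_mem_toSubmodule := fun c u hu a => by
        rw [coe_toRepresentation_apply, ← Module.End.mul_apply (tensorRep ω a), ← map_mul]
        exact hu (a * c) }
  rcases hirr.eq_bot_or_eq_top K with hK | hK
  · have hmem : (⟨w, hw⟩ : (irrep ω b μ).toSubmodule) ∈ K.toSubmodule := h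
    rw [hK] at hmem
    exact congrArg Subtype.val ((Submodule.mem_bot ℚ).1 hmem)
  · have hmem : (⟨highestVector b μ, highestVector_mem_irrep μ⟩ : (irrep ω b μ).toSubmodule)
        ∈ K.toSubmodule := by rw [hK]; exact Submodule.mem_top
    have := hmem 1
    rw [map_one] at this
    exact absurd this h0

/-- The letters `y₁, y₂, y₃, y₄`. -/
def yIdx (hg : 4 ≤ g) (k : Fin 4) : Fin g ⊕ Fin g := Sum.inr (Fin.castLE hg k)

@[simp] theorem eps_xIdx_xIdx (hg : 4 ≤ g) (k l : Fin 4) : eps (xIdx hg k) (xIdx hg l) = 0 := rfl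

@[simp] theorem eps_xIdx_yIdx (hg : 4 ≤ g) (k l : Fin 4) :
    eps (xIdx hg k) (yIdx hg l) = if k = l then 1 else 0 := by
  simp [eps, xIdx, yIdx]

@[simp] theorem eps_yIdx_xIdx (hg : 4 ≤ g) (k l : Fin 4) :
    eps (yIdx hg k) (xIdx hg l) = if k = l then -1 else 0 := by
  simp [eps, xIdx, yIdx]

/-- Tensors in `[4]` are already cyclically invariant. -/
theorem rot_of_mem_yd4 (hg : 4 ≤ g) {t : TensorAlgebra ℚ H}
    (ht : t ∈ (irrep ω b yd4).toSubmodule) : rot b t = t := by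
  have h := map_eq_zero_of_mem_irrep (tensorRep ω) (rot b - LinearMap.id)
    (fun a t => by simp [tensorRep_rot]) (by
      rw [highestVector_yd4 b hg]
      simp [rot_ι_mul, mul_assoc]) ht
  simpa [sub_eq_zero] using h

/-- The summands of `𝔞_g(2)` are embedded independently. They are treated one after the other: a
suitable word has nonzero coefficient in the image of one highest weight vector, and its coefficient
vanishes on the summands not yet treated. Words in the `x_i` do not occur in insertions of `ω₀`;
among them `x₁x₁x₁x₁` is excluded by skew-symmetry in `[2²]` and `[21²]`, and a cyclic
word `x₁x₂x₁x₂` is excluded by skew-symmetry in `[21²]`. -/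
theorem eq_zero_of_sum_eq_zero (hb : IsSymplecticBasis ω b) (hg : 4 ≤ g) {c : ℚ}
    {t₁ t₂ t₃ t₄ t₅ t₆ : TensorAlgebra ℚ H}
    (h₁ : t₁ ∈ (irrep ω b yd11).toSubmodule) (h₂ : t₂ ∈ (irrep ω b yd11).toSubmodule)
    (h₃ : t₃ ∈ (irrep ω b yd2).toSubmodule) (h₄ : t₄ ∈ (irrep ω b yd22).toSubmodule)
    (h₅ : t₅ ∈ (irrep ω b yd211).toSubmodule) (h₆ : t₆ ∈ (irrep ω b yd4).toSubmodule)
    (h : c • insertAdjacent b (symplecticClass b) + insertAdjacent b t₁ + insertOpposite b t₂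
      + insertAdjacent b t₃ + cyc b t₄ + cyc b t₅ + t₆ = 0) :
    c = 0 ∧ t₁ = 0 ∧ t₂ = 0 ∧ t₃ = 0 ∧ t₄ = 0 ∧ t₅ = 0 ∧ t₆ = 0 := by
  have hmem : ∀ {μ} (a : Sp ω) {t}, t ∈ (irrep ω b μ).toSubmodule →
      tensorRep ω a t ∈ (irrep ω b μ).toSubmodule :=
    fun {μ} a {t} ht => (irrep ω b μ).apply_mem_toSubmodule a ht
  -- the relation transported by a group element
  have ha : ∀ a : Sp ω, c • insertAdjacent b (symplecticClass b)
      + insertAdjacent b (tensorRep ω a t₁) + insertOpposite b (tensorRep ω a t₂)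
      + insertAdjacent b (tensorRep ω a t₃) + cyc b (tensorRep ω a t₄)
      + cyc b (tensorRep ω a t₅) + tensorRep ω a t₆ = 0 := fun a => by
    have := congrArg (tensorRep ω a) h
    simpa only [map_add, map_smul, map_zero, tensorRep_cyc, tensorRep_insertAdjacent hb,
      tensorRep_insertOpposite hb, tensorRep_symplecticClass hb] using this
  -- tensors in `[1²]` have no words with equal letters
  have hd : ∀ {t}, t ∈ (irrep ω b yd11).toSubmodule → ∀ k, coeff b [k, k] t = 0 :=
    fun ht k => by linarith [coeff_yd11_swap hg ht k k]
  have h6 : t₆ = 0 := by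
    refine eq_zero_of_functional (A := LinearMap.id) (isIrreducible_yd4 hb hg)
      (coeff b [xIdx hg 0, xIdx hg 0, xIdx hg 0, xIdx hg 0]) ?_ h₆ fun a => ?_
    · simp [highestVector_yd4 b hg, coeff_xVec_mul, coeff_xVec]
    · have := congrArg (coeff b [xIdx hg 0, xIdx hg 0, xIdx hg 0, xIdx hg 0]) (ha a)
      have e4 := coeff_yd22_swap hg (hmem a h₄) (xIdx hg 0) (xIdx hg 0) (xIdx hg 0) (xIdx hg 0)
      have e5 := coeff_yd211_swap hg (hmem a h₅) (xIdx hg 0) (xIdx hg 0) (xIdx hg 0) (xIdx hg 0)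
      simp only [map_add, map_smul, map_zero, coeff_insertAdjacent, coeff_insertOpposite,
        coeff_cyc, eps_xIdx_xIdx, zero_mul, smul_eq_mul, mul_zero, zero_add] at this
      rw [LinearMap.id_apply]
      linarith [e4.1, e5.1]
  subst h6
  have h4 : t₄ = 0 := by
    refine eq_zero_of_functional (A := cyc b) (isIrreducible_yd22 hb hg)
      (coeff b [xIdx hg 0, xIdx hg 1, xIdx hg 0, xIdx hg 1]) ?_ h₄ fun a => ?_
    · simp [highestVector_yd22 b hg, wedge₂, sub_mul, mul_sub, mul_assoc, coeff_cyc,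
        coeff_xVec_mul, coeff_xVec]
      norm_num
    · have := congrArg (coeff b [xIdx hg 0, xIdx hg 1, xIdx hg 0, xIdx hg 1]) (ha a)
      have e := fun k l m n => (coeff_yd211_swap hg (hmem a h₅) k l m n).1
      have e' := fun k l m n => (coeff_yd211_swap hg (hmem a h₅) k l m n).2
      have e13 : ∀ k l n, coeff b [k, l, k, n] (tensorRep ω a t₅) = 0 := fun k l n => by
        linarith [e k l k n, e' l k k n]
      simp only [map_add, map_smul, map_zero, coeff_insertAdjacent, coeff_insertOpposite,
        coeff_cyc, eps_xIdx_xIdx, zero_mul, smul_eq_mul, mul_zero, zero_add, add_zero,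
        e13] at this
      rw [coeff_cyc]
      linarith
  subst h4
  have h5 : t₅ = 0 := by
    refine eq_zero_of_functional (A := cyc b) (isIrreducible_yd211 hb hg)
      (coeff b [xIdx hg 0, xIdx hg 0, xIdx hg 1, xIdx hg 2]) ?_ h₅ fun a => ?_
    · simp [highestVector_yd211 b hg, wedge₃, sub_mul, add_mul, mul_assoc, coeff_cyc,
        coeff_xVec_mul, coeff_xVec]
    · have := congrArg (coeff b [xIdx hg 0, xIdx hg 0, xIdx hg 1, xIdx hg 2]) (ha a)
      simpa only [map_add, map_smul, map_zero, coeff_insertAdjacent, coeff_insertOpposite,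
        eps_xIdx_xIdx, zero_mul, smul_eq_mul, mul_zero, zero_add, add_zero] using this
  subst h5
  have h3 : t₃ = 0 := by
    refine eq_zero_of_functional (A := insertAdjacent b) (isIrreducible_yd2 hb hg)
      (coeff b [xIdx hg 1, yIdx hg 1, xIdx hg 0, xIdx hg 0]) ?_ h₃ fun a => ?_
    · simp [highestVector_yd2 b hg, coeff_insertAdjacent, coeff_xVec_mul, coeff_xVec]
    · have := congrArg (coeff b [xIdx hg 1, yIdx hg 1, xIdx hg 0, xIdx hg 0]) (ha a)
      simpa [coeff_insertAdjacent, coeff_insertOpposite, hd (hmem a h₁),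
        coeff_symplecticClass] using this
  subst h3
  have h1 : t₁ = 0 := by
    refine eq_zero_of_functional (A := insertAdjacent b) (isIrreducible_yd11 hb hg)
      (coeff b [xIdx hg 2, yIdx hg 2, xIdx hg 0, xIdx hg 1]) ?_ h₁ fun a => ?_
    · simp [highestVector_yd11 b hg, wedge₂, coeff_insertAdjacent, coeff_xVec_mul, coeff_xVec]
    · have := congrArg (coeff b [xIdx hg 2, yIdx hg 2, xIdx hg 0, xIdx hg 1]) (ha a)
      simpa [coeff_insertAdjacent, coeff_insertOpposite, coeff_symplecticClass] using this
  subst h1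
  have h2 : t₂ = 0 := by
    refine eq_zero_of_functional (A := insertOpposite b) (isIrreducible_yd11 hb hg)
      (coeff b [xIdx hg 2, xIdx hg 0, yIdx hg 2, xIdx hg 1]) ?_ h₂ fun a => ?_
    · simp [highestVector_yd11 b hg, wedge₂, coeff_insertOpposite, coeff_xVec_mul, coeff_xVec]
    · have := congrArg (coeff b [xIdx hg 2, xIdx hg 0, yIdx hg 2, xIdx hg 1]) (ha a)
      simpa [coeff_insertAdjacent, coeff_insertOpposite, coeff_symplecticClass] using this
  subst h2
  have hc := congrArg (coeff b [xIdx hg 0, yIdx hg 0, xIdx hg 1, yIdx hg 1]) h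
  simp [coeff_insertAdjacent, coeff_symplecticClass] at hc
  exact ⟨by linarith, rfl, rfl, rfl, rfl, rfl, rfl⟩

/-! ### Infinitesimal symplectic transformations -/

open Function

/-- The action on `T(H)` of an endomorphism `N` of `H` by derivations. -/
def der (N : H →ₗ[ℚ] H) : Module.End ℚ (TensorAlgebra ℚ H) :=
  derivationOf (TensorAlgebra.ι ℚ ∘ₗ N)

theorem der_ι (N : H →ₗ[ℚ] H) (u : H) :
    der N (TensorAlgebra.ι ℚ u) = TensorAlgebra.ι ℚ (N u) := derivationOf_ι _ u

theorem der_mul (N : H →ₗ[ℚ] H) (s t : TensorAlgebra ℚ H) :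
    der N (s * t) = der N s * t + s * der N t := derivationOf_mul _ s t

theorem der_one (N : H →ₗ[ℚ] H) : der N 1 = 0 := by
  simpa using der_mul N 1 1

theorem der_rot (N : H →ₗ[ℚ] H) (t : TensorAlgebra ℚ H) : der N (rot b t) = rot b (der N t) := by
  have : der N ∘ₗ rot b = rot b ∘ₗ der N := by
    refine linearMap_ext ?_ fun u t => ?_
    · simp [rot_one, der_one]
    · simp [rot_ι_mul, der_mul, der_ι, add_comm]
  exact LinearMap.congr_fun this t

theorem der_cyc (N : H →ₗ[ℚ] H) (t : TensorAlgebra ℚ H) : der N (cyc b t) = cyc b (der N t) := by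
  simp only [cyc_apply, map_add, der_rot]

/-- `N` is an element of square zero of the Lie algebra `𝔰𝔭(H)`. -/
structure IsInfinitesimal (ω : LinearMap.BilinForm ℚ H) (N : H →ₗ[ℚ] H) : Prop where
  sq : N ∘ₗ N = 0
  skew : ∀ u v, ω (N u) v + ω u (N v) = 0

/-- The unipotent element `1 + s N` of the symplectic group. -/
def unipotent (b : Module.Basis (Fin g ⊕ Fin g) ℚ H) {N : H →ₗ[ℚ] H} (hN : IsInfinitesimal ω N)
    (s : ℚ) : Sp ω :=
  have hsq : ∀ u, N (N u) = 0 := fun u => LinearMap.congr_fun hN.sq u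
  spOfInverse b (LinearMap.id + s • N) (LinearMap.id - s • N)
    (by ext u; simp [hsq]) (by ext u; simp [hsq]) fun k l => by
      have h1 := hN.skew (b k) (b l)
      have h2 := hN.skew (b k) (N (b l))
      rw [hsq, map_zero, add_zero] at h2
      simp only [LinearMap.add_apply, LinearMap.id_apply, LinearMap.smul_apply, map_add, map_smul,
        smul_eq_mul, h2]
      linear_combination s * h1

/-- On words of length at most `4`, the derivation `N` is a combination of unipotent elements of
the group, by numerical differentiation at `s = 0`: the action of `1 + s N` is a polynomial in `s`
of degree at most `4`, and the five-point formula is exact for those. -/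
theorem der_eq_of_mem_degree {N : H →ₗ[ℚ] H} (hN : IsInfinitesimal ω N) {n : ℕ} (hn : n ≤ 4)
    {t : TensorAlgebra ℚ H} (ht : t ∈ degree H n) :
    der N t = (1 / 12 : ℚ) • ((8 : ℚ) • (tensorRep ω (unipotent b hN 1) t
      - tensorRep ω (unipotent b hN (-1)) t) - (tensorRep ω (unipotent b hN 2) t
      - tensorRep ω (unipotent b hN (-2)) t)) := by
  let R : Module.End ℚ (TensorAlgebra ℚ H) := (1 / 12 : ℚ) • ((8 : ℚ) •
    (tensorRep ω (unipotent b hN 1) - tensorRep ω (unipotent b hN (-1)))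
    - (tensorRep ω (unipotent b hN 2) - tensorRep ω (unipotent b hN (-2))))
  have hu : ∀ s u, tensorRep ω (unipotent b hN s) (TensorAlgebra.ι ℚ u)
      = TensorAlgebra.ι ℚ u + s • TensorAlgebra.ι ℚ (N u) := fun s u => by
    rw [tensorRep_ι, ← map_smul, ← map_add]; rfl
  have h1 : ∀ s, tensorRep ω (unipotent b hN s) 1 = 1 := fun s => map_one (tensorMap _)
  suffices h : ∀ l : List (Fin g ⊕ Fin g), l.length ≤ 4 →
      der N (wordBasis b l) = R (wordBasis b l) by
    have hle : degree H n ≤ LinearMap.eqLocus (der N) R := by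
      rw [degree_eq_span b, Submodule.span_le]
      rintro _ ⟨l, hl, rfl⟩
      exact h l (by rw [hl]; exact hn)
    exact hle ht
  rintro l hl
  simp only [R, LinearMap.smul_apply, LinearMap.sub_apply]
  match l, hl with
  | [], _ => simp [der_one, h1]
  | [k], _ =>
    simp only [wordBasis_cons, wordBasis_nil, mul_one, hu, der_ι]
    module
  | [k, l], _ =>
    simp only [wordBasis_cons, wordBasis_nil, mul_one, tensorRep_mul, hu, der_ι, der_mul, add_mul,
      mul_add, smul_mul_assoc, mul_smul_comm]
    module
  | [k, l, m], _ =>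
    simp only [wordBasis_cons, wordBasis_nil, mul_one, tensorRep_mul, hu, der_ι, der_mul, add_mul,
      mul_add, smul_mul_assoc, mul_smul_comm]
    module
  | [k, l, m, n], _ =>
    simp only [wordBasis_cons, wordBasis_nil, mul_one, tensorRep_mul, hu, der_ι, der_mul, add_mul,
      mul_add, smul_mul_assoc, mul_smul_comm]
    module

/-- Stable modules of tensors of degree at most `4` are stable under the Lie algebra elements of
square zero. -/
theorem der_mem {N : H →ₗ[ℚ] H} (hN : IsInfinitesimal ω N) {n : ℕ} (hn : n ≤ 4)
    {W : Submodule ℚ (TensorAlgebra ℚ H)} (hW : ∀ a : Sp ω, ∀ w ∈ W, tensorRep ω a w ∈ W)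
    (b : Module.Basis (Fin g ⊕ Fin g) ℚ H) {t : TensorAlgebra ℚ H} (ht : t ∈ W)
    (hd : t ∈ degree H n) : der N t ∈ W := by
  rw [der_eq_of_mem_degree (b := b) hN hn hd]
  exact W.smul_mem _ (sub_mem (W.smul_mem _ (sub_mem (hW _ _ ht) (hW _ _ ht)))
    (sub_mem (hW _ _ ht) (hW _ _ ht)))

/-- The coefficients of `N t` for the derivation `N`. -/
theorem coeff_der (N : H →ₗ[ℚ] H) {n : ℕ} (m : Fin n → Fin g ⊕ Fin g) (t : TensorAlgebra ℚ H) :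
    coeff b (List.ofFn m) (der N t)
      = ∑ p, ∑ u, b.repr (N (b u)) (m p) * coeff b (List.ofFn (update m p u)) t := by
  induction n generalizing t with
  | zero =>
    have : coeff b [] ∘ₗ der N = 0 := linearMap_ext (by simp [der_one]) fun u t => by
      simp [der_mul, der_ι, coeff_ι_mul_nil]
    simpa using LinearMap.congr_fun this t
  | succ n ih =>
    let R : TensorAlgebra ℚ H →ₗ[ℚ] ℚ :=
      ∑ p, ∑ u, b.repr (N (b u)) (m p) • coeff b (List.ofFn (update m p u))
    have : coeff b (List.ofFn m) ∘ₗ der N = R := by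
      classical
      refine linearMap_ext ?_ fun v t => ?_
      · have h0 : ∀ m : Fin (n + 1) → Fin g ⊕ Fin g, coeff b (List.ofFn m) 1 = 0 := fun m => by
          rw [← wordBasis_nil b, coeff_wordBasis, List.ofFn_succ,
            if_neg (List.cons_ne_nil _ _).symm]
        simp only [R, LinearMap.comp_apply, LinearMap.sum_apply, LinearMap.smul_apply, der_one, h0,
          map_zero, smul_zero, Finset.sum_const_zero]
      · have h0 : ∀ u, List.ofFn (update m 0 u) = u :: List.ofFn (fun i => m (Fin.succ i)) :=
          fun u => by simp [List.ofFn_succ]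
        have hs : ∀ (p : Fin n) u, List.ofFn (update m p.succ u)
            = m 0 :: List.ofFn (update (fun i => m (Fin.succ i)) p u) := fun p u => by
          rw [List.ofFn_succ, update_of_ne (Fin.succ_ne_zero p).symm]
          exact congrArg (fun f => m 0 :: List.ofFn f) (funext fun i => by simp [update_apply])
        have hv : b.repr (N v) (m 0) = ∑ u, b.repr (N (b u)) (m 0) * b.repr v u := by
          conv_lhs => rw [← b.sum_repr v]
          simp only [map_sum, map_smul, Finsupp.finsetSum_apply, Finsupp.smul_apply, smul_eq_mul,
            mul_comm]
        simp only [R, LinearMap.comp_apply, LinearMap.sum_apply, LinearMap.smul_apply, smul_eq_mul,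
          der_mul, der_ι, map_add]
        rw [Fin.sum_univ_succ, List.ofFn_succ]
        simp only [h0, hs, coeff_ι_mul_cons, ih, hv, Finset.sum_mul, Finset.mul_sum]
        congr 1
        · exact Finset.sum_congr rfl fun u _ => by ring
        · exact Finset.sum_congr rfl fun p _ => Finset.sum_congr rfl fun u _ => by ring
    simpa [R, LinearMap.sum_apply] using LinearMap.congr_fun this t

/-- The raising operator `y_i ↦ x_j`, `y_j ↦ x_i` (so `y_i ↦ 2 x_i` if `i = j`). -/
def raise (b : Module.Basis (Fin g ⊕ Fin g) ℚ H) (i j : Fin g) : H →ₗ[ℚ] H :=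
  b.constr ℚ (Sum.elim (fun _ => 0) fun k =>
    (if k = i then b (Sum.inl j) else 0) + if k = j then b (Sum.inl i) else 0)

/-- The infinitesimal transvection `x_j ↦ x_i`, `y_i ↦ -y_j`. -/
def transvect (b : Module.Basis (Fin g ⊕ Fin g) ℚ H) (i j : Fin g) : H →ₗ[ℚ] H :=
  b.constr ℚ (Sum.elim (fun k => if k = j then b (Sum.inl i) else 0)
    fun k => if k = i then -b (Sum.inr j) else 0)

theorem isInfinitesimal_of_basis {N : H →ₗ[ℚ] H} (b : Module.Basis (Fin g ⊕ Fin g) ℚ H)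
    (h1 : ∀ k, N (N (b k)) = 0) (h2 : ∀ k l, ω (N (b k)) (b l) + ω (b k) (N (b l)) = 0) :
    IsInfinitesimal ω N where
  sq := b.ext h1
  skew u v := by
    have : ω.compl₁₂ N LinearMap.id + ω.compl₁₂ LinearMap.id N = 0 :=
      b.ext fun k => b.ext fun l => h2 k l
    exact LinearMap.congr_fun₂ this u v

theorem raise_inl (i j k : Fin g) : raise b i j (b (Sum.inl k)) = 0 :=
  b.constr_basis ℚ _ _

theorem raise_inr (i j k : Fin g) : raise b i j (b (Sum.inr k))
    = (if k = i then b (Sum.inl j) else 0) + if k = j then b (Sum.inl i) else 0 :=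
  b.constr_basis ℚ _ _

theorem transvect_inl (i j k : Fin g) : transvect b i j (b (Sum.inl k))
    = if k = j then b (Sum.inl i) else 0 :=
  b.constr_basis ℚ _ _

theorem transvect_inr (i j k : Fin g) : transvect b i j (b (Sum.inr k))
    = if k = i then -b (Sum.inr j) else 0 :=
  b.constr_basis ℚ _ _

theorem isInfinitesimal_raise (hb : IsSymplecticBasis ω b) (i j : Fin g) :
    IsInfinitesimal ω (raise b i j) := by
  refine isInfinitesimal_of_basis b ?_ ?_
  · rintro (k | k)
    · rw [raise_inl, map_zero]
    · rw [raise_inr]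
      split_ifs <;> simp only [map_add, raise_inl, map_zero, add_zero]
  · rintro (k | k) (l | l)
    · simp [raise_inl]
    · rw [raise_inl, raise_inr]
      split_ifs <;> simp [hb.xx]
    · rw [raise_inl, raise_inr]
      split_ifs <;> simp [hb.xx]
    · rw [raise_inr, raise_inr]
      split_ifs <;> simp [hb.xy, hb.yx, *] <;> grind

theorem isInfinitesimal_transvect (hb : IsSymplecticBasis ω b) {i j : Fin g} (hij : i ≠ j) :
    IsInfinitesimal ω (transvect b i j) := by
  refine isInfinitesimal_of_basis b ?_ ?_
  · rintro (k | k)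
    · rw [transvect_inl]
      split_ifs <;> simp [transvect_inl, hij]
    · rw [transvect_inr]
      split_ifs <;> simp [transvect_inr, hij.symm]
  · rintro (k | k) (l | l)
    · rw [transvect_inl, transvect_inl]
      split_ifs <;> simp [hb.xx]
    · rw [transvect_inl, transvect_inr]
      split_ifs <;> simp [hb.xy, *]; grind
    · rw [transvect_inl, transvect_inr]
      split_ifs <;> simp [hb.yx, *]; grind
    · rw [transvect_inr, transvect_inr]
      split_ifs <;> simp [hb.yy]

/-- A stable module of traceless tensors that does not involve words in the `x_i` is zero. By
induction on `k`, its elements do not involve words with at least `k` letters `y_i`: the raising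
operators lower this number, and tensors that they kill are treated by
`eq_zero_of_traceless_of_raising`. -/
theorem eq_zero_of_traceless_of_stable (hb : IsSymplecticBasis ω b) {n : ℕ} (hn : n ≤ 4)
    (hg : n ≤ g + 1) {Z : Submodule ℚ (TensorAlgebra ℚ H)}
    (hZ : ∀ a : Sp ω, ∀ t ∈ Z, tensorRep ω a t ∈ Z) (hd : Z ≤ degree H n)
    (hT : ∀ t ∈ Z, ∀ p q : Fin n, p < q → ∀ m : Fin n → Fin g ⊕ Fin g,
      ∑ i : Fin g, coeff b (List.ofFn (update (update m p (Sum.inl i)) q (Sum.inr i))) t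
      = ∑ i : Fin g, coeff b (List.ofFn (update (update m p (Sum.inr i)) q (Sum.inl i))) t)
    (hx : ∀ t ∈ Z, ∀ m : Fin n → Fin g, coeff b (List.ofFn fun p => Sum.inl (m p)) t = 0)
    {t : TensorAlgebra ℚ H} (ht : t ∈ Z) : t = 0 := by
  have hT' : ∀ t ∈ Z, ∀ p q : Fin n, p ≠ q → ∀ m : Fin n → Fin g ⊕ Fin g,
      ∑ i : Fin g, coeff b (List.ofFn (update (update m p (Sum.inl i)) q (Sum.inr i))) t
      = ∑ i : Fin g, coeff b (List.ofFn (update (update m p (Sum.inr i)) q (Sum.inl i))) t := by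
    intro t ht p q hpq m
    rcases lt_or_gt_of_ne hpq with h | h
    · exact hT t ht p q h m
    · simp only [update_comm hpq]
      exact (hT t ht q p h m).symm
  -- coefficients of the image under a raising operator
  have hR : ∀ i j (m : Fin n → Fin g ⊕ Fin g) t, coeff b (List.ofFn m) (der (raise b i j) t)
      = ∑ p, ((if m p = Sum.inl j then coeff b (List.ofFn (update m p (Sum.inr i))) t else 0)
        + if m p = Sum.inl i then coeff b (List.ofFn (update m p (Sum.inr j))) t else 0) := by
    intro i j m t
    rw [coeff_der]
    refine Finset.sum_congr rfl fun p _ => ?_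
    rw [Fintype.sum_sum_type]
    simp only [raise_inl, raise_inr, map_zero, Finsupp.zero_apply, zero_mul,
      Finset.sum_const_zero, zero_add, map_add, Finsupp.add_apply, add_mul, Finset.sum_add_distrib]
    have h : ∀ i j : Fin g, ∑ k, b.repr (if k = i then b (Sum.inl j) else 0) (m p)
        * coeff b (List.ofFn (update m p (Sum.inr k))) t
        = if m p = Sum.inl j then coeff b (List.ofFn (update m p (Sum.inr i))) t else 0 := by
      intro i j
      rw [Finset.sum_eq_single i (fun k _ hk => by simp [hk]) (by simp)]
      simp [Finsupp.single_apply, eq_comm]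
    rw [h, h]
  suffices h : ∀ k, ∀ t ∈ Z, (∀ m : Fin n → Fin g ⊕ Fin g,
      k ≤ (Finset.univ.filter fun p => (m p).isRight).card → coeff b (List.ofFn m) t = 0) →
      t = 0 by
    refine h (n + 1) t ht fun m hm => ?_
    have := hm.trans (Finset.card_le_univ _)
    simp at this
  intro k
  induction k with
  | zero =>
    intro t ht h
    refine ext_coeff b fun l => ?_
    rw [map_zero]
    by_cases hl : l.length = n
    · subst hl
      rw [← List.ofFn_get l]
      exact h _ (Nat.zero_le _)
    · exact (mem_degree_iff b).1 (hd ht) l hl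
  | succ k ih =>
    intro t ht h
    have h0 : ∀ i j, der (raise b i j) t = 0 := fun i j => by
      refine ih _ (der_mem (isInfinitesimal_raise hb i j) hn hZ b ht (hd ht)) fun m hm => ?_
      have hup : ∀ p i j, m p = Sum.inl i →
          coeff b (List.ofFn (update m p (Sum.inr j))) t = 0 := fun p i j hp => by
        refine h _ ((Nat.add_le_add_right hm 1).trans ?_)
        rw [← Finset.card_insert_of_notMem (a := p) (by simp [hp])]
        refine Finset.card_le_card fun q hq => ?_
        rcases eq_or_ne q p with rfl | hqp
        · simp
        · simpa [hqp] using hq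
      rw [hR]
      refine Finset.sum_eq_zero fun p _ => ?_
      rw [ite_eq_right_iff.2 fun hp => hup p _ _ hp, ite_eq_right_iff.2 fun hp => hup p _ _ hp,
        add_zero]
    refine ext_coeff b fun l => ?_
    rw [map_zero]
    by_cases hl : l.length = n
    · subst hl
      rw [← List.ofFn_get l]
      by_cases hy : ∃ p a, l.get p = Sum.inr a
      · obtain ⟨p, a, hp⟩ := hy
        exact eq_zero_of_traceless_of_raising (z := fun m => coeff b (List.ofFn m) t) hg
          (fun i j m => by rw [← hR, h0, map_zero]) (hT' t ht) hp
      · push Not at hy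
        have : ∀ p, ∃ i, l.get p = Sum.inl i := fun p => by
          rcases hp : l.get p with i | a
          · exact ⟨i, rfl⟩
          · exact absurd hp (hy p a)
        choose m hm using this
        rw [funext hm]
        exact hx t ht m
    · exact (mem_degree_iff b).1 (hd ht) l hl

/-! ### Tensors of degree two -/

/-- The permutation of the basis that permutes the indices of the `x_i` and of the `y_i`. -/
def permMap (b : Module.Basis (Fin g ⊕ Fin g) ℚ H) (π : Equiv.Perm (Fin g)) : H →ₗ[ℚ] H :=
  b.constr ℚ fun k => b (k.map π π)

theorem permMap_apply (π : Equiv.Perm (Fin g)) (k : Fin g ⊕ Fin g) :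
    permMap b π (b k) = b (k.map π π) := b.constr_basis ℚ _ _

/-- The symplectic automorphism given by a permutation of the indices. -/
def permSp (hb : IsSymplecticBasis ω b) (π : Equiv.Perm (Fin g)) : Sp ω :=
  spOfInverse b (permMap b π) (permMap b π⁻¹)
    (b.ext fun k => by rcases k with i | i <;> simp [permMap_apply])
    (b.ext fun k => by rcases k with i | i <;> simp [permMap_apply])
    fun k l => by
      rcases k with i | i <;> rcases l with j | j <;>
        simp [permMap_apply, hb.xx, hb.xy, hb.yx, hb.yy]

theorem tensorRep_permSp_ι (hb : IsSymplecticBasis ω b) (π : Equiv.Perm (Fin g)) (i : Fin g) :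
    tensorRep ω (permSp hb π) (TensorAlgebra.ι ℚ (b (Sum.inl i)))
      = TensorAlgebra.ι ℚ (b (Sum.inl (π i))) := by
  rw [tensorRep_ι]
  exact congrArg _ (permMap_apply π (Sum.inl i))

theorem exists_perm_of_injective {n : ℕ} {v w : Fin n → Fin g} (hv : Injective v)
    (hw : Injective w) : ∃ π : Equiv.Perm (Fin g), ∀ k, π (v k) = w k := by
  have := Equiv.Perm.isMultiplyPretransitive (Fin g) n
  obtain ⟨π, hπ⟩ := MulAction.exists_smul_eq (Equiv.Perm (Fin g))
    (⟨v, hv⟩ : Fin n ↪ Fin g) ⟨w, hw⟩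
  exact ⟨π, fun k => DFunLike.congr_fun hπ k⟩

/-- The part of `V` that is orthogonal to `S`. -/
def orth (b : Module.Basis (Fin g ⊕ Fin g) ℚ H) (V S : Submodule ℚ (TensorAlgebra ℚ H)) :
    Submodule ℚ (TensorAlgebra ℚ H) where
  carrier := {t | t ∈ V ∧ ∀ w ∈ S, inn b w t = 0}
  add_mem' hs ht := ⟨V.add_mem hs.1 ht.1, fun w hw => by
    rw [map_add, hs.2 w hw, ht.2 w hw, add_zero]⟩
  zero_mem' := ⟨V.zero_mem, fun w _ => map_zero _⟩
  smul_mem' c t ht := ⟨V.smul_mem c ht.1, fun w hw => by rw [map_smul, ht.2 w hw, smul_zero]⟩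

theorem tensorRep_mem_orth (hb : IsSymplecticBasis ω b) {V S : Submodule ℚ (TensorAlgebra ℚ H)}
    (hV : ∀ a : Sp ω, ∀ t ∈ V, tensorRep ω a t ∈ V)
    (hS : ∀ a : Sp ω, ∀ t ∈ S, tensorRep ω a t ∈ S) (a : Sp ω) :
    ∀ t ∈ orth b V S, tensorRep ω a t ∈ orth b V S :=
  fun t ht => ⟨hV a t ht.1, inn_tensorRep_eq_zero hb hS ht.2 a⟩

theorem le_of_orth_eq_zero {n : ℕ} {V S : Submodule ℚ (TensorAlgebra ℚ H)} (hV : V ≤ degree H n)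
    (hS : S ≤ V) (h : ∀ t ∈ orth b V S, t = 0) : V ≤ S := by
  intro t ht
  obtain ⟨w, hw, hwt⟩ := exists_orthogonal_projection b (hS.trans hV) t
  rwa [sub_eq_zero.1 (h (t - w) ⟨V.sub_mem ht (hS hw), hwt⟩)]

theorem tensorRep_mem_degree {n : ℕ} (a : Sp ω) :
    ∀ t ∈ degree H n, tensorRep ω a t ∈ degree H n :=
  fun _ ht => tensorMap_mem_degree _ ht

theorem der_transvect_mem (hb : IsSymplecticBasis ω b) {n : ℕ} (hn : n ≤ 4)
    {W : Submodule ℚ (TensorAlgebra ℚ H)} (hW : ∀ a : Sp ω, ∀ w ∈ W, tensorRep ω a w ∈ W)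
    {i j : Fin g} (hij : i ≠ j) {t : TensorAlgebra ℚ H} (ht : t ∈ W) (hd : t ∈ degree H n) :
    der (transvect b i j) t ∈ W :=
  der_mem (isInfinitesimal_transvect hb hij) hn hW b ht hd

/-- Words `x_i ⊗ x_j` lie in `[1²] + [2]`: polarize `x_1 ⊗ x_1` and add `x_1 ∧ x_2`. -/
theorem wordBasis_two_mem (hb : IsSymplecticBasis ω b) (hg : 4 ≤ g)
    {W : Submodule ℚ (TensorAlgebra ℚ H)} (hW : ∀ a : Sp ω, ∀ w ∈ W, tensorRep ω a w ∈ W)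
    (h11 : highestVector b yd11 ∈ W) (h2 : highestVector b yd2 ∈ W) (i j : Fin g) :
    wordBasis b [Sum.inl i, Sum.inl j] ∈ W := by
  rw [highestVector_yd11 b hg, wedge₂] at h11
  rw [highestVector_yd2 b hg] at h2
  simp only [wordBasis_cons, wordBasis_nil, mul_one]
  by_cases hij : i = j
  · subst hij
    have := hW (permSp hb (Equiv.swap (Fin.castLE hg 0) i)) _ h2
    simpa only [xVec, tensorRep_mul, tensorRep_permSp_ι, Equiv.swap_apply_left] using this
  · have hne : Fin.castLE hg 1 ≠ Fin.castLE hg 0 := (Fin.castLE_injective hg).ne (by decide)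
    have h3 := der_transvect_mem hb (by norm_num) hW hne h2
      (mul_mem_degree (ι_mem_degree _) (ι_mem_degree _))
    simp only [der_mul, der_ι, xVec, transvect_inl, if_true] at h3
    obtain ⟨π, hπ⟩ := exists_perm_of_injective (v := ![Fin.castLE hg 0, Fin.castLE hg 1])
      (w := ![i, j]) (by simp [Injective, Fin.forall_fin_two, hne.symm, hne])
      (by simpa [Injective, Fin.forall_fin_two, eq_comm] using hij)
    have hπ0 : π (Fin.castLE hg 0) = i := hπ 0
    have hπ1 : π (Fin.castLE hg 1) = j := hπ 1
    have e1 := hW (permSp hb π) _ h11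
    have e2 := hW (permSp hb π) _ h3
    simp only [xVec, map_sub, map_add, tensorRep_mul, tensorRep_permSp_ι, hπ0, hπ1] at e1 e2
    convert W.smul_mem (1 / 2) (W.add_mem e1 e2) using 1
    module

/-- `H ⊗ H` is spanned by `[1²]`, `[2]` and `ω₀`. -/
theorem degree_two_le (hb : IsSymplecticBasis ω b) (hg : 4 ≤ g)
    {W : Submodule ℚ (TensorAlgebra ℚ H)} (hd : W ≤ degree H 2)
    (hW : ∀ a : Sp ω, ∀ w ∈ W, tensorRep ω a w ∈ W)
    (h11 : highestVector b yd11 ∈ W) (h2 : highestVector b yd2 ∈ W)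
    (h0 : symplecticClass b ∈ W) : degree H 2 ≤ W := by
  refine le_of_orth_eq_zero (b := b) le_rfl hd fun t ht => ?_
  refine eq_zero_of_traceless_of_stable hb (n := 2) (by norm_num) (by omega)
    (tensorRep_mem_orth hb tensorRep_mem_degree hW) (fun t ht => ht.1) ?_ ?_ ht
  · intro t ht p q hpq m
    have hinn := ht.2 _ h0
    have hp : p = 0 := by omega
    have hq : q = 1 := by omega
    subst hp hq
    have hw : symplecticClass b = ∑ i, (wordBasis b [Sum.inl i, Sum.inr i]
        - wordBasis b [Sum.inr i, Sum.inl i]) := by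
      simp [symplecticClass, wordBasis_cons]
    rw [hw] at hinn
    simp only [map_sum, map_sub, LinearMap.sum_apply, LinearMap.sub_apply, inn_wordBasis_left,
      Finset.sum_sub_distrib, sub_eq_zero] at hinn
    simpa [List.ofFn_succ] using hinn
  · intro t ht m
    have := ht.2 _ (wordBasis_two_mem hb hg hW h11 h2 (m 0) (m 1))
    simpa [inn_wordBasis_left, List.ofFn_succ] using this

/-! ### Cyclic words -/

/-- The cyclic symmetrization of `x_i ⊗ x_j ⊗ x_k ⊗ x_l`. -/
def cycX (b : Module.Basis (Fin g ⊕ Fin g) ℚ H) (i j k l : Fin g) : TensorAlgebra ℚ H :=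
  cyc b (wordBasis b [Sum.inl i, Sum.inl j, Sum.inl k, Sum.inl l])

theorem cycX_eq (i j k l : Fin g) : cycX b i j k l
    = cyc b (TensorAlgebra.ι ℚ (b (Sum.inl i)) * (TensorAlgebra.ι ℚ (b (Sum.inl j)) *
      (TensorAlgebra.ι ℚ (b (Sum.inl k)) * TensorAlgebra.ι ℚ (b (Sum.inl l))))) := by
  simp [cycX, wordBasis_cons]

theorem cycX_mem_degree (i j k l : Fin g) : cycX b i j k l ∈ degree H 4 :=
  (mem_cyclicTensors.1 (cyc_mem (wordBasis_mem_degree b [Sum.inl i, Sum.inl j, Sum.inl k,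
    Sum.inl l]))).1

theorem cycX_rotate (i j k l : Fin g) : cycX b j k l i = cycX b i j k l := by
  rw [cycX_eq, cycX_eq, cyc_apply, cyc_apply]
  simp only [rot_ι_mul, mul_assoc]
  abel

theorem tensorRep_permSp_cycX (hb : IsSymplecticBasis ω b) (π : Equiv.Perm (Fin g))
    (i j k l : Fin g) :
    tensorRep ω (permSp hb π) (cycX b i j k l) = cycX b (π i) (π j) (π k) (π l) := by
  simp only [cycX_eq, tensorRep_cyc, tensorRep_mul, tensorRep_permSp_ι]

theorem der_transvect_cycX (i j k l m n : Fin g) : der (transvect b i j) (cycX b k l m n)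
    = (if k = j then cycX b i l m n else 0) + (if l = j then cycX b k i m n else 0)
      + (if m = j then cycX b k l i n else 0) + if n = j then cycX b k l m i else 0 := by
  simp only [cycX_eq, der_cyc, der_mul, der_ι, transvect_inl]
  split_ifs <;> simp only [map_zero, zero_mul, mul_zero, add_zero, zero_add, mul_add, map_add] <;>
    abel

/-- Cyclic words in four distinct letters are combinations of polarizations of the symmetrized
highest weight vectors of `[4]`, `[2²]` and `[21²]`: the six cyclic words on four letters form three
pairs `f`, `f'` of a word and its reversal. The sums `f + f'` are combinations of the polarizations
of `[4]` and `[2²]`, and the differences `f - f'` of permutations of the polarization of `[21²]`. -/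
theorem cycX_mem_of_distinct (hb : IsSymplecticBasis ω b) (hg : 4 ≤ g)
    {W : Submodule ℚ (TensorAlgebra ℚ H)} (hW : ∀ a : Sp ω, ∀ w ∈ W, tensorRep ω a w ∈ W)
    (h4 : highestVector b yd4 ∈ W) (h22 : cyc b (highestVector b yd22) ∈ W)
    (h211 : cyc b (highestVector b yd211) ∈ W) {v : Fin 4 → Fin g} (hv : Injective v) :
    cycX b (v 0) (v 1) (v 2) (v 3) ∈ W := by
  let x : Fin 4 → Fin g := Fin.castLE hg
  have hx : ∀ k l, x k = x l ↔ k = l := fun k l => (Fin.castLE_injective hg).eq_iff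
  let f : Fin 4 → Fin 4 → Fin 4 → Fin 4 → TensorAlgebra ℚ H :=
    fun i j k l => cycX b (x i) (x j) (x k) (x l)
  have hf : ∀ i j k l, f j k l i = f i j k l := fun i j k l => cycX_rotate _ _ _ _
  have hfd : ∀ i j k l, f i j k l ∈ degree H 4 := fun i j k l => cycX_mem_degree _ _ _ _
  have hder : ∀ i j k l m n, der (transvect b (x i) (x j)) (f k l m n)
      = (if k = j then f i l m n else 0) + (if l = j then f k i m n else 0)
      + (if m = j then f k l i n else 0) + if n = j then f k l m i else 0 :=
    fun i j k l m n => by simp only [f, der_transvect_cycX, hx]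
  have hmem : ∀ i j, i ≠ j → ∀ t ∈ W ⊓ degree H 4,
      der (transvect b (x i) (x j)) t ∈ W ⊓ degree H 4 := fun i j hij t ht =>
    der_transvect_mem hb le_rfl (W := W ⊓ degree H 4)
      (fun a t ht => Submodule.mem_inf.2 ⟨hW a t ht.1, tensorRep_mem_degree a t ht.2⟩)
      ((hx i j).not.2 hij) ht ht.2
  have hperm : ∀ (π : Equiv.Perm (Fin 4)), ∃ a : Sp ω, ∀ i j k l,
      tensorRep ω a (f i j k l) = f (π i) (π j) (π k) (π l) := fun π => by
    obtain ⟨σ, hσ⟩ := exists_perm_of_injective (v := x) (w := x ∘ π)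
      (Fin.castLE_injective hg) ((Fin.castLE_injective hg).comp π.injective)
    exact ⟨permSp hb σ, fun i j k l => by simp only [f, tensorRep_permSp_cycX, hσ, comp_apply]⟩
  -- rotations that move the letter `0` to the front
  have n1 : ∀ i k l, f i 0 k l = f 0 k l i := fun i k l => (hf i 0 k l).symm
  have n2 : ∀ i j l, f i j 0 l = f 0 l i j := fun i j l => by rw [← hf i, n1]
  have n3 : ∀ i j k, f i j k 0 = f 0 i j k := fun i j k => hf 0 i j k
  -- the polarization of the highest weight vector of `[4]`
  have r4 : f 0 1 2 3 + f 0 3 2 1 + f 0 1 3 2 + f 0 2 3 1 + f 0 2 1 3 + f 0 3 1 2 ∈ W := by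
    have h0 : f 0 0 0 0 ∈ W ⊓ degree H 4 := by
      refine ⟨?_, hfd _ _ _ _⟩
      have : f 0 0 0 0 = (4 : ℚ) • highestVector b yd4 := by
        simp only [f, cycX_eq, cyc_apply, rot_ι_mul, mul_assoc, highestVector_yd4 b hg]
        simp only [xVec, x]
        module
      rw [this]
      exact W.smul_mem _ h4
    have h1 := hmem 3 0 (by decide) _ (hmem 2 0 (by decide) _ (hmem 1 0 (by decide) _ h0))
    simp [hder] at h1
    simp only [n1, n2, n3] at h1
    convert W.smul_mem (1 / 4) h1.1 using 1
    module
  -- the polarization of the highest weight vector of `[2²]`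
  have r22 : (2 : ℚ) • (f 0 1 2 3 + f 0 3 2 1) - (f 0 1 3 2 + f 0 2 3 1)
      - (f 0 2 1 3 + f 0 3 1 2) ∈ W := by
    have h0 : f 0 1 0 1 - f 0 0 1 1 ∈ W ⊓ degree H 4 := by
      refine ⟨?_, sub_mem (hfd _ _ _ _) (hfd _ _ _ _)⟩
      have : f 0 1 0 1 - f 0 0 1 1 = (1 / 2 : ℚ) • cyc b (highestVector b yd22) := by
        have : cyc b (highestVector b yd22) = f 0 1 0 1 - f 0 1 1 0 - f 1 0 0 1 + f 1 0 1 0 := by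
          simp only [f, cycX_eq, highestVector_yd22 b hg, wedge₂, sub_mul, mul_sub, mul_assoc,
            map_sub]
          simp only [xVec, x]
          abel
        rw [this, n3 1 0 1, n3 0 1 1, ← hf 1 0 0 1]
        module
      rw [this]
      exact W.smul_mem _ h22
    have h1 := hmem 3 1 (by decide) _ (hmem 2 0 (by decide) _ h0)
    simp [hder] at h1
    simp only [n1, n2] at h1
    convert h1.1 using 1
    module
  -- the polarization of the highest weight vector of `[21²]`
  have r211 : f 0 1 2 3 + f 0 3 1 2 - f 0 2 1 3 - f 0 3 2 1 ∈ W := by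
    have h0 : f 0 0 1 2 - f 0 0 2 1 ∈ W ⊓ degree H 4 := by
      refine ⟨?_, sub_mem (hfd _ _ _ _) (hfd _ _ _ _)⟩
      have : f 0 0 1 2 - f 0 0 2 1 = (1 / 2 : ℚ) • cyc b (highestVector b yd211) := by
        have : cyc b (highestVector b yd211) = f 0 1 2 0 - f 1 0 2 0 - f 2 1 0 0 - f 0 2 1 0
            + f 1 2 0 0 + f 2 0 1 0 := by
          simp only [f, cycX_eq, highestVector_yd211 b hg, wedge₃, sub_mul, add_mul, mul_assoc,
            map_sub, map_add]
          rfl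
        rw [this, n3 0 1 2, n3 1 0 2, n3 2 1 0, n3 0 2 1, n3 1 2 0, n3 2 0 1, n3 0 1 2, n2 0 1 2]
        module
      rw [this]
      exact W.smul_mem _ h211
    have h1 := hmem 3 0 (by decide) _ h0
    simp [hder] at h1
    simp only [n1] at h1
    convert h1.1 using 1
    module
  have key : f 0 1 2 3 ∈ W := by
    obtain ⟨a₁, h₁⟩ := hperm (Equiv.swap 2 3)
    obtain ⟨a₂, h₂⟩ := hperm (Equiv.swap 1 2 * Equiv.swap 2 3)
    have e1 := hW a₁ _ r211
    have e2 := hW a₂ _ r211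
    have p₁ : ∀ k, Equiv.swap (2 : Fin 4) 3 k = ![0, 1, 3, 2] k := by decide
    have p₂ : ∀ k, (Equiv.swap 1 2 * Equiv.swap 2 3 : Equiv.Perm (Fin 4)) k
        = ![0, 2, 3, 1] k := by decide
    simp only [map_sub, map_add, h₁, h₂, p₁, p₂] at e1 e2
    simp at e1 e2
    convert W.add_mem (W.smul_mem (1 / 6) (W.add_mem r4 r22))
      (W.smul_mem (1 / 4) (W.add_mem (W.add_mem r211 e1) e2)) using 1
    module
  obtain ⟨π, hπ⟩ := exists_perm_of_injective (Fin.castLE_injective hg) hv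
  have := hW (permSp hb π) _ key
  simpa only [f, tensorRep_permSp_cycX, hπ, x] using this

/-- Cyclic words in arbitrary letters `x_i` are obtained from those in distinct letters by
transvections; there are enough letters because `g ≥ 4`. -/
theorem cycX_mem_of_highestVector (hb : IsSymplecticBasis ω b) (hg : 4 ≤ g)
    {W : Submodule ℚ (TensorAlgebra ℚ H)} (hW : ∀ a : Sp ω, ∀ w ∈ W, tensorRep ω a w ∈ W)
    (h4 : highestVector b yd4 ∈ W) (h22 : cyc b (highestVector b yd22) ∈ W)
    (h211 : cyc b (highestVector b yd211) ∈ W) (v : Fin 4 → Fin g) :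
    cycX b (v 0) (v 1) (v 2) (v 3) ∈ W := by
  suffices h : ∀ k (v : Fin 4 → Fin g), 4 ≤ (Finset.univ.image v).card + k →
      cycX b (v 0) (v 1) (v 2) (v 3) ∈ W from h 4 v (Nat.le_add_left _ _)
  intro k
  induction k with
  | zero =>
    intro v hcard
    refine cycX_mem_of_distinct hb hg hW h4 h22 h211 ?_
    rw [← Set.injOn_univ, ← Finset.coe_univ, ← Finset.card_image_iff]
    exact le_antisymm Finset.card_image_le (by simpa using hcard)
  | succ k ih =>
    intro v hcard
    by_cases hv : Injective v
    · exact cycX_mem_of_distinct hb hg hW h4 h22 h211 hv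
    -- replace one of two equal letters by a new letter `i`; the transvection undoes this
    obtain ⟨p, q, hpq, hne⟩ : ∃ p q, v p = v q ∧ p ≠ q := by
      simpa [Injective] using hv
    obtain ⟨i, hi⟩ : ∃ i, ∀ r, v r ≠ i := by
      by_contra! h
      refine hv ((Fintype.bijective_iff_surjective_and_card v).2 ⟨h, ?_⟩).1
      have := Fintype.card_le_of_surjective v h
      simp at this ⊢
      omega
    have himg : Finset.univ.image (update v p i) = insert i (Finset.univ.image v) := by
      ext j
      simp only [Finset.mem_image, Finset.mem_univ, true_and, Finset.mem_insert]
      constructor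
      · rintro ⟨r, rfl⟩
        by_cases hr : r = p
        · subst hr; simp
        · exact Or.inr ⟨r, by rw [update_of_ne hr]⟩
      · rintro (rfl | ⟨r, rfl⟩)
        · exact ⟨p, update_self ..⟩
        · by_cases hr : r = p
          · exact ⟨q, by rw [update_of_ne hne.symm, hr, hpq]⟩
          · exact ⟨r, by rw [update_of_ne hr]⟩
    have hmem := ih (update v p i) (by
      rw [himg, Finset.card_insert_of_notMem (by simpa using hi)]
      omega)
    have hmem' := der_transvect_mem hb le_rfl
      (W := W) hW (hi p) hmem (cycX_mem_degree _ _ _ _)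
    rw [der_transvect_cycX] at hmem'
    fin_cases p <;> simpa [hi] using hmem'

/-! ### The decomposition -/

theorem cyc_wordBasis (k l m n : Fin g ⊕ Fin g) : cyc b (wordBasis b [k, l, m, n])
    = wordBasis b [k, l, m, n] + wordBasis b [l, m, n, k] + wordBasis b [m, n, k, l]
      + wordBasis b [n, k, l, m] := by
  simp only [cyc_apply, rot, wordMap_wordBasis]
  rfl

theorem insertAdjacent_wordBasis (m n : Fin g ⊕ Fin g) : insertAdjacent b (wordBasis b [m, n])
    = ∑ i, (cyc b (wordBasis b [Sum.inl i, Sum.inr i, m, n])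
      - cyc b (wordBasis b [Sum.inr i, Sum.inl i, m, n])) := by
  simp only [insertAdjacent, LinearMap.comp_apply, LinearMap.mulLeft_apply, symplecticClass,
    Finset.sum_mul, sub_mul, mul_assoc, ← wordBasis_cons, map_sum, map_sub]

theorem insertOpposite_wordBasis (m n : Fin g ⊕ Fin g) : insertOpposite b (wordBasis b [m, n])
    = ∑ i, (cyc b (wordBasis b [m, Sum.inr i, n, Sum.inl i])
      - cyc b (wordBasis b [m, Sum.inl i, n, Sum.inr i])) := by
  simp only [insertOpposite, LinearMap.comp_apply, LinearMap.mulLeft_apply, symplecticClass,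
    Finset.sum_mul, sub_mul, mul_assoc, ← wordBasis_cons, map_sum, map_sub, rot, swap,
    wordMap_wordBasis]
  rfl

theorem tensorRep_mem_cyclicTensors (a : Sp ω) :
    ∀ t ∈ cyclicTensors b, tensorRep ω a t ∈ cyclicTensors b := fun t ht => by
  obtain ⟨h1, h2⟩ := mem_cyclicTensors.1 ht
  exact mem_cyclicTensors.2 ⟨tensorRep_mem_degree a t h1, by rw [← tensorRep_rot, h2]⟩

theorem coeff_rotate_of_mem {t : TensorAlgebra ℚ H} (ht : t ∈ cyclicTensors b)
    (k l m n : Fin g ⊕ Fin g) : coeff b [k, l, m, n] t = coeff b [n, k, l, m] t := by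
  conv_lhs => rw [← (mem_cyclicTensors.1 ht).2]
  exact coeff_rot_four ..

/-- A stable module of cyclically invariant tensors that contains the insertions of `ω₀` and the
cyclic words in the `x_i` contains everything: the tensors orthogonal to it are traceless and do
not involve words in the `x_i`. -/
theorem cyclicTensors_le (hb : IsSymplecticBasis ω b) (hg : 4 ≤ g)
    {W : Submodule ℚ (TensorAlgebra ℚ H)} (hd : W ≤ cyclicTensors b)
    (hW : ∀ a : Sp ω, ∀ w ∈ W, tensorRep ω a w ∈ W)
    (hA : ∀ t ∈ degree H 2, insertAdjacent b t ∈ W)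
    (hO : ∀ t ∈ degree H 2, insertOpposite b t ∈ W)
    (hX : ∀ i j k l, cycX b i j k l ∈ W) : cyclicTensors b ≤ W := by
  have hle : cyclicTensors b ≤ degree H 4 := fun t ht => (mem_cyclicTensors.1 ht).1
  refine le_of_orth_eq_zero (b := b) hle hd fun t ht => ?_
  have hcyc : ∀ t ∈ cyclicTensors b, ∀ k l m n,
      inn b (cyc b (wordBasis b [k, l, m, n])) t = 4 * coeff b [k, l, m, n] t := by
    intro t ht k l m n
    simp only [cyc_wordBasis, map_add, LinearMap.add_apply, inn_wordBasis_left]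
    rw [coeff_rotate_of_mem ht l m n k, coeff_rotate_of_mem ht m n k l,
      coeff_rotate_of_mem ht l m n k, coeff_rotate_of_mem ht k l m n]
    ring
  refine eq_zero_of_traceless_of_stable hb (n := 4) le_rfl (by omega)
    (tensorRep_mem_orth hb tensorRep_mem_cyclicTensors hW) (fun t ht => hle ht.1) ?_ ?_ ht
  · intro t ht
    have tA : ∀ m n, ∑ i, coeff b [Sum.inl i, Sum.inr i, m, n] t
        = ∑ i, coeff b [Sum.inr i, Sum.inl i, m, n] t := fun m n => by
      have := ht.2 _ (hA _ (wordBasis_mem_degree b [m, n]))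
      rw [insertAdjacent_wordBasis] at this
      simp only [map_sum, map_sub, LinearMap.sum_apply, LinearMap.sub_apply, hcyc t ht.1,
        Finset.sum_sub_distrib, ← Finset.mul_sum] at this
      linarith
    have tO : ∀ m n, ∑ i, coeff b [m, Sum.inr i, n, Sum.inl i] t
        = ∑ i, coeff b [m, Sum.inl i, n, Sum.inr i] t := fun m n => by
      have := ht.2 _ (hO _ (wordBasis_mem_degree b [m, n]))
      rw [insertOpposite_wordBasis] at this
      simp only [map_sum, map_sub, LinearMap.sum_apply, LinearMap.sub_apply, hcyc t ht.1,
        Finset.sum_sub_distrib, ← Finset.mul_sum] at this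
      linarith
    have hr := coeff_rotate_of_mem ht.1
    intro p q hpq m
    fin_cases p <;> fin_cases q <;> simp at hpq <;> simp [List.ofFn_succ]
    · exact tA _ _
    · simpa only [hr _ (m 1) _ (m 3)] using (tO (m 3) (m 1)).symm
    · simpa only [hr _ (m 1) (m 2) _] using (tA (m 1) (m 2)).symm
    · simpa only [← hr _ _ (m 3) (m 0)] using tA (m 3) (m 0)
    · exact (tO _ _).symm
    · simpa only [hr (m 0), hr (Sum.inl _) (m 0), hr (Sum.inr _) (m 0)] using tA (m 0) (m 1)
  · intro t ht m
    have := ht.2 _ (hX (m 0) (m 1) (m 2) (m 3))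
    rw [cycX, hcyc t ht.1] at this
    simpa [List.ofFn_succ] using this

theorem eps_symm (k l : Fin g ⊕ Fin g) : eps k l = -eps l k := by
  rcases k with i | i <;> rcases l with j | j <;> simp [eps, eq_comm] <;> split_ifs <;> simp

theorem insertOpposite_symplecticClass : insertOpposite b (symplecticClass b) = 0 := by
  refine ext_degree_four b (mem_cyclicTensors.1 (insertOpposite_mem symplecticClass_mem)).1
    (zero_mem _) fun k l m n => ?_
  rw [coeff_insertOpposite, map_zero]
  simp only [coeff_symplecticClass]
  rw [eps_symm l n, eps_symm m k]
  ring

theorem insertOpposite_of_mem_yd2 (hg : 4 ≤ g)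
    {t : TensorAlgebra ℚ H} (ht : t ∈ (irrep ω b yd2).toSubmodule) : insertOpposite b t = 0 := by
  refine ext_degree_four b (mem_cyclicTensors.1 (insertOpposite_mem
    (mem_degree_of_mem_irrep (highestVector_yd2_mem hg) ht))).1 (zero_mem _) fun k l m n => ?_
  rw [coeff_insertOpposite, map_zero, coeff_yd2_swap hg ht m k, coeff_yd2_swap hg ht l n,
    eps_symm l n, eps_symm m k]
  ring

/-- The map from `ℚ ⊕ 2[1²] ⊕ [2] ⊕ [2²] ⊕ [21²] ⊕ [4]` to `T(H)` that realizes the decomposition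
of the cyclically invariant tensors of degree `4`. -/
def summandsMap (ω : LinearMap.BilinForm ℚ H) (b : Module.Basis (Fin g ⊕ Fin g) ℚ H) :
    (ℚ × (irrep ω b yd11).toSubmodule × (irrep ω b yd11).toSubmodule ×
      (irrep ω b yd2).toSubmodule × (irrep ω b yd22).toSubmodule ×
      (irrep ω b yd211).toSubmodule × (irrep ω b yd4).toSubmodule) →ₗ[ℚ] TensorAlgebra ℚ H :=
  (LinearMap.toSpanSingleton ℚ _ (insertAdjacent b (symplecticClass b))).coprod <|
    (insertAdjacent b ∘ₗ Submodule.subtype _).coprod <|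
    (insertOpposite b ∘ₗ Submodule.subtype _).coprod <|
    (insertAdjacent b ∘ₗ Submodule.subtype _).coprod <|
    (cyc b ∘ₗ Submodule.subtype _).coprod <|
    (cyc b ∘ₗ Submodule.subtype _).coprod <| Submodule.subtype _

theorem summandsMap_apply (c : ℚ) (t₁ t₂ : (irrep ω b yd11).toSubmodule)
    (t₃ : (irrep ω b yd2).toSubmodule) (t₄ : (irrep ω b yd22).toSubmodule)
    (t₅ : (irrep ω b yd211).toSubmodule) (t₆ : (irrep ω b yd4).toSubmodule) :
    summandsMap ω b (c, t₁, t₂, t₃, t₄, t₅, t₆)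
      = c • insertAdjacent b (symplecticClass b) + insertAdjacent b t₁ + insertOpposite b t₂
        + insertAdjacent b t₃ + cyc b t₄ + cyc b t₅ + t₆ := by
  simp only [summandsMap, LinearMap.coprod_apply, LinearMap.comp_apply, Submodule.subtype_apply,
    LinearMap.toSpanSingleton_apply]
  abel

theorem summandsMap_injective (hb : IsSymplecticBasis ω b) (hg : 4 ≤ g) :
    Function.Injective (summandsMap ω b) := by
  rw [injective_iff_map_eq_zero]
  rintro ⟨c, t₁, t₂, t₃, t₄, t₅, t₆⟩ h
  rw [summandsMap_apply] at h
  simpa using eq_zero_of_sum_eq_zero hb hg t₁.2 t₂.2 t₃.2 t₄.2 t₅.2 t₆.2 h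

theorem summandsMap_equivariant (hb : IsSymplecticBasis ω b) (a : Sp ω)
    (t : ℚ × (irrep ω b yd11).toSubmodule × (irrep ω b yd11).toSubmodule ×
      (irrep ω b yd2).toSubmodule × (irrep ω b yd22).toSubmodule ×
      (irrep ω b yd211).toSubmodule × (irrep ω b yd4).toSubmodule) :
    summandsMap ω b (((Representation.trivial ℚ (Sp ω) ℚ).prod <|
        (irrep ω b yd11).toRepresentation.prod <| (irrep ω b yd11).toRepresentation.prod <|
        (irrep ω b yd2).toRepresentation.prod <| (irrep ω b yd22).toRepresentation.prod <|
        (irrep ω b yd211).toRepresentation.prod (irrep ω b yd4).toRepresentation) a t)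
      = tensorRep ω a (summandsMap ω b t) := by
  obtain ⟨c, t₁, t₂, t₃, t₄, t₅, t₆⟩ := t
  rw [summandsMap_apply c t₁ t₂ t₃ t₄ t₅ t₆]
  simp only [map_add, map_smul, tensorRep_cyc, tensorRep_insertAdjacent hb,
    tensorRep_insertOpposite hb, tensorRep_symplecticClass hb]
  exact summandsMap_apply (ω := ω) c ((irrep ω b yd11).toRepresentation a t₁)
    ((irrep ω b yd11).toRepresentation a t₂) ((irrep ω b yd2).toRepresentation a t₃)
    ((irrep ω b yd22).toRepresentation a t₄) ((irrep ω b yd211).toRepresentation a t₅)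
    ((irrep ω b yd4).toRepresentation a t₆)

theorem range_summandsMap (hb : IsSymplecticBasis ω b) (hg : 4 ≤ g) :
    LinearMap.range (summandsMap ω b) = cyclicTensors b := by
  have hd := fun {μ : YoungDiagram} {n} (h : highestVector b μ ∈ degree H n)
    (t : (irrep ω b μ).toSubmodule) => mem_degree_of_mem_irrep h t.2
  have hle : LinearMap.range (summandsMap ω b) ≤ cyclicTensors b := by
    rintro _ ⟨⟨c, t₁, t₂, t₃, t₄, t₅, t₆⟩, rfl⟩
    rw [summandsMap_apply]
    have h6 : (t₆ : TensorAlgebra ℚ H) ∈ cyclicTensors b :=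
      mem_cyclicTensors.2 ⟨hd (highestVector_yd4_mem hg) t₆, rot_of_mem_yd4 hg t₆.2⟩
    exact add_mem (add_mem (add_mem (add_mem (add_mem (add_mem
      (Submodule.smul_mem _ _ (insertAdjacent_mem symplecticClass_mem))
      (insertAdjacent_mem (hd (highestVector_yd11_mem hg) t₁)))
      (insertOpposite_mem (hd (highestVector_yd11_mem hg) t₂)))
      (insertAdjacent_mem (hd (highestVector_yd2_mem hg) t₃)))
      (cyc_mem (hd (highestVector_yd22_mem hg) t₄)))
      (cyc_mem (hd (highestVector_yd211_mem hg) t₅))) h6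
  have hst : ∀ a : Sp ω, ∀ t ∈ LinearMap.range (summandsMap ω b),
      tensorRep ω a t ∈ LinearMap.range (summandsMap ω b) := by
    rintro a _ ⟨t, rfl⟩
    exact ⟨_, summandsMap_equivariant hb a t⟩
  have hhv := fun μ => highestVector_mem_irrep (ω := ω) (b := b) μ
  -- an equivariant map sends all of `H ⊗ H` to the range if it sends three generators there
  have htwo : ∀ A : Module.End ℚ (TensorAlgebra ℚ H),
      (∀ (a : Sp ω) t, tensorRep ω a (A t) = A (tensorRep ω a t)) →
      A (highestVector b yd11) ∈ LinearMap.range (summandsMap ω b) →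
      A (highestVector b yd2) ∈ LinearMap.range (summandsMap ω b) →
      A (symplecticClass b) ∈ LinearMap.range (summandsMap ω b) →
      ∀ t ∈ degree H 2, A t ∈ LinearMap.range (summandsMap ω b) := by
    intro A hA h11 h2 h0 t ht
    have := degree_two_le hb hg
      (W := degree H 2 ⊓ (LinearMap.range (summandsMap ω b)).comap A) inf_le_left
      (fun a t ht => Submodule.mem_inf.2 ⟨tensorRep_mem_degree a t ht.1, by
        rw [Submodule.mem_comap, ← hA]
        exact hst a _ ht.2⟩)
      ⟨highestVector_yd11_mem hg, h11⟩ ⟨highestVector_yd2_mem hg, h2⟩ ⟨symplecticClass_mem, h0⟩ ht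
    exact this.2
  refine le_antisymm hle (cyclicTensors_le hb hg hle hst
    (htwo _ (tensorRep_insertAdjacent hb) ?_ ?_ ?_) (htwo _ (tensorRep_insertOpposite hb) ?_ ?_ ?_)
    fun i j k l => cycX_mem_of_highestVector hb hg hst ?_ ?_ ?_ ![i, j, k, l])
  · exact ⟨(0, ⟨_, hhv yd11⟩, 0, 0, 0, 0, 0), by rw [summandsMap_apply]; simp⟩
  · exact ⟨(0, 0, 0, ⟨_, hhv yd2⟩, 0, 0, 0), by rw [summandsMap_apply]; simp⟩
  · exact ⟨(1, 0, 0, 0, 0, 0, 0), by rw [summandsMap_apply]; simp⟩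
  · exact ⟨(0, 0, ⟨_, hhv yd11⟩, 0, 0, 0, 0), by rw [summandsMap_apply]; simp⟩
  · rw [insertOpposite_of_mem_yd2 hg (hhv yd2)]
    exact zero_mem _
  · rw [insertOpposite_symplecticClass]
    exact zero_mem _
  · exact ⟨(0, 0, 0, 0, 0, 0, ⟨_, hhv yd4⟩), by rw [summandsMap_apply]; simp⟩
  · exact ⟨(0, 0, 0, 0, ⟨_, hhv yd22⟩, 0, 0), by rw [summandsMap_apply]; simp⟩
  · exact ⟨(0, 0, 0, 0, 0, ⟨_, hhv yd211⟩, 0), by rw [summandsMap_apply]; simp⟩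

theorem nonempty_equiv_prod (hb : IsSymplecticBasis ω b) (hg : 4 ≤ g) :
    Nonempty (((symplecticDerivationsRep hb 2).toRepresentation).Equiv
      ((Representation.trivial ℚ (Sp ω) ℚ).prod <|
        (irrep ω b yd11).toRepresentation.prod <| (irrep ω b yd11).toRepresentation.prod <|
        (irrep ω b yd2).toRepresentation.prod <| (irrep ω b yd22).toRepresentation.prod <|
        (irrep ω b yd211).toRepresentation.prod (irrep ω b yd4).toRepresentation)) := by
  have h1 : LinearMap.range (poincareDualMap b ∘ₗ
      (symplecticDerivationsRep hb 2).toSubmodule.subtype) = _ :=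
    (range_poincareDualMap b).trans (range_summandsMap hb hg).symm
  have h2 : Function.Injective (poincareDualMap b ∘ₗ
      (symplecticDerivationsRep hb 2).toSubmodule.subtype) := poincareDualMap_injective b 2
  obtain ⟨Φ, -⟩ := exists_equiv_of_range_eq
    (ρM := (symplecticDerivationsRep hb 2).toRepresentation)
    (ρN := (Representation.trivial ℚ (Sp ω) ℚ).prod <|
        (irrep ω b yd11).toRepresentation.prod <| (irrep ω b yd11).toRepresentation.prod <|
        (irrep ω b yd2).toRepresentation.prod <| (irrep ω b yd22).toRepresentation.prod <|
        (irrep ω b yd211).toRepresentation.prod (irrep ω b yd4).toRepresentation) (tensorRep ω)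
    (f := poincareDualMap b ∘ₗ (symplecticDerivationsRep hb 2).toSubmodule.subtype)
    (f' := summandsMap ω b) h2 (summandsMap_injective hb hg) h1
    (fun a D => by
      simp only [LinearMap.comp_apply, Submodule.subtype_apply, coe_toRepresentation_apply]
      exact poincareDual_conj hb a _)
    (summandsMap_equivariant hb)
  exact ⟨Φ⟩

end Decomposition

end

end SympDer

theorem proposition4p2 {H : Type*} [AddCommGroup H] [Module ℚ H] (g : ℕ) (hg : 4 ≤ g)
    (ω : LinearMap.BilinForm ℚ H) (b : Module.Basis (Fin g ⊕ Fin g) ℚ H)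
    (hb : SympDer.IsSymplecticBasis ω b) :
    -- `𝔞_g(2) ≅ (H^{⊗4})^{ℤ/4}` through Poincaré duality
    (∃ Φ : ((SympDer.symplecticDerivationsRep hb 2).toRepresentation).Equiv
        (SympDer.cyclicInvariants ω 4).toRepresentation,
      ∀ D, TensorPower.toTensorAlgebra (Φ D : ⨂[ℚ]^4 H) = SympDer.poincareDual b D) ∧
    -- `𝔞_g(2) ≅ ℚ ⊕ 2[1²] ⊕ [2] ⊕ [2²] ⊕ [21²] ⊕ [4]`
    Nonempty (((SympDer.symplecticDerivationsRep hb 2).toRepresentation).Equiv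
      ((Representation.trivial ℚ (SympDer.Sp ω) ℚ).prod <|
        (SympDer.irrep ω b SympDer.yd11).toRepresentation.prod <|
        (SympDer.irrep ω b SympDer.yd11).toRepresentation.prod <|
        (SympDer.irrep ω b SympDer.yd2).toRepresentation.prod <|
        (SympDer.irrep ω b SympDer.yd22).toRepresentation.prod <|
        (SympDer.irrep ω b SympDer.yd211).toRepresentation.prod
        (SympDer.irrep ω b SympDer.yd4).toRepresentation)) ∧
    -- `[μ]` is indeed the irreducible representation of highest weight `μ`
    (∀ μ ∈ ({SympDer.yd11, SympDer.yd2, SympDer.yd22, SympDer.yd211, SympDer.yd4} :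
        Set YoungDiagram),
      SympDer.IsIrreducibleOfHighestWeight b (SympDer.irrep ω b μ).toRepresentation μ) :=
  ⟨SympDer.exists_equiv_cyclicInvariants hb, SympDer.nonempty_equiv_prod hb hg,
    fun _ hμ => SympDer.isIrreducibleOfHighestWeight hb hg hμ⟩
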